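/- Let $K$ be a field of characteristic $0$, let $L/K$ be a finite field extension, and let $G=\operatorname{Spec}A$ be an affine $K$-groupoid acting on $\operatorname{Spec}L$ (with source and target morphisms $s,t:G\to\operatorname{Spec}L$). Let $U$ be a unipotent algebraic group over $L$ with an action of $G$: every point $g$ of $G$ with values in a $K$-scheme $T$ induces an isomorphism of group schemes $\rho(g):s(g)^*U\to t(g)^*U$ over $T$, compatibly with base change and with composition in $G$. For a $K$-algebra $R$ let $H^1(G_R,U_R)$ be the set of isomorphism classes of $G_R$-equivariant torsors under $U_R$ over $R\otimes_K L$, and let $\underline H^1(G,U)$ be the functor $R\mapsto H^1(G_R,U_R)$ on $K$-algebras. Let $H^0(G,U)$ be the group of all $u\in U(L)$ with $\rho(g)(s(g)^*u)=t(g)^*u$ for all points $g$ of $G$. Let $U^1=U$, $U^{i+1}=[U^i,U]$ be the lower central series of $U$, and put $U_n=U/U^n$. Each $U^i/U^{i+1}$ is the vector scheme associated to a finite dimensional representation of $G$; write $H^1(G,U^i/U^{i+1})$ for the cohomology of this representation ($1$-cocycles modulo $1$-coboundaries), which is a $K$-vector space. Assume that for every $i\ge 1$ the group $H^0(G,U^i/U^{i+1})$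 is trivial and $H^1(G,U^i/U^{i+1})$ is finite dimensional over $K$. Then for every $n\ge 1$ the functor $\underline H^1(G,U_n)$ is represented by an affine scheme of finite type over $K$, of dimension at most $\sum_{i=1}^{n-1}\dim_K H^1(G,U^i/U^{i+1})$. -/

import Mathlib

open scoped TensorProduct
universe u

/-- The points of the affine scheme `Spec B` over `Spec Λ` with values in `T`,
lying over the point `x : Λ →+* T` of `Spec Λ`. -/
@[ext] structure Pt {Λ : Type u} [CommRing Λ] (B : Type u) [CommRing B] [Algebra Λ B]
    {T : Type u} [CommRing T] (x : Λ →+* T) where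
  hom : B →+* T
  base : ∀ l : Λ, hom (algebraMap Λ B l) = x l

namespace Pt

section Basic

variable {Λ : Type u} [CommRing Λ] {B C : Type u} [CommRing B] [Algebra Λ B]
  [CommRing C] [Algebra Λ C] {T T' : Type u} [CommRing T] [CommRing T'] {x : Λ →+* T}

/-- Functoriality of points in the test ring. -/
def map (u : Pt B x) (f : T →+* T') : Pt B (f.comp x) :=
  ⟨f.comp u.hom, fun l => congrArg f (u.base l)⟩

/-- Functoriality of points in the scheme. -/
def res (u : Pt C x) (f : B →ₐ[Λ] C) : Pt B x :=
  ⟨u.hom.comp f.toRingHom, fun l => by simpa using u.base l⟩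

/-- Points over `x` are the algebra homomorphisms to `T`, regarded as an algebra through `x`. -/
def equivAlgHom (x : Λ →+* T) :
    Pt B x ≃ letI := x.toAlgebra; WithConv (B →ₐ[Λ] T) :=
  letI := x.toAlgebra
  { toFun := fun u => WithConv.toConv { u.hom with commutes' := u.base }
    invFun := fun u => ⟨u.ofConv.toRingHom, u.ofConv.commutes⟩
    left_inv := fun _ => rfl
    right_inv := fun _ => rfl }

/-- The point of a fibre product defined by a pair of points. -/
def pair (u : Pt B x) (v : Pt C x) : Pt (B ⊗[Λ] C) x :=
  letI := x.toAlgebra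
  ⟨(Algebra.TensorProduct.lift (equivAlgHom x u).ofConv (equivAlgHom x v).ofConv
      (fun _ _ => Commute.all _ _)).toRingHom, fun l => by
        exact AlgHom.commutes _ l⟩

@[simp] lemma pair_tmul (u : Pt B x) (v : Pt C x) (b : B) (c : C) :
    (pair u v).hom (b ⊗ₜ c) = u.hom b * v.hom c := by
  let _ := x.toAlgebra
  simp [pair, equivAlgHom]

@[simp] lemma map_hom (u : Pt B x) (f : T →+* T') (b : B) : (u.map f).hom b = f (u.hom b) := rfl
@[simp] lemma res_hom (u : Pt C x) (f : B →ₐ[Λ] C) (b : B) : (u.res f).hom b = u.hom (f b) := rfl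

lemma ext' {u v : Pt B x} (h : ∀ b, u.hom b = v.hom b) : u = v := Pt.ext (RingHom.ext h)

end Basic

section Group

variable {Λ : Type u} [CommRing Λ] {H : Type u} [CommRing H] [HopfAlgebra Λ H]
  {T T' : Type u} [CommRing T] [CommRing T'] {x : Λ →+* T}

noncomputable instance : Monoid (Pt H x) :=
  letI := x.toAlgebra
  (equivAlgHom x).monoid

lemma mul_hom (u v : Pt H x) (f : H) :
    (u * v).hom f = (pair u v).hom (Coalgebra.comul (R := Λ) f) := by
  let _ := x.toAlgebra
  exact AlgHom.convMul_apply (equivAlgHom x u) (equivAlgHom x v) f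

lemma one_hom (f : H) : (1 : Pt H x).hom f = x (Coalgebra.counit (R := Λ) f) := rfl

noncomputable instance : Inv (Pt H x) := ⟨fun u => u.res (HopfAlgebra.antipodeAlgHom Λ H)⟩

lemma inv_hom (u : Pt H x) (f : H) : (u⁻¹).hom f = u.hom (HopfAlgebra.antipode Λ f) := rfl

/-- The group law on the points of an affine group scheme: convolution of homomorphisms
out of its Hopf algebra. -/
noncomputable instance : Group (Pt H x) where
  inv_mul_cancel u := by
    apply ext'
    intro f
    have key : ∀ z : H ⊗[Λ] H, (pair u⁻¹ u).hom z =
        u.hom (LinearMap.mul' Λ H ((HopfAlgebra.antipode Λ).rTensor H z)) := by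
      intro z
      induction z with
      | zero => simp
      | tmul a b => simp [inv_hom]
      | add a b ha hb => simp only [map_add, ha, hb]
    rw [mul_hom, key, HopfAlgebra.mul_antipode_rTensor_comul_apply, u.base, one_hom]

lemma pair_map {B C : Type u} [CommRing B] [Algebra Λ B] [CommRing C] [Algebra Λ C]
    (u : Pt B x) (v : Pt C x) (f : T →+* T') :
    (pair u v).map f = pair (u.map f) (v.map f) := by
  apply ext'
  intro z
  induction z with
  | zero => simp
  | tmul a b => simp
  | add a b ha hb => rw [map_add, map_add, ha, hb]

lemma map_mul (u v : Pt H x) (f : T →+* T') : (u * v).map f = u.map f * v.map f := by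
  apply ext'
  intro b
  rw [mul_hom, map_hom, mul_hom, ← pair_map]
  rfl

lemma map_one (f : T →+* T') : (1 : Pt H x).map f = 1 := ext' fun _ => rfl
lemma map_inv (u : Pt H x) (f : T →+* T') : (u⁻¹).map f = (u.map f)⁻¹ := ext' fun _ => rfl

end Group
end Pt

/-- The `T`-points of a scheme `Spec A` with source and target morphisms `s, t` to `Spec L`,
having source `x` and target `y`. -/
@[ext] structure Arr {K L : Type u} [CommRing K] [CommRing L] [Algebra K L]
    {A : Type u} [CommRing A] [Algebra K A] (s t : L →ₐ[K] A)
    {T : Type u} [CommRing T] [Algebra K T] (x y : L →ₐ[K] T) where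
  hom : A →ₐ[K] T
  source : ∀ l : L, hom (s l) = x l
  target : ∀ l : L, hom (t l) = y l

namespace Arr

variable {K L : Type u} [CommRing K] [CommRing L] [Algebra K L]
    {A : Type u} [CommRing A] [Algebra K A] {s t : L →ₐ[K] A}
    {T T' : Type u} [CommRing T] [Algebra K T] [CommRing T'] [Algebra K T'] {x y : L →ₐ[K] T}

/-- Functoriality of arrows in the test ring. -/
def map (g : Arr s t x y) (f : T →ₐ[K] T') : Arr s t (f.comp x) (f.comp y) :=
  ⟨f.comp g.hom, fun l => congrArg f (g.source l), fun l => congrArg f (g.target l)⟩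

end Arr

/-- An affine `K`-groupoid `G = Spec A` acting on `Spec L`. The law of composition, a morphism of
schemes `G ×_{s, Spec L, t} G ⟶ G` over `Spec L ×_K Spec L`, is given by its effect on points
with values in `K`-algebras `T` (composable pairs `y ⟶ z`, `x ⟶ y` are sent to an arrow `x ⟶ z`,
naturally in `T`), and it has to make the `T`-points into a groupoid. -/
structure AffineGroupoid (K L : Type u) [Field K] [Field L] [Algebra K L] where
  A : Type u
  [commRing : CommRing A]
  [algebra : Algebra K A]
  s : L →ₐ[K] A
  t : L →ₐ[K] A
  comp : ∀ {T : Type u} [CommRing T] [Algebra K T] {x y z : L →ₐ[K] T},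
    Arr s t y z → Arr s t x y → Arr s t x z
  comp_map : ∀ {T T' : Type u} [CommRing T] [Algebra K T] [CommRing T'] [Algebra K T']
    (f : T →ₐ[K] T') {x y z : L →ₐ[K] T} (g : Arr s t y z) (h : Arr s t x y),
    (comp g h).map f = comp (g.map f) (h.map f)
  assoc : ∀ {T : Type u} [CommRing T] [Algebra K T] {w x y z : L →ₐ[K] T}
    (g : Arr s t y z) (h : Arr s t x y) (k : Arr s t w x),
    comp (comp g h) k = comp g (comp h k)
  one : ∀ {T : Type u} [CommRing T] [Algebra K T] (x : L →ₐ[K] T), Arr s t x x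
  one_comp : ∀ {T : Type u} [CommRing T] [Algebra K T] {x y : L →ₐ[K] T}
    (g : Arr s t x y), comp (one y) g = g
  comp_one : ∀ {T : Type u} [CommRing T] [Algebra K T] {x y : L →ₐ[K] T}
    (g : Arr s t x y), comp g (one x) = g
  inv : ∀ {T : Type u} [CommRing T] [Algebra K T] {x y : L →ₐ[K] T},
    Arr s t x y → Arr s t y x
  inv_comp : ∀ {T : Type u} [CommRing T] [Algebra K T] {x y : L →ₐ[K] T}
    (g : Arr s t x y), comp (inv g) g = one x
  comp_inv : ∀ {T : Type u} [CommRing T] [Algebra K T] {x y : L →ₐ[K] T}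
    (g : Arr s t x y), comp g (inv g) = one y

namespace AffineGroupoid

variable {K L : Type u} [Field K] [Field L] [Algebra K L] (G : AffineGroupoid K L)

attribute [instance] commRing algebra

/-- `G.Hom x y` is the set of points of `G` with values in `T`, source `x` and target `y`. -/
abbrev Hom {T : Type u} [CommRing T] [Algebra K T] (x y : L →ₐ[K] T) : Type u := Arr G.s G.t x y

/-- The coordinate ring of `G` is an `L`-algebra through the source morphism. -/
instance : Algebra L G.A := G.s.toRingHom.toAlgebra

/-- The universal arrow. -/
def univ : G.Hom G.s G.t := ⟨AlgHom.id K G.A, fun _ => rfl, fun _ => rfl⟩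

end AffineGroupoid

/-- An affine group scheme `Spec O` over `L`, given by its Hopf algebra `O`, with an action of the
groupoid `G`: every arrow `g : x ⟶ y` of `G` with values in `T` induces a homomorphism
`ρ(g)` from the fibre over `x` to the fibre over `y`, compatibly with base change and with the
composition of arrows. -/
structure EquivariantGroup {K L : Type u} [Field K] [Field L] [Algebra K L]
    (G : AffineGroupoid K L) where
  O : Type u
  [commRing : CommRing O]
  [hopf : HopfAlgebra L O]
  act : ∀ {T : Type u} [CommRing T] [Algebra K T] {x y : L →ₐ[K] T},
    G.Hom x y → (Pt O (x : L →+* T) →* Pt O (y : L →+* T))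
  act_map : ∀ {T T' : Type u} [CommRing T] [Algebra K T] [CommRing T'] [Algebra K T']
    (f : T →ₐ[K] T') {x y : L →ₐ[K] T} (g : G.Hom x y) (u : Pt O (x : L →+* T)),
    (act g u).map (f : T →+* T') = act (g.map f) (u.map (f : T →+* T'))
  act_one : ∀ {T : Type u} [CommRing T] [Algebra K T] (x : L →ₐ[K] T) (u : Pt O (x : L →+* T)),
    act (G.one x) u = u
  act_comp : ∀ {T : Type u} [CommRing T] [Algebra K T] {x y z : L →ₐ[K] T}
    (g : G.Hom y z) (h : G.Hom x y) (u : Pt O (x : L →+* T)),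
    act (G.comp g h) u = act g (act h u)

namespace EquivariantGroup

variable {K L : Type u} [Field K] [Field L] [Algebra K L] {G : AffineGroupoid K L}

attribute [instance] commRing hopf

/-- The base change to `T`, along `x : L →ₐ[K] T`, of an `L`-valued point. -/
def pull (W : EquivariantGroup G) (u : Pt W.O (RingHom.id L)) {T : Type u} [CommRing T]
    [Algebra K T] (x : L →ₐ[K] T) : Pt W.O (x : L →+* T) :=
  u.map (x : L →+* T)

/-- `H⁰(G, W)`: the `L`-valued points `u` of `W` with `ρ(g) (s(g)^* u) = t(g)^* u` for all
points `g` of `G`. -/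
def H0 (W : EquivariantGroup G) : Subgroup (Pt W.O (RingHom.id L)) where
  carrier := {u | ∀ {T : Type u} [CommRing T] [Algebra K T] {x y : L →ₐ[K] T} (g : G.Hom x y),
    W.act g (W.pull u x) = W.pull u y}
  mul_mem' {u v} hu hv T _ _ x y g := by
    have h1 : W.pull (u * v) x = W.pull u x * W.pull v x := Pt.map_mul u v _
    have h2 : W.pull (u * v) y = W.pull u y * W.pull v y := Pt.map_mul u v _
    rw [h1, h2, _root_.map_mul, hu g, hv g]
  one_mem' {T _ _ x y} g := by
    have h1 : W.pull 1 x = 1 := Pt.map_one _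
    have h2 : W.pull 1 y = 1 := Pt.map_one _
    rw [h1, h2, _root_.map_one]
  inv_mem' {u} hu T _ _ x y g := by
    have h1 : W.pull u⁻¹ x = (W.pull u x)⁻¹ := Pt.map_inv u _
    have h2 : W.pull u⁻¹ y = (W.pull u y)⁻¹ := Pt.map_inv u _
    rw [h1, h2, _root_.map_inv, hu g]

end EquivariantGroup

/-- A unipotent algebraic group over `L`, given by its Hopf algebra `O`: it is of finite type, and
every nonzero finite dimensional representation (i.e. `O`-comodule) has a nonzero fixed vector. -/
def IsUnipotentGroup (L : Type u) [Field L] (O : Type u) [CommRing O] [HopfAlgebra L O] : Prop :=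
  Algebra.FiniteType L O ∧
  ∀ (V : Type u) [AddCommGroup V] [Module L V] [Module.Finite L V] [Nontrivial V]
    (c : V →ₗ[L] V ⊗[L] O),
    (TensorProduct.assoc L V O O).toLinearMap ∘ₗ c.rTensor O ∘ₗ c =
      (Coalgebra.comul (R := L) (A := O)).lTensor V ∘ₗ c →
    (TensorProduct.rid L V).toLinearMap ∘ₗ (Coalgebra.counit (R := L) (A := O)).lTensor V ∘ₗ c =
      LinearMap.id →
    ∃ v : V, v ≠ 0 ∧ c v = v ⊗ₜ 1

/-! ### Equivariant torsors and the cohomology functor -/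

/-- The `T`-points of an affine scheme `Spec B` over `R ⊗[K] L`, lying over the point of
`Spec (R ⊗[K] L)` given by `φ : R →ₐ[K] T` and `x : L →ₐ[K] T`. -/
@[ext] structure TPt {K L R : Type u} [Field K] [Field L] [Algebra K L] [CommRing R] [Algebra K R]
    (B : Type u) [CommRing B] [Algebra (R ⊗[K] L) B]
    {T : Type u} [CommRing T] [Algebra K T] (φ : R →ₐ[K] T) (x : L →ₐ[K] T) where
  hom : B →+* T
  base : ∀ (r : R) (l : L), hom (algebraMap (R ⊗[K] L) B (r ⊗ₜ l)) = φ r * x l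

namespace TPt

variable {K L R : Type u} [Field K] [Field L] [Algebra K L] [CommRing R] [Algebra K R]
  {B B' : Type u} [CommRing B] [Algebra (R ⊗[K] L) B] [CommRing B'] [Algebra (R ⊗[K] L) B']
  {T T' : Type u} [CommRing T] [Algebra K T] [CommRing T'] [Algebra K T']
  {φ : R →ₐ[K] T} {x : L →ₐ[K] T}

/-- Functoriality of points in the test ring. -/
def map (p : TPt B φ x) (f : T →ₐ[K] T') : TPt B (f.comp φ) (f.comp x) :=
  ⟨(f : T →+* T').comp p.hom, fun r l => by simp [p.base]⟩

/-- Functoriality of points in the scheme. -/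
def res (p : TPt B' φ x) (e : B →ₐ[R ⊗[K] L] B') : TPt B φ x :=
  ⟨p.hom.comp e.toRingHom, fun r l => by simp [p.base]⟩

end TPt

/-- For a `K`-algebra `R`, a `G_R`-equivariant torsor `P = Spec B` under `W_R`. Here `G_R` is the
`R`-groupoid acting on `Spec (R ⊗[K] L)` and `W_R` the group scheme over `R ⊗[K] L` obtained by
base change: for an `R`-algebra `T` (with structure morphism `φ`) their `T`-points are
those of `G` and `W`. The scheme `P` is faithfully flat over `R ⊗[K] L`, and `W_R` acts on it
from the right, simply transitively; `G_R` acts on `P`, compatibly with its action on `W_R`. -/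
structure EquivariantTorsor {K L : Type u} [Field K] [Field L] [Algebra K L]
    {G : AffineGroupoid K L} (W : EquivariantGroup G) (R : Type u) [CommRing R] [Algebra K R] where
  B : Type u
  [commRing : CommRing B]
  [algebra : Algebra (R ⊗[K] L) B]
  faithfullyFlat : Module.FaithfullyFlat (R ⊗[K] L) B
  smul : ∀ {T : Type u} [CommRing T] [Algebra K T] {φ : R →ₐ[K] T} {x : L →ₐ[K] T},
    TPt B φ x → Pt W.O (x : L →+* T) → TPt B φ x
  smul_map : ∀ {T T' : Type u} [CommRing T] [Algebra K T] [CommRing T'] [Algebra K T']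
    (f : T →ₐ[K] T') {φ : R →ₐ[K] T} {x : L →ₐ[K] T} (p : TPt B φ x) (u : Pt W.O (x : L →+* T)),
    (smul p u).map f = smul (p.map f) (u.map (f : T →+* T'))
  smul_one : ∀ {T : Type u} [CommRing T] [Algebra K T] {φ : R →ₐ[K] T} {x : L →ₐ[K] T}
    (p : TPt B φ x), smul p 1 = p
  smul_mul : ∀ {T : Type u} [CommRing T] [Algebra K T] {φ : R →ₐ[K] T} {x : L →ₐ[K] T}
    (p : TPt B φ x) (u v : Pt W.O (x : L →+* T)), smul p (u * v) = smul (smul p u) v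
  existsUnique_smul_eq : ∀ {T : Type u} [CommRing T] [Algebra K T] {φ : R →ₐ[K] T}
    {x : L →ₐ[K] T} (p q : TPt B φ x), ∃! u : Pt W.O (x : L →+* T), smul p u = q
  act : ∀ {T : Type u} [CommRing T] [Algebra K T] {φ : R →ₐ[K] T} {x y : L →ₐ[K] T},
    G.Hom x y → TPt B φ x → TPt B φ y
  act_map : ∀ {T T' : Type u} [CommRing T] [Algebra K T] [CommRing T'] [Algebra K T']
    (f : T →ₐ[K] T') {φ : R →ₐ[K] T} {x y : L →ₐ[K] T} (g : G.Hom x y) (p : TPt B φ x),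
    (act g p).map f = act (g.map f) (p.map f)
  act_one : ∀ {T : Type u} [CommRing T] [Algebra K T] {φ : R →ₐ[K] T} {x : L →ₐ[K] T}
    (p : TPt B φ x), act (G.one x) p = p
  act_comp : ∀ {T : Type u} [CommRing T] [Algebra K T] {φ : R →ₐ[K] T} {x y z : L →ₐ[K] T}
    (g : G.Hom y z) (h : G.Hom x y) (p : TPt B φ x), act (G.comp g h) p = act g (act h p)
  act_smul : ∀ {T : Type u} [CommRing T] [Algebra K T] {φ : R →ₐ[K] T} {x y : L →ₐ[K] T}
    (g : G.Hom x y) (p : TPt B φ x) (u : Pt W.O (x : L →+* T)),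
    act g (smul p u) = smul (act g p) (W.act g u)

namespace EquivariantTorsor

variable {K L : Type u} [Field K] [Field L] [Algebra K L] {G : AffineGroupoid K L}
  {W : EquivariantGroup G} {R R' : Type u} [CommRing R] [Algebra K R] [CommRing R'] [Algebra K R']

attribute [instance] commRing algebra

/-- Isomorphism of equivariant torsors. -/
def Iso (P Q : EquivariantTorsor W R) : Prop :=
  ∃ e : P.B ≃ₐ[R ⊗[K] L] Q.B,
    (∀ {T : Type u} [CommRing T] [Algebra K T] {φ : R →ₐ[K] T} {x : L →ₐ[K] T}
      (q : TPt Q.B φ x) (u : Pt W.O (x : L →+* T)),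
      (Q.smul q u).res e.toAlgHom = P.smul (q.res e.toAlgHom) u) ∧
    (∀ {T : Type u} [CommRing T] [Algebra K T] {φ : R →ₐ[K] T} {x y : L →ₐ[K] T}
      (g : G.Hom x y) (q : TPt Q.B φ x),
      (Q.act g q).res e.toAlgHom = P.act g (q.res e.toAlgHom))

lemma res_res_symm {P Q : EquivariantTorsor W R} (e : P.B ≃ₐ[R ⊗[K] L] Q.B)
    {T : Type u} [CommRing T] [Algebra K T] {φ : R →ₐ[K] T} {x : L →ₐ[K] T}
    (p : TPt P.B φ x) : (p.res e.symm.toAlgHom).res e.toAlgHom = p :=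
  TPt.ext (RingHom.ext fun b => by simp [TPt.res])

lemma res_symm_res {P Q : EquivariantTorsor W R} (e : P.B ≃ₐ[R ⊗[K] L] Q.B)
    {T : Type u} [CommRing T] [Algebra K T] {φ : R →ₐ[K] T} {x : L →ₐ[K] T}
    (p : TPt Q.B φ x) : (p.res e.toAlgHom).res e.symm.toAlgHom = p :=
  TPt.ext (RingHom.ext fun b => by simp [TPt.res])

variable (W R) in
/-- Isomorphism of equivariant torsors is an equivalence relation. -/
def setoid : Setoid (EquivariantTorsor W R) where
  r := Iso
  iseqv :=
    { refl := fun _ => ⟨AlgEquiv.refl, fun _ _ => rfl, fun _ _ => rfl⟩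
      symm := by
        rintro P Q ⟨e, h1, h2⟩
        refine ⟨e.symm, fun q u => ?_, fun g q => ?_⟩
        · have := h1 (q.res e.symm.toAlgHom) u
          rw [res_res_symm] at this
          rw [← this, res_symm_res]
        · have := h2 g (q.res e.symm.toAlgHom)
          rw [res_res_symm] at this
          rw [← this, res_symm_res]
      trans := by
        rintro P Q S ⟨e, h1, h2⟩ ⟨f, h3, h4⟩
        refine ⟨e.trans f, fun q u => ?_, fun g q => ?_⟩
        · have := congrArg (fun p => p.res e.toAlgHom) (h3 q u)
          exact this.trans (h1 _ u)
        · have := congrArg (fun p => p.res e.toAlgHom) (h4 g q)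
          exact this.trans (h2 g _) }

end EquivariantTorsor

namespace TPt

variable {K L : Type u} [Field K] [Field L] [Algebra K L]
  {R R' : Type u} [CommRing R] [Algebra K R] [CommRing R'] [Algebra K R']
  [Algebra (R ⊗[K] L) (R' ⊗[K] L)] {f : R →ₐ[K] R'}
  (hf : algebraMap (R ⊗[K] L) (R' ⊗[K] L) = (Algebra.TensorProduct.map f (AlgHom.id K L)).toRingHom)
  {B : Type u} [CommRing B] [Algebra (R ⊗[K] L) B]
  {T T' : Type u} [CommRing T] [Algebra K T] [CommRing T'] [Algebra K T']
  {x : L →ₐ[K] T}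

lemma base_eq {φ : R →ₐ[K] T} (p : TPt B φ x) (z : R ⊗[K] L) :
    p.hom (algebraMap (R ⊗[K] L) B z) =
      Algebra.TensorProduct.lift φ x (fun _ _ => Commute.all _ _) z := by
  induction z with
  | zero => simp
  | tmul r l => simp [p.base]
  | add a b ha hb => simp only [map_add, ha, hb]

variable {φ : R' →ₐ[K] T}

/-- A point of the base change of a scheme gives a point of the original scheme. -/
def toPt (p : TPt ((R' ⊗[K] L) ⊗[R ⊗[K] L] B) φ x) : TPt B (φ.comp f) x :=
  ⟨p.hom.comp (Algebra.TensorProduct.includeRight :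
      B →ₐ[R ⊗[K] L] (R' ⊗[K] L) ⊗[R ⊗[K] L] B).toRingHom, fun r l => by
    have h : (Algebra.TensorProduct.includeRight : B →ₐ[R ⊗[K] L] (R' ⊗[K] L) ⊗[R ⊗[K] L] B)
        (algebraMap (R ⊗[K] L) B (r ⊗ₜ l)) =
        algebraMap (R' ⊗[K] L) ((R' ⊗[K] L) ⊗[R ⊗[K] L] B) (f r ⊗ₜ l) := by
      rw [AlgHom.commutes, IsScalarTower.algebraMap_apply (R ⊗[K] L) (R' ⊗[K] L), hf]
      simp
    exact (congrArg p.hom h).trans (p.base _ _)⟩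

/-- A point of a scheme gives a point of its base change. -/
noncomputable def ofPt (p : TPt B (φ.comp f) x) : TPt ((R' ⊗[K] L) ⊗[R ⊗[K] L] B) φ x :=
  let y : R' ⊗[K] L →ₐ[K] T := Algebra.TensorProduct.lift φ x (fun _ _ => Commute.all _ _)
  letI := (y.toRingHom.comp (algebraMap (R ⊗[K] L) (R' ⊗[K] L))).toAlgebra
  let h1 : (R' ⊗[K] L) →ₐ[R ⊗[K] L] T := { y.toRingHom with commutes' := fun _ => rfl }
  let h2 : B →ₐ[R ⊗[K] L] T := { p.hom with
    commutes' := fun z => by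
      refine (base_eq p z).trans ?_
      change _ = y (algebraMap (R ⊗[K] L) (R' ⊗[K] L) z)
      rw [hf]
      change _ = (y.comp (Algebra.TensorProduct.map f (AlgHom.id K L))) z
      congr 1
      ext <;> simp [y] }
  { hom := (Algebra.TensorProduct.lift h1 h2 (fun _ _ => Commute.all _ _)).toRingHom
    base := fun r l => by
      refine (Algebra.TensorProduct.lift_tmul h1 h2 (fun _ _ => Commute.all _ _) _ _).trans ?_
      rw [_root_.map_one, mul_one]
      change y (r ⊗ₜ l) = _
      simp [y] }

lemma toPt_ofPt (p : TPt B (φ.comp f) x) : toPt hf (ofPt hf p) = p := by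
  refine TPt.ext (RingHom.ext fun b => ?_)
  let y : R' ⊗[K] L →ₐ[K] T := Algebra.TensorProduct.lift φ x (fun _ _ => Commute.all _ _)
  let _ := (y.toRingHom.comp (algebraMap (R ⊗[K] L) (R' ⊗[K] L))).toAlgebra
  refine (Algebra.TensorProduct.lift_tmul _ _ (fun _ _ => Commute.all _ _) _ _).trans ?_
  rw [_root_.map_one, one_mul]
  rfl

lemma toPt_injective : Function.Injective
    (toPt hf : TPt ((R' ⊗[K] L) ⊗[R ⊗[K] L] B) φ x → TPt B (φ.comp f) x) := by
  intro p q h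
  refine TPt.ext (RingHom.ext fun b => ?_)
  induction b with
  | zero => rw [_root_.map_zero, _root_.map_zero]
  | add a b ha hb => rw [_root_.map_add, _root_.map_add, ha, hb]
  | tmul a b =>
    have h1 : (a ⊗ₜ b : (R' ⊗[K] L) ⊗[R ⊗[K] L] B) =
        algebraMap (R' ⊗[K] L) ((R' ⊗[K] L) ⊗[R ⊗[K] L] B) a * (1 ⊗ₜ b) := by
      simp [Algebra.TensorProduct.algebraMap_apply]
    have h2 : p.hom (1 ⊗ₜ b) = q.hom (1 ⊗ₜ b) := congrArg (fun p => p.hom b) h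
    rw [h1, _root_.map_mul, _root_.map_mul, h2, base_eq, base_eq]

lemma ofPt_toPt (p : TPt ((R' ⊗[K] L) ⊗[R ⊗[K] L] B) φ x) : ofPt hf (toPt hf p) = p :=
  toPt_injective hf (toPt_ofPt hf _)

lemma ofPt_map (p : TPt B (φ.comp f) x) (h : T →ₐ[K] T') :
    (ofPt hf p).map h = ofPt hf (φ := h.comp φ) (p.map h : TPt B (h.comp (φ.comp f)) (h.comp x)) :=
  toPt_injective hf <|
    (congrArg (fun q => q.map h) (toPt_ofPt hf p)).trans
      (toPt_ofPt hf (φ := h.comp φ) (p.map h : TPt B (h.comp (φ.comp f)) (h.comp x))).symm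

lemma toPt_res {B' : Type u} [CommRing B'] [Algebra (R ⊗[K] L) B']
    (e : B ≃ₐ[R ⊗[K] L] B') (p : TPt ((R' ⊗[K] L) ⊗[R ⊗[K] L] B') φ x) :
    toPt hf (p.res (Algebra.TensorProduct.congr
      (AlgEquiv.refl : (R' ⊗[K] L) ≃ₐ[R' ⊗[K] L] (R' ⊗[K] L)) e).toAlgHom) =
      (toPt hf p).res e.toAlgHom :=
  TPt.ext (RingHom.ext fun _ => congrArg p.hom (Algebra.TensorProduct.map_tmul _ _ _ _))

end TPt

namespace EquivariantTorsor

variable {K L : Type u} [Field K] [Field L] [Algebra K L] {G : AffineGroupoid K L}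
  {W : EquivariantGroup G} {R R' : Type u} [CommRing R] [Algebra K R] [CommRing R'] [Algebra K R']
  [Algebra (R ⊗[K] L) (R' ⊗[K] L)] {f : R →ₐ[K] R'}
  (hf : algebraMap (R ⊗[K] L) (R' ⊗[K] L) = (Algebra.TensorProduct.map f (AlgHom.id K L)).toRingHom)

open TPt

/-- The base change of an equivariant torsor along a homomorphism of `K`-algebras. -/
noncomputable def baseChange (P : EquivariantTorsor W R) : EquivariantTorsor W R' where
  B := (R' ⊗[K] L) ⊗[R ⊗[K] L] P.B
  faithfullyFlat := by
    have := P.faithfullyFlat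
    infer_instance
  smul p u := ofPt hf (P.smul (toPt hf p) u)
  smul_map h φ x p u := by
    rw [ofPt_map, P.smul_map]
    rfl
  smul_one p := by rw [P.smul_one, ofPt_toPt]
  smul_mul p u v := by rw [P.smul_mul, toPt_ofPt]
  existsUnique_smul_eq p q := by
    obtain ⟨u, hu, huniq⟩ := P.existsUnique_smul_eq (toPt hf p) (toPt hf q)
    refine ⟨u, ?_, fun v hv => huniq v ?_⟩
    · change ofPt hf (P.smul (toPt hf p) u) = q
      rw [hu, ofPt_toPt]
    · rw [← hv, toPt_ofPt]
  act g p := ofPt hf (P.act g (toPt hf p))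
  act_map h φ x y g p := by
    rw [ofPt_map, P.act_map]
    rfl
  act_one p := by rw [P.act_one, ofPt_toPt]
  act_comp g h p := by rw [P.act_comp, toPt_ofPt]
  act_smul g p u := by rw [toPt_ofPt, toPt_ofPt, P.act_smul]

lemma Iso.baseChange {P Q : EquivariantTorsor W R} (h : Iso P Q) :
    Iso (P.baseChange hf) (Q.baseChange hf) := by
  obtain ⟨e, h1, h2⟩ := h
  refine ⟨Algebra.TensorProduct.congr
      (AlgEquiv.refl : (R' ⊗[K] L) ≃ₐ[R' ⊗[K] L] (R' ⊗[K] L)) e, fun q u => ?_, fun g q => ?_⟩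
  · apply toPt_injective hf
    refine (toPt_res hf e _).trans ?_
    refine Eq.trans ?_ (toPt_ofPt hf _).symm
    refine (congrArg (fun p => TPt.res p e.toAlgHom) (toPt_ofPt hf _)).trans ?_
    exact (h1 _ u).trans (congrArg (fun p => P.smul p u) (toPt_res hf e q).symm)
  · apply toPt_injective hf
    refine (toPt_res hf e _).trans ?_
    refine Eq.trans ?_ (toPt_ofPt hf _).symm
    refine (congrArg (fun p => TPt.res p e.toAlgHom) (toPt_ofPt hf _)).trans ?_
    exact (h2 g _).trans (congrArg (fun p => P.act g p) (toPt_res hf e q).symm)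

end EquivariantTorsor

namespace EquivariantGroup

variable {K L : Type u} [Field K] [Field L] [Algebra K L] {G : AffineGroupoid K L}
  (W : EquivariantGroup G) {R R' : Type u} [CommRing R] [Algebra K R] [CommRing R'] [Algebra K R']

/-- The value at `R` of the cohomology functor `H¹(G, W)`: the set `H¹(G_R, W_R)` of isomorphism
classes of `G_R`-equivariant torsors under `W_R`. -/
def H1 (R : Type u) [CommRing R] [Algebra K R] : Type (u + 1) :=
  Quotient (EquivariantTorsor.setoid W R)

/-- The functor `H¹(G, W)` on homomorphisms of `K`-algebras: base change of torsors. -/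
noncomputable def H1.map (f : R →ₐ[K] R') : W.H1 R → W.H1 R' :=
  letI := (Algebra.TensorProduct.map f (AlgHom.id K L)).toRingHom.toAlgebra
  Quotient.map (EquivariantTorsor.baseChange (f := f) rfl) fun _ _ h => h.baseChange rfl

/-- The functor `H¹(G, W)` on `K`-algebras is represented by the affine scheme `Spec X`. -/
def H1IsRepresentedBy (X : Type u) [CommRing X] [Algebra K X] : Prop :=
  ∃ e : ∀ (R : Type u) [CommRing R] [Algebra K R], (X →ₐ[K] R) ≃ W.H1 R,
    ∀ {R R' : Type u} [CommRing R] [Algebra K R] [CommRing R'] [Algebra K R']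
      (f : R →ₐ[K] R') (a : X →ₐ[K] R), H1.map W f (e R a) = e R' (f.comp a)

end EquivariantGroup

/-! ### Closed subgroups and the lower central series -/

namespace Pt

section Closed

variable {L : Type u} [Field L] {H : Type u} [CommRing H] [HopfAlgebra L H]
  {T T' : Type u} [CommRing T] [CommRing T'] {x : L →+* T}

/-- The point `u` lies in the closed subscheme defined by the ideal `I`. -/
def Mem {H : Type u} [CommRing H] [Algebra L H] (I : Ideal H) (u : Pt H x) : Prop :=
  ∀ f ∈ I, u.hom f = 0

lemma Mem.map {I : Ideal H} {u : Pt H x} (hu : u.Mem I) (φ : T →+* T') : (u.map φ).Mem I :=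
  fun f hf => by rw [map_hom, hu f hf, _root_.map_zero]

/-- A point in the closed subscheme defined by `I`, as a point of `Spec (H ⧸ I)`. -/
def desc {I : Ideal H} (u : Pt H x) (hu : u.Mem I) : Pt (H ⧸ I) x :=
  ⟨Ideal.Quotient.lift I u.hom hu, fun l => u.base l⟩

/-- The closed immersion `Spec (H ⧸ I) ⟶ Spec H` on points. -/
abbrev ofQuot {I : Ideal H} (u : Pt (H ⧸ I) x) : Pt H x := u.res (Ideal.Quotient.mkₐ L I)

lemma ofQuot_mem {I : Ideal H} (u : Pt (H ⧸ I) x) : (ofQuot u).Mem I := fun f hf => by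
  have : Ideal.Quotient.mkₐ L I f = 0 := Ideal.Quotient.eq_zero_iff_mem.2 hf
  rw [res_hom, this, _root_.map_zero]

lemma ofQuot_desc {I : Ideal H} (u : Pt H x) (hu : u.Mem I) : ofQuot (u.desc hu) = u := rfl

lemma ofQuot_injective {I : Ideal H} :
    Function.Injective (ofQuot : Pt (H ⧸ I) x → Pt H x) := fun u v h => by
  refine Pt.ext (Ideal.Quotient.ringHom_ext (RingHom.ext fun f => ?_))
  exact congrArg (fun w => w.hom f) h

lemma pair_res {B C B' C' : Type u} [CommRing B] [Algebra L B] [CommRing C] [Algebra L C]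
    [CommRing B'] [Algebra L B'] [CommRing C'] [Algebra L C']
    (u : Pt B x) (v : Pt C x) (f : B' →ₐ[L] B) (g : C' →ₐ[L] C) :
    pair (u.res f) (v.res g) = (pair u v).res (Algebra.TensorProduct.map f g) := by
  apply ext'
  intro z
  induction z with
  | zero => simp
  | tmul a b => simp
  | add a b ha hb => rw [_root_.map_add, _root_.map_add, ha, hb]

lemma Mem.mul {I : Ideal H} [hI : I.IsHopfIdeal L] {u v : Pt H x} (hu : u.Mem I) (hv : v.Mem I) :
    (u * v).Mem I := by
  intro f hf
  rw [mul_hom, ← ofQuot_desc u hu, ← ofQuot_desc v hv, pair_res, res_hom]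
  have h : Algebra.TensorProduct.map (Ideal.Quotient.mkₐ L I) (Ideal.Quotient.mkₐ L I)
      (Coalgebra.comul (R := L) f) = 0 :=
    Submodule.IsCoideal.map_mkQ_comul_eq_zero (I := I.restrictScalars L) hf
  rw [h, _root_.map_zero]

lemma mem_one {I : Ideal H} [hI : I.IsHopfIdeal L] : (1 : Pt H x).Mem I := fun f hf => by
  rw [one_hom, Submodule.IsCoideal.counit_eq_zero (I := I.restrictScalars L) hf, _root_.map_zero]

lemma Mem.inv {I : Ideal H} [hI : I.IsHopfIdeal L] {u : Pt H x} (hu : u.Mem I) : (u⁻¹).Mem I :=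
  fun f hf => by rw [inv_hom, hu _ (hI.antipode_mem hf)]

lemma mem_inv_iff {I : Ideal H} [hI : I.IsHopfIdeal L] {u : Pt H x} : (u⁻¹).Mem I ↔ u.Mem I :=
  ⟨fun h => by simpa using h.inv, Mem.inv⟩

/-- The tautological point of an affine scheme. -/
def taut (B : Type u) [CommRing B] [Algebra L B] : Pt B (algebraMap L B) :=
  ⟨RingHom.id B, fun _ => rfl⟩

/-- An algebra homomorphism gives a point. -/
def ofAlgHom {B C : Type u} [CommRing B] [Algebra L B] [CommRing C] [Algebra L C]
    (f : B →ₐ[L] C) : Pt B (algebraMap L C) := ⟨f.toRingHom, f.commutes⟩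

end Closed

end Pt

section Closed

variable {L : Type u} [Field L] {H : Type u} [CommRing H] [HopfAlgebra L H]

/-- A closed subscheme whose points form subgroups is defined by a Hopf ideal. -/
lemma isHopfIdeal_of_points (I : Ideal H)
    (h1 : ∀ {T : Type u} [CommRing T] (x : L →+* T), (1 : Pt H x).Mem I)
    (hmul : ∀ {T : Type u} [CommRing T] {x : L →+* T} (u v : Pt H x),
      u.Mem I → v.Mem I → (u * v).Mem I)
    (hinv : ∀ {T : Type u} [CommRing T] {x : L →+* T} (u : Pt H x), u.Mem I → (u⁻¹).Mem I) :
    I.IsHopfIdeal L where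
  counit_eq_zero f hf := h1 (RingHom.id L) f hf
  map_mkQ_comul_eq_zero f hf := by
    let π := Ideal.Quotient.mkₐ L I
    let u : Pt (H ⧸ I) (algebraMap L ((H ⧸ I) ⊗[L] (H ⧸ I))) :=
      Pt.ofAlgHom Algebra.TensorProduct.includeLeft
    let v : Pt (H ⧸ I) (algebraMap L ((H ⧸ I) ⊗[L] (H ⧸ I))) :=
      Pt.ofAlgHom Algebra.TensorProduct.includeRight
    have h := hmul (Pt.ofQuot u) (Pt.ofQuot v) (Pt.ofQuot_mem u) (Pt.ofQuot_mem v) f hf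
    rw [Pt.mul_hom, Pt.pair_res, Pt.res_hom] at h
    have huv : Pt.pair u v = Pt.taut _ := by
      apply Pt.ext'
      intro z
      induction z with
      | zero => simp
      | tmul a b => simp [u, v, Pt.ofAlgHom, Pt.taut]
      | add a b ha hb => rw [_root_.map_add, _root_.map_add, ha, hb]
    rw [huv] at h
    exact h
  antipode_mem f hf := by
    have h := hinv (Pt.ofAlgHom (Ideal.Quotient.mkₐ L I))
      (fun f hf => Ideal.Quotient.eq_zero_iff_mem.2 hf) f hf
    exact Ideal.Quotient.eq_zero_iff_mem.1 h

/-- The closed subgroup defined by the Hopf ideal `I` is normal. -/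
class IsNormalIdeal (L : Type u) [Field L] {H : Type u} [CommRing H] [HopfAlgebra L H]
    (I : Ideal H) : Prop where
  conj_mem : ∀ {T : Type u} [CommRing T] {x : L →+* T} (u n : Pt H x),
    n.Mem I → (u * n * u⁻¹).Mem I

/-- For `M` the closed subgroup of the group scheme `U = Spec H` defined by `I`, the ideal of the
commutator subgroup `[M, U]`: the smallest closed subgroup scheme containing all
commutators of points of `M` with points of `U`. (Closed subgroups correspond to Hopf
ideals, and intersections of closed subgroups to sums of ideals.) -/
def commutatorIdeal (L : Type u) [Field L] {H : Type u} [CommRing H] [HopfAlgebra L H]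
    (I : Ideal H) : Ideal H :=
  sSup {J | J.IsHopfIdeal L ∧ ∀ {T : Type u} [CommRing T] {x : L →+* T} (u v : Pt H x),
    u.Mem I → (u * v * u⁻¹ * v⁻¹).Mem J}

lemma mem_sSup_iff {S : Set (Ideal H)} {T : Type u} [CommRing T] {x : L →+* T} (u : Pt H x) :
    u.Mem (sSup S) ↔ ∀ J ∈ S, u.Mem J := by
  have : ∀ I : Ideal H, u.Mem I ↔ I ≤ RingHom.ker u.hom := fun I => Iff.rfl
  simp only [this, sSup_le_iff]

lemma isHopfIdeal_sSup {S : Set (Ideal H)} (hS : ∀ J ∈ S, J.IsHopfIdeal L) :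
    (sSup S).IsHopfIdeal L := by
  refine isHopfIdeal_of_points _ (fun x => ?_) (fun u v hu hv => ?_) (fun u hu => ?_)
  · rw [mem_sSup_iff]
    intro J hJ
    have := hS J hJ
    exact Pt.mem_one
  · rw [mem_sSup_iff] at *
    intro J hJ
    have := hS J hJ
    exact (hu J hJ).mul (hv J hJ)
  · rw [mem_sSup_iff] at *
    intro J hJ
    have := hS J hJ
    exact (hu J hJ).inv

lemma isHopfIdeal_commutatorIdeal (I : Ideal H) : (commutatorIdeal L I).IsHopfIdeal L :=
  isHopfIdeal_sSup fun _ h => h.1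

lemma commutator_mem (I : Ideal H) {T : Type u} [CommRing T] {x : L →+* T} (u v : Pt H x)
    (hu : u.Mem I) : (u * v * u⁻¹ * v⁻¹).Mem (commutatorIdeal L I) := by
  rw [commutatorIdeal, mem_sSup_iff]
  intro J hJ
  exact hJ.2 u v hu

lemma le_commutatorIdeal (I : Ideal H) [I.IsHopfIdeal L] (hI : IsNormalIdeal L I) :
    I ≤ commutatorIdeal L I := by
  refine le_sSup ⟨‹_›, fun u v hu => ?_⟩
  have := hu.mul (hI.conj_mem v u⁻¹ hu.inv)
  simpa [mul_assoc] using this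

lemma isNormalIdeal_commutatorIdeal (I : Ideal H) [I.IsHopfIdeal L] (hI : IsNormalIdeal L I) :
    IsNormalIdeal L (commutatorIdeal L I) := by
  constructor
  intro T _ x u n hn
  have := isHopfIdeal_commutatorIdeal (L := L) I
  have h1 : n.Mem I := fun f hf => hn f (le_commutatorIdeal I hI hf)
  have h2 := (commutator_mem I n u h1).inv.mul hn
  simpa [mul_assoc] using h2

/-- The ideals of the terms `U¹ = U`, `Uⁿ⁺¹ = [Uⁿ, U]` of the lower central series of the group
scheme `U = Spec H` (with the convention `U⁰ = U`). -/
def lcsIdeal (L : Type u) [Field L] (H : Type u) [CommRing H] [HopfAlgebra L H] : ℕ → Ideal H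
  | 0 => ⊥
  | 1 => ⊥
  | n + 2 => commutatorIdeal L (lcsIdeal L H (n + 1))

lemma mem_bot {T : Type u} [CommRing T] {x : L →+* T} (u : Pt H x) : u.Mem (⊥ : Ideal H) :=
  fun f hf => by rw [(Ideal.mem_bot).1 hf, _root_.map_zero]

lemma isHopfIdeal_bot : (⊥ : Ideal H).IsHopfIdeal L :=
  isHopfIdeal_of_points _ (fun _ => mem_bot _) (fun _ _ _ _ => mem_bot _) (fun _ _ => mem_bot _)

lemma isHopfIdeal_lcsIdeal : ∀ n, (lcsIdeal L H n).IsHopfIdeal L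
  | 0 => isHopfIdeal_bot
  | 1 => isHopfIdeal_bot
  | _ + 2 => isHopfIdeal_commutatorIdeal _

instance (n : ℕ) : (lcsIdeal L H n).IsHopfIdeal L := isHopfIdeal_lcsIdeal n

lemma isNormalIdeal_lcsIdeal : ∀ n, IsNormalIdeal L (lcsIdeal L H n)
  | 0 => ⟨fun _ _ _ => mem_bot _⟩
  | 1 => ⟨fun _ _ _ => mem_bot _⟩
  | n + 2 => isNormalIdeal_commutatorIdeal _ (isNormalIdeal_lcsIdeal (n + 1))

instance (n : ℕ) : IsNormalIdeal L (lcsIdeal L H n) := isNormalIdeal_lcsIdeal n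

lemma lcsIdeal_le_succ : ∀ n, lcsIdeal L H n ≤ lcsIdeal L H (n + 1)
  | 0 => le_rfl
  | n + 1 => le_commutatorIdeal _ (isNormalIdeal_lcsIdeal (n + 1))

end Closed

namespace Pt

section MapTo

variable {L : Type u} [Field L] {H : Type u} [CommRing H] [HopfAlgebra L H]
  {T T' : Type u} [CommRing T] [CommRing T'] {x : L →+* T} {x' : L →+* T'}

/-- Functoriality of points in the test ring, as a homomorphism of groups. -/
noncomputable def mapTo (φ : T →+* T') (h : ∀ l, φ (x l) = x' l) : Pt H x →* Pt H x' :=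
  have h' : φ.comp x = x' := RingHom.ext h
  h' ▸ { toFun := fun u => u.map φ
         map_one' := map_one φ
         map_mul' := fun u v => map_mul u v φ }

lemma mapTo_hom (φ : T →+* T') (h : ∀ l, φ (x l) = x' l) (u : Pt H x) (f : H) :
    (mapTo φ h u).hom f = φ (u.hom f) := by
  obtain rfl : φ.comp x = x' := RingHom.ext h
  rfl

end MapTo

end Pt

namespace AffineGroupoid

variable {K L : Type u} [Field K] [Field L] [Algebra K L] (G : AffineGroupoid K L)

instance : IsScalarTower K L G.A := IsScalarTower.of_algebraMap_eq fun k => (G.s.commutes k).symm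

variable {G} in
/-- An arrow, as a point of `Spec A` over its source. -/
def Hom.pt {T : Type u} [CommRing T] [Algebra K T] {x y : L →ₐ[K] T} (g : G.Hom x y) :
    Pt G.A (x : L →+* T) := ⟨g.hom, g.source⟩

end AffineGroupoid

namespace EquivariantGroup

variable {K L : Type u} [Field K] [Field L] [Algebra K L] {G : AffineGroupoid K L}
  (W : EquivariantGroup G)

lemma act_congr {T : Type u} [CommRing T] [Algebra K T] {x y x' y' : L →ₐ[K] T}
    (hx : x = x') (hy : y = y') (g : G.Hom x y) (g' : G.Hom x' y') (hg : g.hom = g'.hom)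
    (u : Pt W.O (x : L →+* T)) (u' : Pt W.O (x' : L →+* T)) (hu : u.hom = u'.hom) :
    (W.act g u).hom = (W.act g' u').hom := by
  subst hx hy
  rw [Arr.ext hg, Pt.ext hu]

/-- The coaction `O ⟶ A ⊗ O` corresponding to the action of `G` on `W = Spec O`, where `A` is an
`L`-algebra through the source map; it is semilinear along the target map. -/
noncomputable def coact : W.O →+* G.A ⊗[L] W.O :=
  (W.act (G.univ.map (Algebra.TensorProduct.includeLeft : G.A →ₐ[K] G.A ⊗[L] W.O))
    ⟨(Algebra.TensorProduct.includeRight : W.O →ₐ[L] G.A ⊗[L] W.O).toRingHom,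
      fun l => (AlgHom.commutes _ l)⟩).hom

lemma act_hom {T : Type u} [CommRing T] [Algebra K T] {x y : L →ₐ[K] T} (g : G.Hom x y)
    (u : Pt W.O (x : L →+* T)) (f : W.O) :
    (W.act g u).hom f = (Pt.pair (AffineGroupoid.Hom.pt g) u).hom (W.coact f) := by
  let F : G.A ⊗[L] W.O →ₐ[K] T :=
    { (Pt.pair (AffineGroupoid.Hom.pt g) u).hom with
      commutes' := fun k => by
        have : algebraMap K (G.A ⊗[L] W.O) k = (algebraMap K G.A k) ⊗ₜ 1 := rfl
        change (Pt.pair (AffineGroupoid.Hom.pt g) u).hom _ = _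
        rw [this, Pt.pair_tmul, map_one, mul_one]
        exact g.hom.commutes k }
  have h := W.act_map F
    (G.univ.map (Algebra.TensorProduct.includeLeft : G.A →ₐ[K] G.A ⊗[L] W.O))
    ⟨(Algebra.TensorProduct.includeRight : W.O →ₐ[L] G.A ⊗[L] W.O).toRingHom,
      fun l => (AlgHom.commutes _ l)⟩
  have hF1 : ∀ a, F (a ⊗ₜ 1) = g.hom a := fun a => by
    change (Pt.pair (AffineGroupoid.Hom.pt g) u).hom _ = _
    rw [Pt.pair_tmul, map_one, mul_one]
    rfl
  have hF2 : ∀ b, F (1 ⊗ₜ b) = u.hom b := fun b => by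
    change (Pt.pair (AffineGroupoid.Hom.pt g) u).hom _ = _
    rw [Pt.pair_tmul, map_one, one_mul]
  have hx : F.comp (Algebra.TensorProduct.includeLeft.comp G.s) = x :=
    AlgHom.ext fun l => (hF1 _).trans (g.source l)
  have hy : F.comp (Algebra.TensorProduct.includeLeft.comp G.t) = y :=
    AlgHom.ext fun l => (hF1 _).trans (g.target l)
  have h' := congrArg (fun w => w.hom f) h
  refine Eq.trans ?_ h'.symm
  refine congrArg (fun r => r f) (W.act_congr hx.symm hy.symm _ _ ?_ _ _ ?_)
  · exact AlgHom.ext fun a => (hF1 a).symm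
  · exact RingHom.ext fun b => (hF2 b).symm

/-- The closed subscheme of `W` defined by `I` is stable under the action of `G`. -/
def IsStableIdeal (I : Ideal W.O) : Prop :=
  ∀ {T : Type u} [CommRing T] [Algebra K T] {x y : L →ₐ[K] T} (g : G.Hom x y)
    (u : Pt W.O (x : L →+* T)), u.Mem I → (W.act g u).Mem I

lemma eq_zero_of_forall_rTensor {A N : Type u} [AddCommGroup A] [Module L A] [AddCommGroup N]
    [Module L N] (z : A ⊗[L] N)
    (h : ∀ a : A →ₗ[L] L, TensorProduct.lid L N (a.rTensor N z) = 0) : z = 0 := by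
  let b := Module.Free.chooseBasis L A
  apply (TensorProduct.equivFinsuppOfBasisLeft (N := N) b).injective
  rw [map_zero]
  ext i
  rw [Finsupp.zero_apply, ← h (b.coord i)]
  clear h
  induction z with
  | zero => simp
  | tmul a n => simp
  | add a b ha hb => simp only [map_add, Finsupp.add_apply, ha, hb]

/-- The ideal of the largest closed subscheme all of whose translates under `G` lie in the closed
subscheme defined by `J`. -/
def coreIdeal (J : Ideal W.O) : Ideal W.O :=
  Ideal.span {c | ∃ (a : G.A →ₗ[L] L) (f : W.O), f ∈ J ∧
    c = TensorProduct.lid L W.O (a.rTensor W.O (W.coact f))}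

lemma mem_coreIdeal_iff (J : Ideal W.O) {T : Type u} [CommRing T] [Algebra L T]
    (u : Pt W.O (algebraMap L T)) :
    u.Mem (W.coreIdeal J) ↔ ∀ f ∈ J,
      ({ u.hom with commutes' := u.base } : W.O →ₐ[L] T).toLinearMap.lTensor G.A (W.coact f) = 0 := by
  set U : W.O →ₐ[L] T := { u.hom with commutes' := u.base } with hU
  have key : ∀ (a : G.A →ₗ[L] L) (z : G.A ⊗[L] W.O),
      u.hom (TensorProduct.lid L W.O (a.rTensor W.O z)) =
        TensorProduct.lid L T (a.rTensor T (U.toLinearMap.lTensor G.A z)) := by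
    intro a z
    induction z with
    | zero => simp
    | tmul b c =>
      have : ∀ c, u.hom c = U c := fun _ => rfl
      simp [this]
    | add b c hb hc => simp only [map_add, hb, hc]
  constructor
  · intro h f hf
    apply eq_zero_of_forall_rTensor
    intro a
    rw [← key]
    exact h _ (Ideal.subset_span ⟨a, f, hf, rfl⟩)
  · intro h
    have h2 : W.coreIdeal J ≤ RingHom.ker u.hom := by
      rw [coreIdeal, Ideal.span_le]
      rintro _ ⟨a, f, hf, rfl⟩
      change u.hom _ = 0
      rw [key, h f hf]
      simp
    exact h2

/-- The translate of a point by the universal arrow. -/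
lemma exists_translate {T : Type u} [CommRing T] (x : L →+* T) (J : Ideal W.O) :
    ∃ (T' : Type u) (_ : CommRing T') (_ : Algebra K T') (y z : L →ₐ[K] T') (g : G.Hom y z)
      (φ : T →+* T') (E : Pt W.O x →* Pt W.O (y : L →+* T')), ∀ u : Pt W.O x,
      (∀ f, (E u).hom f = φ (u.hom f)) ∧
      (u.Mem (W.coreIdeal J) ↔ (W.act g (E u)).Mem J) := by
  let _ := x.toAlgebra
  let ψ : T →ₐ[L] G.A ⊗[L] T := Algebra.TensorProduct.includeRight
  let ι : G.A →ₐ[K] G.A ⊗[L] T := Algebra.TensorProduct.includeLeft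
  let E : Pt W.O x →* Pt W.O ((ι.comp G.s : L →ₐ[K] G.A ⊗[L] T) : L →+* G.A ⊗[L] T) :=
    Pt.mapTo ψ.toRingHom (fun l => AlgHom.commutes ψ l)
  have hE : ∀ u f, (E u).hom f = ψ (u.hom f) := fun u f => Pt.mapTo_hom _ _ u f
  refine ⟨G.A ⊗[L] T, inferInstance, inferInstance, _, _, G.univ.map ι, ψ.toRingHom, E,
    fun u => ⟨hE u, ?_⟩⟩
  refine (W.mem_coreIdeal_iff J u).trans (forall₂_congr fun f _ => Eq.congr_left ?_)
  refine Eq.trans ?_ (W.act_hom (G.univ.map ι) (E u) f).symm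
  generalize W.coact f = w
  induction w with
  | zero => simp
  | tmul a b =>
    rw [Pt.pair_tmul, hE]
    change a ⊗ₜ u.hom b = (a ⊗ₜ 1) * (1 ⊗ₜ u.hom b)
    rw [Algebra.TensorProduct.tmul_mul_tmul, mul_one, one_mul]
  | add b c hb hc => rw [map_add, map_add, hb, hc]

lemma act_mem_of_mem_coreIdeal (J : Ideal W.O) {T : Type u} [CommRing T] [Algebra K T]
    {x y : L →ₐ[K] T} (g : G.Hom x y) (u : Pt W.O (x : L →+* T)) (hu : u.Mem (W.coreIdeal J)) :
    (W.act g u).Mem J := by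
  intro f hf
  let _ := (x : L →+* T).toAlgebra
  have h := (W.mem_coreIdeal_iff J u).1 hu f hf
  rw [act_hom]
  have key : ∀ w : G.A ⊗[L] W.O, (Pt.pair (AffineGroupoid.Hom.pt g) u).hom w =
      (Pt.pair (AffineGroupoid.Hom.pt g) (Pt.taut T)).hom
        (({ u.hom with commutes' := u.base } : W.O →ₐ[L] T).toLinearMap.lTensor G.A w) := by
    intro w
    induction w with
    | zero => simp
    | tmul a b =>
      rw [Pt.pair_tmul, LinearMap.lTensor_tmul, Pt.pair_tmul]
      rfl
    | add b c hb hc => simp only [map_add, hb, hc]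
  rw [key, h, map_zero]

lemma isStableIdeal_commutatorIdeal (I : Ideal W.O) (hI : W.IsStableIdeal I) :
    W.IsStableIdeal (commutatorIdeal L I) := by
  set J := commutatorIdeal L I with hJ
  have hJH : J.IsHopfIdeal L := isHopfIdeal_commutatorIdeal I
  have hle : W.coreIdeal J ≤ J := by
    refine le_sSup ⟨isHopfIdeal_of_points _ (fun x => ?_) (fun {T _ x} u v hu hv => ?_)
      (fun {T _ x} u hu => ?_), fun {T _ x} u v hu => ?_⟩ <;>
    obtain ⟨T', _, _, y, z, g, φ, E, H⟩ := W.exists_translate x J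
    · rw [(H _).2, map_one, map_one]
      exact Pt.mem_one
    · rw [(H _).2] at *
      rw [map_mul, map_mul]
      exact hu.mul hv
    · rw [(H _).2] at *
      rw [map_inv, map_inv]
      exact hu.inv
    · rw [(H _).2]
      simp only [map_mul, map_inv]
      refine commutator_mem I _ _ (hI g _ fun f hf => ?_)
      rw [(H _).1, hu f hf, map_zero]
  intro T _ _ x y g u hu
  exact W.act_mem_of_mem_coreIdeal J g u fun f hf => hu f (hle hf)

lemma isStableIdeal_lcsIdeal : ∀ n, W.IsStableIdeal (lcsIdeal L W.O n)
  | 0 => fun _ _ _ => mem_bot _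
  | 1 => fun _ _ _ => mem_bot _
  | n + 2 => W.isStableIdeal_commutatorIdeal _ (isStableIdeal_lcsIdeal (n + 1))

end EquivariantGroup

/-! ### Quotients by normal closed subgroups -/

section Quotient

variable {L : Type u} [Field L] {H : Type u} [CommRing H] [HopfAlgebra L H]

open Algebra.TensorProduct in
/-- For the closed subgroup `N` of `U = Spec H` defined by `I`, the coordinate ring
of the quotient `U / N`: the functions `f` on `U` with `f (u n) = f (u)` for points `u` of `U` and
`n` of `N`, that is, whose image under `H ⟶ H ⊗ H ⟶ H ⊗ H ⧸ I` is `f ⊗ 1`. -/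
def coinvariants (L : Type u) [Field L] {H : Type u} [CommRing H] [HopfAlgebra L H]
    (I : Ideal H) : Subalgebra L H :=
  AlgHom.equalizer
    ((Algebra.TensorProduct.map (AlgHom.id L H) (Ideal.Quotient.mkₐ L I)).comp
      (Bialgebra.comulAlgHom L H))
    (includeLeft : H →ₐ[L] H ⊗[L] (H ⧸ I))

namespace coinvariants

open Algebra.TensorProduct

variable (I : Ideal H)

/-- The map `f ↦ ((u, n) ↦ f (u n))`. -/
abbrev α : H →ₐ[L] H ⊗[L] (H ⧸ I) :=
  (Algebra.TensorProduct.map (AlgHom.id L H) (Ideal.Quotient.mkₐ L I)).comp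
    (Bialgebra.comulAlgHom L H)

/-- The map `f ↦ ((u, n) ↦ f (u))`. -/
abbrev β : H →ₐ[L] H ⊗[L] (H ⧸ I) := includeLeft

variable {I}

lemma mem_iff {f : H} : f ∈ coinvariants L I ↔ α I f = β (L := L) I f := Iff.rfl

lemma α_apply {T : Type u} [CommRing T] {x : L →+* T} (u : Pt H x) (n : Pt (H ⧸ I) x) (f : H) :
    (Pt.pair u n).hom (α (L := L) I f) = (u * Pt.ofQuot n).hom f := by
  rw [Pt.mul_hom, show u = u.res (AlgHom.id L H) from rfl, Pt.pair_res]
  rfl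

lemma β_apply {T : Type u} [CommRing T] {x : L →+* T} (u : Pt H x) (n : Pt (H ⧸ I) x) (f : H) :
    (Pt.pair u n).hom (β (L := L) I f) = u.hom f := by
  change (Pt.pair u n).hom (f ⊗ₜ 1) = _
  rw [Pt.pair_tmul, map_one, mul_one]

lemma apply_mul {f : H} (hf : f ∈ coinvariants L I) {T : Type u} [CommRing T] {x : L →+* T}
    (u n : Pt H x) (hn : n.Mem I) : (u * n).hom f = u.hom f := by
  rw [← Pt.ofQuot_desc n hn, ← α_apply, mem_iff.1 hf, β_apply]

lemma pair_includes (B C : Type u) [CommRing B] [Algebra L B] [CommRing C] [Algebra L C] :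
    Pt.pair (Pt.ofAlgHom (includeLeft : B →ₐ[L] B ⊗[L] C))
      (Pt.ofAlgHom (includeRight : C →ₐ[L] B ⊗[L] C)) = Pt.taut (B ⊗[L] C) := by
  apply Pt.ext'
  intro z
  induction z with
  | zero => simp
  | tmul a b => simp [Pt.ofAlgHom, Pt.taut]
  | add a b ha hb => rw [map_add, map_add, ha, hb]

lemma mem_of_points {f : H} (h : ∀ {T : Type u} [CommRing T] {x : L →+* T}
    (u n : Pt H x), n.Mem I → (u * n).hom f = u.hom f) : f ∈ coinvariants L I := by
  rw [mem_iff]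
  have h1 := α_apply (I := I) (Pt.ofAlgHom (includeLeft : H →ₐ[L] H ⊗[L] (H ⧸ I)))
    (Pt.ofAlgHom includeRight) f
  have h2 := β_apply (I := I) (Pt.ofAlgHom (includeLeft : H →ₐ[L] H ⊗[L] (H ⧸ I)))
    (Pt.ofAlgHom includeRight) f
  rw [h _ _ (Pt.ofQuot_mem _), ← h2, pair_includes] at h1
  exact h1

/-- The coinvariants are the kernel of `α - β`. -/
lemma exact_subtype (I : Ideal H) :
    Function.Exact (coinvariants L I).val.toLinearMap
      ((α (L := L) I).toLinearMap - (β (L := L) I).toLinearMap) := by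
  intro f
  constructor
  · intro h
    exact ⟨⟨f, mem_iff.2 (sub_eq_zero.1 h)⟩, rfl⟩
  · rintro ⟨b, rfl⟩
    exact sub_eq_zero.2 (mem_iff.1 b.2)

lemma exists_lTensor {M : Type u} [AddCommGroup M] [Module L M] (z : M ⊗[L] H)
    (hz : (α (L := L) I).toLinearMap.lTensor M z = (β (L := L) I).toLinearMap.lTensor M z) :
    ∃ z', (coinvariants L I).val.toLinearMap.lTensor M z' = z := by
  refine (Module.Flat.lTensor_exact M (exact_subtype (L := L) I) z).1 ?_
  exact (LinearMap.congr_fun (LinearMap.lTensor_sub (M := M) _ _) z).trans (sub_eq_zero.2 hz)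

lemma exists_rTensor {M : Type u} [AddCommGroup M] [Module L M] (z : H ⊗[L] M)
    (hz : (α (L := L) I).toLinearMap.rTensor M z = (β (L := L) I).toLinearMap.rTensor M z) :
    ∃ z', (coinvariants L I).val.toLinearMap.rTensor M z' = z := by
  refine (Module.Flat.rTensor_exact M (exact_subtype (L := L) I) z).1 ?_
  exact (LinearMap.congr_fun (LinearMap.rTensor_sub (Q := M) _ _) z).trans (sub_eq_zero.2 hz)

lemma lTensor_val_injective (M : Type u) [AddCommGroup M] [Module L M] :
    Function.Injective ((coinvariants L I).val.toLinearMap.lTensor M) :=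
  Module.Flat.lTensor_preserves_injective_linearMap _ Subtype.val_injective

lemma rTensor_val_injective (M : Type u) [AddCommGroup M] [Module L M] :
    Function.Injective ((coinvariants L I).val.toLinearMap.rTensor M) :=
  Module.Flat.rTensor_preserves_injective_linearMap _ Subtype.val_injective

lemma lTensor_comul {f : H} (hf : f ∈ coinvariants L I) :
    (α (L := L) I).toLinearMap.lTensor H (Coalgebra.comul (R := L) f) =
      (β (L := L) I).toLinearMap.lTensor H (Coalgebra.comul (R := L) f) := by
  let T := H ⊗[L] (H ⊗[L] (H ⧸ I))
  let u : Pt H (algebraMap L T) := Pt.ofAlgHom includeLeft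
  let v : Pt H (algebraMap L T) := Pt.ofAlgHom (includeRight.comp includeLeft)
  let n : Pt (H ⧸ I) (algebraMap L T) := Pt.ofAlgHom (includeRight.comp includeRight)
  have hvn : Pt.pair v n = Pt.ofAlgHom includeRight := by
    apply Pt.ext'
    intro z
    induction z with
    | zero => simp
    | tmul a b =>
      rw [Pt.pair_tmul]
      change (1 ⊗ₜ (a ⊗ₜ 1)) * (1 ⊗ₜ (1 ⊗ₜ b)) = 1 ⊗ₜ (a ⊗ₜ b)
      simp only [tmul_mul_tmul, mul_one, one_mul]
    | add a b ha hb => rw [map_add, map_add, ha, hb]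
  have key : ∀ (γ : H →ₐ[L] H ⊗[L] (H ⧸ I)) (w : Pt H (algebraMap L T)),
      (∀ f, (Pt.pair v n).hom (γ f) = w.hom f) →
      γ.toLinearMap.lTensor H (Coalgebra.comul (R := L) f) = (u * w).hom f := by
    intro γ w hw
    rw [Pt.mul_hom]
    generalize (Coalgebra.comul (R := L) f) = z
    induction z with
    | zero => simp
    | tmul a b =>
      rw [Pt.pair_tmul, ← hw, hvn]
      change a ⊗ₜ γ b = (a ⊗ₜ 1) * (1 ⊗ₜ γ b)
      rw [tmul_mul_tmul, mul_one, one_mul]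
    | add a b ha hb => rw [map_add, map_add, ha, hb]
  rw [key (α I) _ (α_apply v n), key (β I) _ (β_apply v n), ← mul_assoc,
    apply_mul hf _ _ (Pt.ofQuot_mem n)]

lemma rTensor_comul [hI : IsNormalIdeal L I] {f : H} (hf : f ∈ coinvariants L I) :
    (α (L := L) I).toLinearMap.rTensor H (Coalgebra.comul (R := L) f) =
      (β (L := L) I).toLinearMap.rTensor H (Coalgebra.comul (R := L) f) := by
  let T := (H ⊗[L] (H ⧸ I)) ⊗[L] H
  let u : Pt H (algebraMap L T) := Pt.ofAlgHom includeRight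
  let v : Pt H (algebraMap L T) := Pt.ofAlgHom (AlgHom.comp (includeLeft : _ →ₐ[L] T) includeLeft)
  let n : Pt (H ⧸ I) (algebraMap L T) :=
    Pt.ofAlgHom (AlgHom.comp (includeLeft : _ →ₐ[L] T) includeRight)
  have hvn : Pt.pair v n = Pt.ofAlgHom includeLeft := by
    apply Pt.ext'
    intro z
    induction z with
    | zero => simp
    | tmul a b =>
      rw [Pt.pair_tmul]
      change ((a ⊗ₜ 1) ⊗ₜ 1) * ((1 ⊗ₜ b) ⊗ₜ 1) = (a ⊗ₜ b) ⊗ₜ 1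
      simp only [tmul_mul_tmul, mul_one, one_mul]
    | add a b ha hb => rw [map_add, map_add, ha, hb]
  have key : ∀ (γ : H →ₐ[L] H ⊗[L] (H ⧸ I)) (w : Pt H (algebraMap L T)),
      (∀ f, (Pt.pair v n).hom (γ f) = w.hom f) →
      γ.toLinearMap.rTensor H (Coalgebra.comul (R := L) f) = (w * u).hom f := by
    intro γ w hw
    rw [Pt.mul_hom]
    generalize (Coalgebra.comul (R := L) f) = z
    induction z with
    | zero => simp
    | tmul a b =>
      rw [Pt.pair_tmul, ← hw, hvn]
      change γ a ⊗ₜ b = (γ a ⊗ₜ 1) * (1 ⊗ₜ b)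
      rw [tmul_mul_tmul, mul_one, one_mul]
    | add a b ha hb => rw [map_add, map_add, ha, hb]
  have h := hI.conj_mem u⁻¹ (Pt.ofQuot n) (Pt.ofQuot_mem n)
  rw [key (α I) _ (α_apply v n), key (β I) _ (β_apply v n), ← apply_mul hf (v * u) _ h]
  congr 1
  group

variable (L I) in
/-- The inclusion of `B ⊗ B` into `H ⊗ H`, for `B` the ring of coinvariants. -/
noncomputable def incl₂ : coinvariants L I ⊗[L] coinvariants L I →ₐ[L] H ⊗[L] H :=
  Algebra.TensorProduct.map (coinvariants L I).val (coinvariants L I).val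

lemma incl₂_tmul (a b : coinvariants L I) : incl₂ L I (a ⊗ₜ b) = (a : H) ⊗ₜ (b : H) := rfl

lemma incl₂_eq (z : coinvariants L I ⊗[L] coinvariants L I) : incl₂ L I z =
    (coinvariants L I).val.toLinearMap.lTensor H
      ((coinvariants L I).val.toLinearMap.rTensor _ z) := by
  induction z with
  | zero => simp only [map_zero]
  | tmul a b => rfl
  | add a b ha hb => rw [map_add, map_add, map_add, ha, hb]

lemma incl₂_injective : Function.Injective (incl₂ L I) := fun z w h => by
  rw [incl₂_eq, incl₂_eq] at h
  exact rTensor_val_injective _ (lTensor_val_injective _ h)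

lemma comul_mem_range [IsNormalIdeal L I] {f : H} (hf : f ∈ coinvariants L I) :
    Coalgebra.comul (R := L) f ∈ (incl₂ L I).range := by
  have h0 := lTensor_comul hf
  obtain ⟨z, hz⟩ := exists_lTensor (M := H) (Coalgebra.comul (R := L) f) h0
  have hcomm : ∀ γ : H →ₗ[L] H ⊗[L] (H ⧸ I), γ.rTensor H
      (Coalgebra.comul (R := L) f) = (coinvariants L I).val.toLinearMap.lTensor _
        (γ.rTensor _ z) := by
    intro γ
    rw [← hz]
    clear hz
    induction z with
    | zero => simp only [map_zero]
    | tmul a b => rfl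
    | add a b ha hb => simp only [map_add, ha, hb]
  have h := ((hcomm (α I).toLinearMap).symm.trans (rTensor_comul hf)).trans
    (hcomm (β I).toLinearMap)
  have h' := lTensor_val_injective (H ⊗[L] (H ⧸ I)) h
  obtain ⟨z', hz'⟩ := exists_rTensor z h'
  exact ⟨z', (incl₂_eq z').trans ((congrArg _ hz').trans hz)⟩

variable (L I) in
/-- The comultiplication of the quotient group. -/
noncomputable def comulHom [IsNormalIdeal L I] :
    coinvariants L I →ₐ[L] coinvariants L I ⊗[L] coinvariants L I :=
  (AlgEquiv.ofInjective (incl₂ L I) incl₂_injective).symm.toAlgHom.comp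
    (((Bialgebra.comulAlgHom L H).comp (coinvariants L I).val).codRestrict (incl₂ L I).range
      fun b => comul_mem_range b.2)

lemma incl₂_comulHom [IsNormalIdeal L I] (b : coinvariants L I) :
    incl₂ L I (comulHom L I b) = Coalgebra.comul (R := L) (b : H) := by
  have := AlgEquiv.apply_symm_apply (AlgEquiv.ofInjective (incl₂ L I) incl₂_injective)
    ((((Bialgebra.comulAlgHom L H).comp (coinvariants L I).val).codRestrict (incl₂ L I).range
      fun b => comul_mem_range b.2) b)
  exact congrArg Subtype.val this

lemma antipode_mem [hH : I.IsHopfIdeal L] [hI : IsNormalIdeal L I] {f : H}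
    (hf : f ∈ coinvariants L I) : HopfAlgebra.antipode L f ∈ coinvariants L I := by
  refine mem_of_points fun {T _ x} u n hn => ?_
  rw [← Pt.inv_hom, ← Pt.inv_hom, ← apply_mul hf u⁻¹ _ (hI.conj_mem u n⁻¹ hn.inv)]
  congr 1
  group

variable (L I) in
/-- The antipode of the quotient group. -/
noncomputable def antipodeHom [I.IsHopfIdeal L] [IsNormalIdeal L I] :
    coinvariants L I →ₐ[L] coinvariants L I :=
  ((HopfAlgebra.antipodeAlgHom L H).comp (coinvariants L I).val).codRestrict _
    fun b => antipode_mem b.2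

noncomputable instance [IsNormalIdeal L I] : Bialgebra L (coinvariants L I) :=
  Bialgebra.ofAlgHom (comulHom L I) ((Bialgebra.counitAlgHom L H).comp (coinvariants L I).val)
    (by
      refine AlgHom.ext fun b => ?_
      have hinj : Function.Injective (Algebra.TensorProduct.map (coinvariants L I).val
          (incl₂ L I)) := by
        have : ∀ z, Algebra.TensorProduct.map (coinvariants L I).val (incl₂ L I) z =
            (coinvariants L I).val.toLinearMap.rTensor _
              ((incl₂ L I).toLinearMap.lTensor _ z) := by
          intro z
          induction z with
          | zero => simp only [map_zero]
          | tmul a b => rfl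
          | add a b ha hb => rw [map_add, map_add, map_add, ha, hb]
        intro z w h
        rw [this, this] at h
        exact Module.Flat.lTensor_preserves_injective_linearMap _ incl₂_injective
          (Module.Flat.rTensor_preserves_injective_linearMap _ Subtype.val_injective h)
      apply hinj
      have h1 : ∀ z : coinvariants L I ⊗[L] coinvariants L I,
          Algebra.TensorProduct.map (coinvariants L I).val (incl₂ L I)
            (Algebra.TensorProduct.assoc L L L _ _ _
              (Algebra.TensorProduct.map (comulHom L I) (AlgHom.id L _) z)) =
          TensorProduct.assoc L H H H
            ((Coalgebra.comul (R := L)).rTensor H (incl₂ L I z)) := by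
        intro z
        induction z with
        | zero => simp
        | tmul a b =>
          rw [Algebra.TensorProduct.map_tmul, incl₂_tmul, LinearMap.rTensor_tmul]
          change _ = TensorProduct.assoc L H H H (Coalgebra.comul (R := L) (a : H) ⊗ₜ (b : H))
          rw [← incl₂_comulHom]
          generalize comulHom L I a = w
          induction w with
          | zero => simp
          | tmul c d => rfl
          | add c d hc hd => simp only [TensorProduct.add_tmul, map_add, hc, hd]
        | add a b ha hb => simp only [map_add, ha, hb]
      have h2 : ∀ z : coinvariants L I ⊗[L] coinvariants L I,
          Algebra.TensorProduct.map (coinvariants L I).val (incl₂ L I)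
              (Algebra.TensorProduct.map (AlgHom.id L _) (comulHom L I) z) =
            (Coalgebra.comul (R := L)).lTensor H (incl₂ L I z) := by
        intro z
        induction z with
        | zero => simp
        | tmul a b =>
          rw [Algebra.TensorProduct.map_tmul, Algebra.TensorProduct.map_tmul, incl₂_tmul,
            LinearMap.lTensor_tmul, incl₂_comulHom]
          rfl
        | add a b ha hb => simp only [map_add, ha, hb]
      refine (h1 _).trans (Eq.trans ?_ (h2 _).symm)
      have h3 := incl₂_comulHom b
      exact ((congrArg (fun z => TensorProduct.assoc L H H H
          ((Coalgebra.comul (R := L)).rTensor H z)) h3).trans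
        (Coalgebra.coassoc_apply (b : H))).trans
        (congrArg ((Coalgebra.comul (R := L)).lTensor H) h3).symm)
    (by
      refine AlgHom.ext fun b => ?_
      apply lTensor_val_injective (I := I) L
      have h1 : ∀ z : coinvariants L I ⊗[L] coinvariants L I,
          (coinvariants L I).val.toLinearMap.lTensor L
            (Algebra.TensorProduct.map ((Bialgebra.counitAlgHom L H).comp (coinvariants L I).val)
              (AlgHom.id L _) z) = (Coalgebra.counit (R := L)).rTensor H (incl₂ L I z) := by
        intro z
        induction z with
        | zero => simp
        | tmul a b => rfl
        | add a b ha hb => simp only [map_add, ha, hb]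
      exact ((h1 _).trans (congrArg ((Coalgebra.counit (R := L)).rTensor H) (incl₂_comulHom b))).trans
        (Coalgebra.rTensor_counit_comul (b : H)))
    (by
      refine AlgHom.ext fun b => ?_
      apply rTensor_val_injective (I := I) L
      have h1 : ∀ z : coinvariants L I ⊗[L] coinvariants L I,
          (coinvariants L I).val.toLinearMap.rTensor L
            (Algebra.TensorProduct.map (AlgHom.id L _)
              ((Bialgebra.counitAlgHom L H).comp (coinvariants L I).val) z) =
            (Coalgebra.counit (R := L)).lTensor H (incl₂ L I z) := by
        intro z
        induction z with
        | zero => simp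
        | tmul a b => rfl
        | add a b ha hb => simp only [map_add, ha, hb]
      exact ((h1 _).trans (congrArg ((Coalgebra.counit (R := L)).lTensor H) (incl₂_comulHom b))).trans
        (Coalgebra.lTensor_counit_comul (b : H)))

/-- The Hopf algebra of the quotient of a group scheme by a normal closed subgroup. -/
noncomputable instance [I.IsHopfIdeal L] [IsNormalIdeal L I] : HopfAlgebra L (coinvariants L I) :=
  HopfAlgebra.ofAlgHom (antipodeHom L I)
    (by
      refine AlgHom.ext fun b => Subtype.val_injective ?_
      have h1 : ∀ z : coinvariants L I ⊗[L] coinvariants L I,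
          ((Algebra.TensorProduct.lift (antipodeHom L I) (AlgHom.id L _)
            (fun _ _ => Commute.all _ _) z : coinvariants L I) : H) =
          LinearMap.mul' L H ((HopfAlgebra.antipode L).rTensor H (incl₂ L I z)) := by
        intro z
        induction z with
        | zero => simp
        | tmul a b => rfl
        | add a b ha hb => simp only [map_add, AddMemClass.coe_add, ha, hb]
      refine (h1 _).trans ((congrArg _ (congrArg _ (incl₂_comulHom b))).trans ?_)
      rw [HopfAlgebra.mul_antipode_rTensor_comul_apply]
      rfl)
    (by
      refine AlgHom.ext fun b => Subtype.val_injective ?_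
      have h1 : ∀ z : coinvariants L I ⊗[L] coinvariants L I,
          ((Algebra.TensorProduct.lift (AlgHom.id L _) (antipodeHom L I)
            (fun _ _ => Commute.all _ _) z : coinvariants L I) : H) =
          LinearMap.mul' L H ((HopfAlgebra.antipode L).lTensor H (incl₂ L I z)) := by
        intro z
        induction z with
        | zero => simp
        | tmul a b => rfl
        | add a b ha hb => simp only [map_add, AddMemClass.coe_add, ha, hb]
      refine (h1 _).trans ((congrArg _ (congrArg _ (incl₂_comulHom b))).trans ?_)
      rw [HopfAlgebra.mul_antipode_lTensor_comul_apply]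
      rfl)

end coinvariants

end Quotient

namespace Pt

variable {L : Type u} [Field L] {B H : Type u} [CommRing B] [HopfAlgebra L B]
  [CommRing H] [HopfAlgebra L H] {T : Type u} [CommRing T] {x : L →+* T}

lemma res_mul (f : B →ₐ[L] H) (hf : ∀ b, Coalgebra.comul (R := L) (f b) =
    Algebra.TensorProduct.map f f (Coalgebra.comul (R := L) b)) (u v : Pt H x) :
    (u * v).res f = u.res f * v.res f := by
  apply ext'
  intro b
  rw [res_hom, mul_hom, mul_hom, pair_res, hf, res_hom]

lemma ofQuot_mul (I : Ideal H) [I.IsHopfIdeal L] (u v : Pt (H ⧸ I) x) :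
    ofQuot (u * v) = ofQuot u * ofQuot v :=
  res_mul _ (fun _ => rfl) u v

lemma ofQuot_one (I : Ideal H) [I.IsHopfIdeal L] : ofQuot (1 : Pt (H ⧸ I) x) = 1 := by
  have h := ofQuot_mul I (1 : Pt (H ⧸ I) x) 1
  rw [mul_one] at h
  exact left_eq_mul.1 h

lemma res_coinvariants_mul (I : Ideal H) [I.IsHopfIdeal L] [IsNormalIdeal L I] (u v : Pt H x) :
    (u * v).res (coinvariants L I).val =
      u.res (coinvariants L I).val * v.res (coinvariants L I).val :=
  res_mul _ (fun b => (coinvariants.incl₂_comulHom b).symm) u v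

lemma ext_id {u v : Pt B x} (h : u.hom = v.hom) : u = v := Pt.ext h

end Pt

namespace AffineGroupoid

variable {K L : Type u} [Field K] [Field L] [Algebra K L] (G : AffineGroupoid K L)

lemma one_map {T T' : Type u} [CommRing T] [Algebra K T] [CommRing T'] [Algebra K T']
    (f : T →ₐ[K] T') (x : L →ₐ[K] T) : (G.one x).map f = G.one (f.comp x) := by
  have h := G.comp_map f (G.one x) (G.one x)
  rw [G.one_comp] at h
  have h2 := congrArg (G.comp (G.inv ((G.one x).map f))) h
  rw [← G.assoc, G.inv_comp, G.one_comp] at h2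
  exact h2.symm

end AffineGroupoid

namespace Pt

variable {K L : Type u} [Field K] [Field L] [Algebra K L]
  {B H : Type u} [CommRing B] [Algebra L B] [CommRing H] [Algebra L H]
  {T T' : Type u} [CommRing T] [Algebra K T] [CommRing T'] [Algebra K T'] {x : L →ₐ[K] T}

/-- Functoriality of points in the test ring. -/
def push (u : Pt B (x : L →+* T)) (f : T →ₐ[K] T') :
    Pt B ((f.comp x : L →ₐ[K] T') : L →+* T') := u.map (f : T →+* T')

lemma push_hom (u : Pt B (x : L →+* T)) (f : T →ₐ[K] T') (b : B) :
    (u.push f).hom b = f (u.hom b) := rfl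

lemma push_mul {H : Type u} [CommRing H] [HopfAlgebra L H] (u v : Pt H (x : L →+* T))
    (f : T →ₐ[K] T') : (u * v).push f = u.push f * v.push f := map_mul u v _

lemma fun_congr {C : Type u} [CommRing C] [Algebra L C]
    (F : ∀ {S : Type u} [CommRing S] [Algebra K S] (ι : T →ₐ[K] S),
      Pt C ((ι.comp x : L →ₐ[K] S) : L →+* S) → S) {S : Type u} [CommRing S] [Algebra K S]
    {ι₁ ι₂ : T →ₐ[K] S}
    {w₁ : Pt C ((ι₁.comp x : L →ₐ[K] S) : L →+* S)}
    {w₂ : Pt C ((ι₂.comp x : L →ₐ[K] S) : L →+* S)}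
    (hι : ι₁ = ι₂) (hw : w₁.hom = w₂.hom) : F ι₁ w₁ = F ι₂ w₂ := by
  subst hι
  rw [Pt.ext hw]

/-- Two natural functions on points are equal if they agree on the points that lift along a
dominant morphism. -/
lemma dense (i : B →ₐ[L] H) (hi : Function.Injective i)
    (F₁ F₂ : ∀ {S : Type u} [CommRing S] [Algebra K S] (ι : T →ₐ[K] S),
      Pt B ((ι.comp x : L →ₐ[K] S) : L →+* S) → S)
    (h₁ : ∀ {S S' : Type u} [CommRing S] [Algebra K S] [CommRing S'] [Algebra K S']
      (ι : T →ₐ[K] S) (φ : S →ₐ[K] S') v, φ (F₁ ι v) = F₁ (φ.comp ι) (v.push φ))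
    (h₂ : ∀ {S S' : Type u} [CommRing S] [Algebra K S] [CommRing S'] [Algebra K S']
      (ι : T →ₐ[K] S) (φ : S →ₐ[K] S') v, φ (F₂ ι v) = F₂ (φ.comp ι) (v.push φ))
    (h : ∀ {S : Type u} [CommRing S] [Algebra K S] (ι : T →ₐ[K] S)
      (u : Pt H ((ι.comp x : L →ₐ[K] S) : L →+* S)), F₁ ι (u.res i) = F₂ ι (u.res i))
    (v : Pt B (x : L →+* T)) :
    F₁ (AlgHom.id K T) v = F₂ (AlgHom.id K T) v := by
  let _ := (x : L →+* T).toAlgebra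
  have : IsScalarTower K L T := IsScalarTower.of_algebraMap_eq fun k => (x.commutes k).symm
  let ι : T →ₐ[K] T ⊗[L] B := Algebra.TensorProduct.includeLeft
  let V : B →ₐ[L] T := { v.hom with commutes' := v.base }
  let φ' : T ⊗[L] B →ₐ[L] T :=
    Algebra.TensorProduct.lift (AlgHom.id L T) V (fun _ _ => Commute.all _ _)
  let φ : T ⊗[L] B →ₐ[K] T := φ'.restrictScalars K
  let j' : T ⊗[L] B →ₐ[L] T ⊗[L] H := Algebra.TensorProduct.map (AlgHom.id L T) i
  let j : T ⊗[L] B →ₐ[K] T ⊗[L] H := j'.restrictScalars K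
  let r : B →ₐ[L] T ⊗[L] B := Algebra.TensorProduct.includeRight
  let r' : H →ₐ[L] T ⊗[L] H := Algebra.TensorProduct.includeRight
  have hιr : ∀ l, r (algebraMap L _ l) = ι (x l) := fun l => AlgHom.commutes r l
  let v₁ : Pt B ((ι.comp x : L →ₐ[K] T ⊗[L] B) : L →+* T ⊗[L] B) := ⟨r.toRingHom, hιr⟩
  have hbase : ∀ l, r' (algebraMap L H l) = j (ι (x l)) := by
    intro l
    refine (AlgHom.commutes r' l).trans ?_
    change x l ⊗ₜ 1 = Algebra.TensorProduct.map (AlgHom.id L T) i (x l ⊗ₜ 1)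
    rw [Algebra.TensorProduct.map_tmul, _root_.map_one]
    rfl
  let u : Pt H (((j.comp ι).comp x : L →ₐ[K] T ⊗[L] H) : L →+* T ⊗[L] H) :=
    ⟨r'.toRingHom, hbase⟩
  have hu : (v₁.push j).hom = (u.res i).hom := by
    apply RingHom.ext
    intro b
    change Algebra.TensorProduct.map (AlgHom.id L T) i (1 ⊗ₜ b) = 1 ⊗ₜ (i b)
    rw [Algebra.TensorProduct.map_tmul, _root_.map_one]
  have hj : Function.Injective j := by
    have : ∀ z, j z = i.toLinearMap.lTensor T z := by
      intro z
      induction z with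
      | zero => simp only [_root_.map_zero]
      | tmul a b => rfl
      | add a b ha hb => rw [_root_.map_add, _root_.map_add, ha, hb]
    intro z w hzw
    rw [this, this] at hzw
    exact Module.Flat.lTensor_preserves_injective_linearMap i.toLinearMap hi hzw
  have h3 : F₁ ι v₁ = F₂ ι v₁ := by
    apply hj
    rw [h₁, h₂]
    exact (fun_congr F₁ rfl hu).trans ((h (j.comp ι) u).trans (fun_congr F₂ rfl hu.symm))
  have hφι : φ.comp ι = AlgHom.id K T := by
    apply AlgHom.ext
    intro a
    refine (Algebra.TensorProduct.lift_tmul (AlgHom.id L T) V (fun _ _ => Commute.all _ _) a 1).trans ?_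
    rw [_root_.map_one, mul_one]
    rfl
  have hφr : ∀ b, φ (r b) = v.hom b := by
    intro b
    refine (Algebra.TensorProduct.lift_tmul (AlgHom.id L T) V (fun _ _ => Commute.all _ _) 1 b).trans ?_
    rw [_root_.map_one, one_mul]
    rfl
  have h5 := congrArg φ h3
  rw [h₁, h₂] at h5
  have hv : (v₁.push φ).hom = v.hom := RingHom.ext hφr
  exact (fun_congr F₁ hφι hv).symm.trans (h5.trans (fun_congr F₂ hφι hv))

end Pt

namespace EquivariantGroup

variable {K L : Type u} [Field K] [Field L] [Algebra K L] {G : AffineGroupoid K L}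
  (W : EquivariantGroup G) (I : Ideal W.O)

/-- The closed subgroup of `W` defined by a `G`-stable Hopf ideal, with the induced action. -/
noncomputable def sub [I.IsHopfIdeal L] (hI : W.IsStableIdeal I) : EquivariantGroup G where
  O := W.O ⧸ I
  act g :=
    { toFun := fun u => (W.act g (Pt.ofQuot u)).desc (hI g _ (Pt.ofQuot_mem u))
      map_one' := Pt.ofQuot_injective (by
        rw [Pt.ofQuot_desc, Pt.ofQuot_one, Pt.ofQuot_one, map_one])
      map_mul' := fun u v => Pt.ofQuot_injective (by
        rw [Pt.ofQuot_desc, Pt.ofQuot_mul, Pt.ofQuot_mul, map_mul]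
        rfl) }
  act_map f x y g u := Pt.ofQuot_injective (W.act_map f g (Pt.ofQuot u))
  act_one x u := Pt.ofQuot_injective (W.act_one x (Pt.ofQuot u))
  act_comp g h u := Pt.ofQuot_injective (W.act_comp g h (Pt.ofQuot u))

variable {W I}

section Quot

open coinvariants

lemma coact_mem (hI : W.IsStableIdeal I) {f : W.O} (hf : f ∈ coinvariants L I) :
    (α (L := L) I).toLinearMap.lTensor G.A (W.coact f) =
      (β (L := L) I).toLinearMap.lTensor G.A (W.coact f) := by
  let X := W.O ⊗[L] (W.O ⧸ I)
  let _ : CommRing (G.A ⊗[L] X) := Algebra.TensorProduct.instCommRing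
  let ι : G.A →ₐ[K] G.A ⊗[L] X := Algebra.TensorProduct.includeLeft
  let j : X →ₐ[L] G.A ⊗[L] X := Algebra.TensorProduct.includeRight
  let g := G.univ.map ι
  let u : Pt W.O ((ι.comp G.s : L →ₐ[K] G.A ⊗[L] X) : L →+* G.A ⊗[L] X) :=
    ⟨(j.comp Algebra.TensorProduct.includeLeft).toRingHom, fun l => AlgHom.commutes _ l⟩
  let n : Pt (W.O ⧸ I) ((ι.comp G.s : L →ₐ[K] G.A ⊗[L] X) : L →+* G.A ⊗[L] X) :=
    ⟨(j.comp Algebra.TensorProduct.includeRight).toRingHom, fun l => AlgHom.commutes _ l⟩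
  have hun : ∀ z, (Pt.pair u n).hom z = j z := by
    intro z
    induction z with
    | zero => simp only [map_zero]
    | tmul a b =>
      rw [Pt.pair_tmul]
      change (1 ⊗ₜ (a ⊗ₜ 1)) * (1 ⊗ₜ (1 ⊗ₜ b)) = 1 ⊗ₜ (a ⊗ₜ b)
      simp only [Algebra.TensorProduct.tmul_mul_tmul, mul_one, one_mul]
    | add a b ha hb => rw [map_add, map_add, ha, hb]
  have key : ∀ (γ : W.O →ₐ[L] X)
      (w : Pt W.O ((ι.comp G.s : L →ₐ[K] G.A ⊗[L] X) : L →+* G.A ⊗[L] X)),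
      (∀ f, (Pt.pair u n).hom (γ f) = w.hom f) →
      γ.toLinearMap.lTensor G.A (W.coact f) = (W.act g w).hom f := by
    intro γ w hw
    rw [act_hom]
    generalize W.coact f = z
    induction z with
    | zero => simp only [map_zero]
    | tmul a b =>
      rw [Pt.pair_tmul, ← hw, hun]
      change a ⊗ₜ γ b = (a ⊗ₜ 1) * (1 ⊗ₜ γ b)
      rw [Algebra.TensorProduct.tmul_mul_tmul, mul_one, one_mul]
    | add a b ha hb => rw [map_add, map_add, ha, hb]
  rw [key (α I) _ (α_apply u n), key (β I) _ (β_apply u n), map_mul,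
    apply_mul hf _ _ (hI g _ (Pt.ofQuot_mem n))]

lemma exists_coact (hI : W.IsStableIdeal I) (b : coinvariants L I) :
    ∃ z, (coinvariants L I).val.toLinearMap.lTensor G.A z = W.coact b := by
  have h0 := coact_mem hI b.2
  exact exists_lTensor (M := G.A) (W.coact b) h0

variable (I) in
/-- The inclusion of `A ⊗ B` into `A ⊗ O`, for `B` the ring of coinvariants. -/
noncomputable def inclA : G.A ⊗[L] coinvariants L I →+* G.A ⊗[L] W.O :=
  (Algebra.TensorProduct.map (AlgHom.id L G.A) (coinvariants L I).val).toRingHom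

lemma inclA_eq (z : G.A ⊗[L] coinvariants L I) :
    inclA I z = (coinvariants L I).val.toLinearMap.lTensor G.A z := by
  induction z with
  | zero => simp only [map_zero]
  | tmul a b => rfl
  | add a b ha hb => rw [map_add, map_add, ha, hb]

lemma inclA_injective : Function.Injective (inclA (W := W) I) := fun z w h => by
  rw [inclA_eq, inclA_eq] at h
  exact lTensor_val_injective _ h

/-- The coaction on the ring of coinvariants, obtained by restriction from `O`. -/
noncomputable def coactB (hI : W.IsStableIdeal I) : coinvariants L I →+* G.A ⊗[L] coinvariants L I :=
  have h := fun b => (exists_coact hI b).choose_spec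
  have h' : ∀ b, inclA I (exists_coact hI b).choose = W.coact b :=
    fun b => (inclA_eq _).trans (h b)
  { toFun := fun b => (exists_coact hI b).choose
    map_one' := inclA_injective (by rw [h', map_one]; exact map_one _)
    map_zero' := inclA_injective (by rw [h', map_zero]; exact map_zero _)
    map_add' := fun a b => inclA_injective (by rw [map_add, h', h', h']; exact map_add _ _ _)
    map_mul' := fun a b => inclA_injective (by rw [map_mul, h', h', h']; exact map_mul _ _ _) }

lemma inclA_coactB (hI : W.IsStableIdeal I) (b : coinvariants L I) :
    inclA I (coactB hI b) = W.coact b :=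
  (inclA_eq _).trans (exists_coact hI b).choose_spec

lemma coactB_algebraMap (hI : W.IsStableIdeal I) (l : L) :
    coactB hI (algebraMap L _ l) = G.t l ⊗ₜ 1 := by
  apply inclA_injective
  rw [inclA_coactB]
  exact (W.act _ _).base l

variable {T T' : Type u} [CommRing T] [Algebra K T] [CommRing T'] [Algebra K T']

/-- The action of `G` on the points of the quotient group. -/
noncomputable def actB (hI : W.IsStableIdeal I) {x y : L →ₐ[K] T} (g : G.Hom x y)
    (v : Pt (coinvariants L I) (x : L →+* T)) : Pt (coinvariants L I) (y : L →+* T) :=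
  ⟨(Pt.pair (AffineGroupoid.Hom.pt g) v).hom.comp (coactB hI), fun l => by
    change (Pt.pair (AffineGroupoid.Hom.pt g) v).hom (coactB hI _) = _
    rw [coactB_algebraMap, Pt.pair_tmul, map_one, mul_one]
    exact g.target l⟩

lemma actB_map (hI : W.IsStableIdeal I) {x y : L →ₐ[K] T} (f : T →ₐ[K] T') (g : G.Hom x y)
    (v : Pt (coinvariants L I) (x : L →+* T)) :
    (actB hI g v).push f = actB hI (g.map f) (v.push f) := by
  apply Pt.ext'
  intro b
  have h := Pt.pair_map (AffineGroupoid.Hom.pt g) v (f : T →+* T')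
  exact congrArg (fun p => p.hom (coactB hI b)) h

lemma actB_res (hI : W.IsStableIdeal I) {x y : L →ₐ[K] T} (g : G.Hom x y)
    (u : Pt W.O (x : L →+* T)) :
    actB hI g (u.res (coinvariants L I).val) = (W.act g u).res (coinvariants L I).val := by
  apply Pt.ext'
  intro b
  rw [Pt.res_hom, act_hom]
  change _ = (Pt.pair (AffineGroupoid.Hom.pt g) u).hom (W.coact (b : W.O))
  rw [← inclA_coactB hI]
  change (Pt.pair (AffineGroupoid.Hom.pt g) _).hom (coactB hI b) = _
  rw [show AffineGroupoid.Hom.pt g = (AffineGroupoid.Hom.pt g).res (AlgHom.id L G.A) from rfl,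
    Pt.pair_res]
  rfl

lemma actB_one (hI : W.IsStableIdeal I) (x : L →ₐ[K] T)
    (v : Pt (coinvariants L I) (x : L →+* T)) : actB hI (G.one x) v = v := by
  apply Pt.ext'
  intro b
  refine Pt.dense (x := x) (coinvariants L I).val Subtype.val_injective (fun {S} _ _ ι v => (actB hI (G.one (ι.comp x)) v).hom b)
    (fun {S} _ _ ι v => v.hom b) ?_ ?_ ?_ v
  · intro S S' _ _ _ _ ι φ v
    have h := actB_map hI φ (G.one (ι.comp x)) v
    rw [G.one_map] at h
    exact congrArg (fun p => p.hom b) h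
  · intro S S' _ _ _ _ ι φ v
    rfl
  · intro S _ _ ι u
    exact congrArg (fun p => p.hom b) ((actB_res hI _ u).trans
      (congrArg (fun p => Pt.res p (coinvariants L I).val) (W.act_one _ u)))

lemma actB_comp (hI : W.IsStableIdeal I) {x y z : L →ₐ[K] T} (g : G.Hom y z) (h : G.Hom x y)
    (v : Pt (coinvariants L I) (x : L →+* T)) :
    actB hI (G.comp g h) v = actB hI g (actB hI h v) := by
  apply Pt.ext'
  intro b
  refine Pt.dense (x := x) (coinvariants L I).val Subtype.val_injective (fun {S} _ _ ι v => (actB hI (G.comp (g.map ι) (h.map ι)) v).hom b)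
    (fun {S} _ _ ι v => (actB hI (g.map ι) (actB hI (h.map ι) v)).hom b) ?_ ?_ ?_ v
  · intro S S' _ _ _ _ ι φ v
    have e := actB_map hI φ (G.comp (g.map ι) (h.map ι)) v
    rw [G.comp_map] at e
    exact congrArg (fun p => p.hom b) e
  · intro S S' _ _ _ _ ι φ v
    have e := actB_map hI φ (g.map ι) (actB hI (h.map ι) v)
    rw [actB_map hI φ (h.map ι) v] at e
    exact congrArg (fun p => p.hom b) e
  · intro S _ _ ι u
    have e : actB hI (G.comp (g.map ι) (h.map ι)) (u.res (coinvariants L I).val) =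
        actB hI (g.map ι) (actB hI (h.map ι) (u.res (coinvariants L I).val)) := by
      rw [actB_res, actB_res, actB_res, W.act_comp]
    exact congrArg (fun p => p.hom b) e

variable [I.IsHopfIdeal L] [IsNormalIdeal L I]

lemma actB_mul_res (hI : W.IsStableIdeal I) {x y : L →ₐ[K] T} (g : G.Hom x y)
    (u : Pt W.O (x : L →+* T)) (w : Pt (coinvariants L I) (x : L →+* T)) :
    actB hI g (u.res (coinvariants L I).val * w) =
      actB hI g (u.res (coinvariants L I).val) * actB hI g w := by
  apply Pt.ext'
  intro b
  refine Pt.dense (x := x) (coinvariants L I).val Subtype.val_injective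
    (fun {S} _ _ ι w => (actB hI (g.map ι)
      ((u.push ι).res (coinvariants L I).val * w)).hom b)
    (fun {S} _ _ ι w => (actB hI (g.map ι) ((u.push ι).res (coinvariants L I).val) *
      actB hI (g.map ι) w).hom b) ?_ ?_ ?_ w
  · intro S S' _ _ _ _ ι φ v
    have h := actB_map hI φ (g.map ι) ((u.push ι).res (coinvariants L I).val * v)
    rw [Pt.push_mul] at h
    exact congrArg (fun p => p.hom b) h
  · intro S S' _ _ _ _ ι φ v
    have h := Pt.push_mul (actB hI (g.map ι) ((u.push ι).res (coinvariants L I).val))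
      (actB hI (g.map ι) v) φ
    rw [actB_map, actB_map] at h
    exact congrArg (fun p => p.hom b) h
  · intro S _ _ ι v
    have h : actB hI (g.map ι) ((u.push ι).res (coinvariants L I).val *
        v.res (coinvariants L I).val) =
        actB hI (g.map ι) ((u.push ι).res (coinvariants L I).val) *
          actB hI (g.map ι) (v.res (coinvariants L I).val) := by
      erw [← Pt.res_coinvariants_mul]
      rw [actB_res, map_mul, Pt.res_coinvariants_mul, ← actB_res, ← actB_res]
    exact congrArg (fun p => p.hom b) h

lemma actB_mul (hI : W.IsStableIdeal I) {x y : L →ₐ[K] T} (g : G.Hom x y)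
    (v w : Pt (coinvariants L I) (x : L →+* T)) :
    actB hI g (v * w) = actB hI g v * actB hI g w := by
  apply Pt.ext'
  intro b
  refine Pt.dense (x := x) (coinvariants L I).val Subtype.val_injective
    (fun {S} _ _ ι v => (actB hI (g.map ι) (v * w.push ι)).hom b)
    (fun {S} _ _ ι v => (actB hI (g.map ι) v * actB hI (g.map ι) (w.push ι)).hom b)
    ?_ ?_ ?_ v
  · intro S S' _ _ _ _ ι φ v
    have h := actB_map hI φ (g.map ι) (v * w.push ι)
    rw [Pt.push_mul] at h
    exact congrArg (fun p => p.hom b) h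
  · intro S S' _ _ _ _ ι φ v
    have h := Pt.push_mul (actB hI (g.map ι) v) (actB hI (g.map ι) (w.push ι))
      φ
    rw [actB_map, actB_map] at h
    exact congrArg (fun p => p.hom b) h
  · intro S _ _ ι u
    exact congrArg (fun p => p.hom b) (actB_mul_res hI (g.map ι) u (w.push ι))

variable (W I) in
/-- The quotient of `W` by the normal closed subgroup defined by a `G`-stable Hopf ideal, with the
induced action. -/
noncomputable def quot (hI : W.IsStableIdeal I) : EquivariantGroup G where
  O := coinvariants L I
  act g :=
    { toFun := actB hI g
      map_one' := by
        have h := actB_mul hI g 1 1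
        rw [mul_one] at h
        exact left_eq_mul.1 h
      map_mul' := actB_mul hI g }
  act_map f _ _ g v := actB_map hI f g v
  act_one x v := actB_one hI x v
  act_comp g h v := actB_comp hI g h v

end Quot

end EquivariantGroup

/-! ### Graded pieces of the lower central series -/

section Image

variable {L : Type u} [Field L] {H : Type u} [CommRing H] [HopfAlgebra L H] (I J : Ideal H)
  {T : Type u} [CommRing T] {x : L →+* T}

lemma mem_map_iff (u : Pt (H ⧸ I) x) :
    u.Mem (J.map (Ideal.Quotient.mk I)) ↔ (Pt.ofQuot u).Mem J :=
  Ideal.map_le_iff_le_comap (f := Ideal.Quotient.mk I) (I := J) (K := RingHom.ker u.hom)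

variable [I.IsHopfIdeal L]

lemma ofQuot_inv (u : Pt (H ⧸ I) x) : Pt.ofQuot u⁻¹ = (Pt.ofQuot u)⁻¹ :=
  eq_inv_of_mul_eq_one_left (by rw [← Pt.ofQuot_mul, inv_mul_cancel, Pt.ofQuot_one])

instance [J.IsHopfIdeal L] : (J.map (Ideal.Quotient.mk I)).IsHopfIdeal L := by
  refine isHopfIdeal_of_points _ (fun x => ?_) (fun u v hu hv => ?_) (fun u hu => ?_)
  · rw [mem_map_iff, Pt.ofQuot_one]
    exact Pt.mem_one
  · rw [mem_map_iff] at *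
    rw [Pt.ofQuot_mul]
    exact hu.mul hv
  · rw [mem_map_iff] at *
    rw [ofQuot_inv]
    exact hu.inv

instance [hJ : IsNormalIdeal L J] : IsNormalIdeal L (J.map (Ideal.Quotient.mk I)) where
  conj_mem u n hn := by
    rw [mem_map_iff] at *
    rw [Pt.ofQuot_mul, Pt.ofQuot_mul, ofQuot_inv]
    exact hJ.conj_mem _ _ hn

end Image

namespace EquivariantGroup

variable {K L : Type u} [Field K] [Field L] [Algebra K L] {G : AffineGroupoid K L}
  (W : EquivariantGroup G)

/-- For closed subgroups `N ⊆ M` of `W`, defined by `G`-stable ideals `J ⊇ I`, with `N` normal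
in `W`, the group `M / N` with its action of `G`. -/
noncomputable def subquot (I J : Ideal W.O) [I.IsHopfIdeal L] [hJ : J.IsHopfIdeal L]
    [hN : IsNormalIdeal L J] (hI : W.IsStableIdeal I) (hJs : W.IsStableIdeal J) :
    EquivariantGroup G :=
  let M := W.sub I hI
  let J' : Ideal M.O := J.map (Ideal.Quotient.mk I)
  have _h1 : J'.IsHopfIdeal L := inferInstanceAs ((J.map (Ideal.Quotient.mk I)).IsHopfIdeal L)
  have _h2 : IsNormalIdeal L J' :=
    inferInstanceAs (IsNormalIdeal L (J.map (Ideal.Quotient.mk I)))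
  M.quot J' fun g u hu => (mem_map_iff I J _).2 (hJs g _ ((mem_map_iff I J u).1 hu))

/-- The graded piece `Uⁱ / Uⁱ⁺¹` of the lower central series `U¹ = U`, `Uⁱ⁺¹ = [Uⁱ, U]`. -/
noncomputable def gr (i : ℕ) : EquivariantGroup G :=
  W.subquot (lcsIdeal L W.O i) (lcsIdeal L W.O (i + 1)) (W.isStableIdeal_lcsIdeal i)
    (W.isStableIdeal_lcsIdeal (i + 1))

/-- The quotient `Uₙ = U / Uⁿ` of `U` by the `n`-th term of its lower central series. -/
noncomputable def lcsQuot (n : ℕ) : EquivariantGroup G :=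
  W.quot (lcsIdeal L W.O n) (W.isStableIdeal_lcsIdeal n)

/-! ### Cohomology with coefficients in a vector scheme -/

/-- The additive functions on a group scheme, i.e. the primitive elements of its Hopf algebra. If
`W = Spec (Sym (Vᵛ))` is a vector scheme then this is `Vᵛ`. -/
def prim : Submodule L W.O :=
  LinearMap.ker (Coalgebra.comul (R := L) - (TensorProduct.mk L W.O W.O).flip 1 -
    TensorProduct.mk L W.O W.O 1)

variable {W}

lemma mem_prim_iff {f : W.O} :
    f ∈ W.prim ↔ Coalgebra.comul (R := L) f = f ⊗ₜ 1 + 1 ⊗ₜ f := by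
  rw [prim, LinearMap.mem_ker, LinearMap.sub_apply, LinearMap.sub_apply, sub_sub, sub_eq_zero]
  rfl

lemma mul_hom_prim {f : W.O} (hf : f ∈ W.prim) {T : Type u} [CommRing T] {x : L →+* T}
    (u v : Pt W.O x) : (u * v).hom f = u.hom f + v.hom f := by
  rw [Pt.mul_hom, mem_prim_iff.1 hf, map_add, Pt.pair_tmul, Pt.pair_tmul, map_one, map_one,
    mul_one, one_mul]

lemma exists_coact_prim {f : W.O} (hf : f ∈ W.prim) :
    ∃ z, W.prim.subtype.lTensor G.A z = W.coact f := by
  have hex := LinearMap.exact_subtype_ker_map (Coalgebra.comul (R := L) (A := W.O) -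
    (TensorProduct.mk L W.O W.O).flip 1 - TensorProduct.mk L W.O W.O 1)
  refine (Module.Flat.lTensor_exact G.A hex _).1 ?_
  let X := W.O ⊗[L] W.O
  let _ : CommRing (G.A ⊗[L] X) := Algebra.TensorProduct.instCommRing
  let ι : G.A →ₐ[K] G.A ⊗[L] X := Algebra.TensorProduct.includeLeft
  let j : X →ₐ[L] G.A ⊗[L] X := Algebra.TensorProduct.includeRight
  let g := G.univ.map ι
  let u : Pt W.O ((ι.comp G.s : L →ₐ[K] G.A ⊗[L] X) : L →+* G.A ⊗[L] X) :=
    ⟨(j.comp Algebra.TensorProduct.includeLeft).toRingHom, fun l => AlgHom.commutes _ l⟩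
  let v : Pt W.O ((ι.comp G.s : L →ₐ[K] G.A ⊗[L] X) : L →+* G.A ⊗[L] X) :=
    ⟨(j.comp Algebra.TensorProduct.includeRight).toRingHom, fun l => AlgHom.commutes _ l⟩
  have huv : ∀ z, (Pt.pair u v).hom z = j z := by
    intro z
    induction z with
    | zero => simp only [map_zero]
    | tmul a b =>
      rw [Pt.pair_tmul]
      change (1 ⊗ₜ (a ⊗ₜ 1)) * (1 ⊗ₜ (1 ⊗ₜ b)) = 1 ⊗ₜ (a ⊗ₜ b)
      simp only [Algebra.TensorProduct.tmul_mul_tmul, mul_one, one_mul]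
    | add a b ha hb => rw [map_add, map_add, ha, hb]
  have key : ∀ (γ : W.O →ₗ[L] X)
      (w : Pt W.O ((ι.comp G.s : L →ₐ[K] G.A ⊗[L] X) : L →+* G.A ⊗[L] X)),
      (∀ f, j (γ f) = w.hom f) → γ.lTensor G.A (W.coact f) = (W.act g w).hom f := by
    intro γ w hw
    rw [act_hom]
    generalize W.coact f = z
    induction z with
    | zero => simp only [map_zero]
    | tmul a b =>
      rw [Pt.pair_tmul, ← hw]
      change a ⊗ₜ γ b = (a ⊗ₜ 1) * (1 ⊗ₜ γ b)
      rw [Algebra.TensorProduct.tmul_mul_tmul, mul_one, one_mul]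
    | add a b ha hb => rw [map_add, map_add, ha, hb]
  have k1 := key (Coalgebra.comul (R := L)) (u * v) fun f => by rw [Pt.mul_hom, huv]
  have k2 := key ((TensorProduct.mk L W.O W.O).flip 1) u fun f => rfl
  have k3 := key (TensorProduct.mk L W.O W.O 1) v fun f => rfl
  rw [map_mul, mul_hom_prim hf, ← k2, ← k3] at k1
  rw [LinearMap.lTensor_sub, LinearMap.lTensor_sub]
  exact (congrArg (fun w => w - _ - _) k1).trans (by rw [sub_sub, sub_self])

lemma lTensor_prim_injective : Function.Injective (W.prim.subtype.lTensor G.A) :=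
  Module.Flat.lTensor_preserves_injective_linearMap _ Subtype.val_injective

variable (W) in
/-- The coaction on `Vᵛ ⊆ O`, obtained by restriction from `O`. -/
noncomputable def coactPrim : W.prim →+ G.A ⊗[L] W.prim where
  toFun f := (exists_coact_prim f.2).choose
  map_zero' := lTensor_prim_injective (by
    rw [(exists_coact_prim (0 : W.prim).2).choose_spec]
    exact (map_zero W.coact).trans (map_zero _).symm)
  map_add' a b := lTensor_prim_injective (by
    rw [map_add, (exists_coact_prim a.2).choose_spec, (exists_coact_prim b.2).choose_spec,
      (exists_coact_prim (a + b).2).choose_spec]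
    exact map_add _ _ _)

lemma lTensor_coactPrim (f : W.prim) :
    W.prim.subtype.lTensor G.A (W.coactPrim f) = W.coact f :=
  (exists_coact_prim f.2).choose_spec

lemma coactPrim_smul (l : L) (f : W.prim) : W.coactPrim (l • f) = G.t l • W.coactPrim f := by
  apply lTensor_prim_injective
  have h1 : ∀ z : G.A ⊗[L] W.prim, W.prim.subtype.lTensor G.A (G.t l • z) =
      (G.t l ⊗ₜ 1) * W.prim.subtype.lTensor G.A z := by
    intro z
    induction z with
    | zero => simp only [smul_zero, map_zero, mul_zero]
    | tmul a b =>
      rw [TensorProduct.smul_tmul', LinearMap.lTensor_tmul, LinearMap.lTensor_tmul,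
        Algebra.TensorProduct.tmul_mul_tmul, one_mul, smul_eq_mul]
    | add a b ha hb => rw [smul_add, map_add, map_add, ha, hb, mul_add]
  rw [h1, lTensor_coactPrim, lTensor_coactPrim]
  have h2 : W.coact (algebraMap L W.O l) = G.t l ⊗ₜ 1 := (W.act _ _).base l
  rw [← h2, ← map_mul, ← Algebra.smul_def]
  rfl

variable (W) in
/-- The sections of `x^* V` over `T`, for `x : L →+* T`, where `V` is the dual of the space `Vᵛ`
of additive functions: the `x`-semilinear maps from `Vᵛ` to `T`. -/
def VSec {T : Type u} [CommRing T] (x : L →+* T) : Type u := W.prim →ₛₗ[x] T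

section VSec

instance {T : Type u} [CommRing T] (x : L →+* T) : FunLike (W.VSec x) W.prim T :=
  inferInstanceAs (FunLike (W.prim →ₛₗ[x] T) W.prim T)

instance {T : Type u} [CommRing T] (x : L →+* T) : SemilinearMapClass (W.VSec x) x W.prim T :=
  inferInstanceAs (SemilinearMapClass (W.prim →ₛₗ[x] T) x W.prim T)

noncomputable instance {T : Type u} [CommRing T] (x : L →+* T) : AddCommGroup (W.VSec x) :=
  inferInstanceAs (AddCommGroup (W.prim →ₛₗ[x] T))

noncomputable instance {T : Type u} [CommRing T] [Algebra K T] (x : L →+* T) :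
    Module K (W.VSec x) :=
  inferInstanceAs (Module K (W.prim →ₛₗ[x] T))

lemma VSec.ext {T : Type u} [CommRing T] {x : L →+* T} {θ η : W.VSec x} (h : ∀ f, θ f = η f) :
    θ = η := LinearMap.ext h

variable {T T' : Type u} [CommRing T] [Algebra K T] [CommRing T'] [Algebra K T']
  {x y : L →ₐ[K] T}

/-- Pullback of sections. -/
def vmap {x : L →+* T} (θ : W.VSec x) (f : T →+* T') : W.VSec (f.comp x) where
  toFun p := f (θ p)
  map_add' p q := by rw [map_add, map_add]
  map_smul' l p := by
    rw [map_smulₛₗ, smul_eq_mul, map_mul]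
    rfl

/-- The map `a ⊗ f ↦ g(a) θ(f)`. -/
noncomputable def evalSec (g : G.Hom x y) (θ : W.VSec (x : L →+* T)) : G.A ⊗[L] W.prim →+ T :=
  TensorProduct.liftAddHom
    ((AddMonoidHom.mul (R := T)).compl₂ (θ : W.prim →+ T) |>.comp (g.hom : G.A →+* T).toAddMonoidHom)
    fun l a f => by
      change g.hom (G.s l * a) * θ f = g.hom a * θ (l • f)
      rw [map_mul, g.source, map_smulₛₗ, smul_eq_mul, ← mul_assoc, mul_comm (x l)]
      rfl

/-- The action `ρ(g) : x^* V ⟶ y^* V` of an arrow `g : x ⟶ y` with values in `T`. -/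
noncomputable def vact (g : G.Hom x y) (θ : W.VSec (x : L →+* T)) : W.VSec (y : L →+* T) where
  toFun f := evalSec g θ (W.coactPrim f)
  map_add' p q := by rw [map_add, map_add]
  map_smul' l p := by
    rw [coactPrim_smul]
    generalize W.coactPrim p = z
    induction z with
    | zero => simp only [smul_zero, map_zero]
    | tmul a b =>
      rw [TensorProduct.smul_tmul']
      change g.hom (G.t l * a) * θ b = y l * (g.hom a * θ b)
      rw [map_mul, g.target, mul_assoc]
    | add a b ha hb => rw [smul_add, map_add, map_add, ha, hb, smul_add]

lemma vact_add (g : G.Hom x y) (θ η : W.VSec (x : L →+* T)) :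
    vact g (θ + η) = vact g θ + vact g η := by
  refine VSec.ext fun f => ?_
  change evalSec g (θ + η) (W.coactPrim f) = evalSec g θ (W.coactPrim f) +
    evalSec g η (W.coactPrim f)
  generalize W.coactPrim f = z
  induction z with
  | zero => simp only [map_zero, add_zero]
  | tmul a b => exact mul_add _ _ _
  | add a b ha hb => rw [map_add, map_add, map_add, ha, hb]; abel

lemma vact_smul (g : G.Hom x y) (k : K) (θ : W.VSec (x : L →+* T)) :
    vact g (k • θ) = k • vact g θ := by
  refine VSec.ext fun f => ?_
  change evalSec g (k • θ) (W.coactPrim f) = k • evalSec g θ (W.coactPrim f)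
  generalize W.coactPrim f = z
  induction z with
  | zero => simp only [map_zero, smul_zero]
  | tmul a b => exact mul_smul_comm _ _ _
  | add a b ha hb => rw [map_add, map_add, ha, hb, smul_add]

end VSec

variable (W)

/-- The value `φ(g)` of a `1`-cochain `φ` (a section of `t^* V` over `G`) at a point `g` of `G`. -/
def cochainValue (φ : W.VSec (G.t : L →+* G.A)) {T : Type u} [CommRing T] [Algebra K T]
    {x y : L →ₐ[K] T} (g : G.Hom x y) : W.VSec (y : L →+* T) where
  toFun f := g.hom (φ f)
  map_add' p q := by rw [map_add, map_add]
  map_smul' l p := by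
    rw [map_smulₛₗ, smul_eq_mul, map_mul]
    exact congrArg (· * _) (g.target l)

/-- The space of `1`-cocycles: `0 = (d¹ φ)(g, h) = ρ(g) φ(h) - φ(g h) + φ(g)` for all composable
points `g, h` of `G`. -/
def Z1 : Submodule K (W.VSec (G.t : L →+* G.A)) where
  carrier := {φ | ∀ {T : Type u} [CommRing T] [Algebra K T] {x y z : L →ₐ[K] T} (g : G.Hom y z)
    (h : G.Hom x y), vact g (W.cochainValue φ h) - W.cochainValue φ (G.comp g h) +
      W.cochainValue φ g = 0}
  add_mem' {φ ψ} hφ hψ T _ _ x y z g h := by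
    have e : ∀ {x y : L →ₐ[K] T} (g : G.Hom x y), W.cochainValue (φ + ψ) g =
        W.cochainValue φ g + W.cochainValue ψ g := fun g => VSec.ext fun f => map_add g.hom _ _
    rw [e, e, e, vact_add]
    have := congrArg₂ (· + ·) (hφ g h) (hψ g h)
    simp only [add_zero] at this
    rw [← this]
    abel
  zero_mem' {T _ _ x y z} g h := by
    have e : ∀ {x y : L →ₐ[K] T} (g : G.Hom x y), W.cochainValue 0 g = 0 :=
      fun g => VSec.ext fun f => map_zero g.hom
    have h0 : vact g (0 : W.VSec (y : L →+* T)) = 0 := by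
      have := vact_smul g (0 : K) (0 : W.VSec (y : L →+* T))
      rwa [zero_smul, zero_smul] at this
    rw [e, e, e, h0, sub_zero, add_zero]
  smul_mem' k φ hφ T _ _ x y z g h := by
    have e : ∀ {x y : L →ₐ[K] T} (g : G.Hom x y), W.cochainValue (k • φ) g =
        k • W.cochainValue φ g := fun g => VSec.ext fun f => map_smul g.hom _ _
    rw [e, e, e, vact_smul, ← smul_sub, ← smul_add, hφ g h, smul_zero]

/-- The differential `(d⁰ v)(g) = ρ(g) (s(g)^* v) - t(g)^* v`. -/
noncomputable def d0 : W.VSec (RingHom.id L) →ₗ[K] W.VSec (G.t : L →+* G.A) where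
  toFun v := vact G.univ (vmap v (G.s : L →+* G.A)) - vmap v (G.t : L →+* G.A)
  map_add' v w := by
    have e : ∀ f : L →+* G.A, vmap (v + w) f = vmap v f + vmap w f :=
      fun f => VSec.ext fun p => map_add f _ _
    rw [e, e]
    refine (congrArg (· - _) (vact_add _ _ _)).trans ?_
    abel
  map_smul' k v := by
    have e1 : vmap (k • v) (G.s : L →+* G.A) = k • vmap v (G.s : L →+* G.A) :=
      VSec.ext fun p => map_smul G.s _ _
    have e2 : vmap (k • v) (G.t : L →+* G.A) = k • vmap v (G.t : L →+* G.A) :=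
      VSec.ext fun p => map_smul G.t _ _
    rw [e1, e2]
    refine (congrArg (· - _) (vact_smul _ _ _)).trans ?_
    rw [RingHom.id_apply, smul_sub]

/-- The first cohomology `H¹(G, V)`, a vector space over `K`, for the representation `V` of `G`
with `W = Spec (Sym (Vᵛ))`: cocycles modulo coboundaries. -/
abbrev VecH1 : Type u := W.Z1 ⧸ (LinearMap.range W.d0).submoduleOf W.Z1

end EquivariantGroup

/-! The proof is an induction on `n` along the central extensions of `Uₙ` by the vector groups `V =
Uⁿ / Uⁿ⁺¹`, with middle term `Uₙ₊₁`, carried out with cocycles instead of torsors.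

Structure of unipotent groups. Unipotence makes the Hopf algebra conilpotent
(`IsUnipotentGroup.isConilpotent`): its coradical filtration is exhaustive, so series in convolution
powers of a map vanishing at `1` are finite on each function. In characteristic zero this gives
powers `uᵗ`, logarithms and exponentials. Two consequences are used throughout. A closed subgroup
has an equivariant retraction (`IsConilpotent.hasEquivariantRetraction`), so points of a quotient
lift over every ring. A commutative unipotent group is a vector group, its points being the linear
functionals on its primitive elements (`logPt_bijective`). Together they produce the central
extensions (`quotExt`, `lcsExt`).

Torsors and cocycles. A faithfully flat covering has no Čech cohomology with values in a vector
group, by exactness of the Amitsur complex. This passes through the extensions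
(`CentralExt.cechTrivial`), so every equivariant torsor over `R ⊗ L` has a section
(`nonempty_section`), and `H¹(G_R, U_R)` is the set of `1`-cocycles over `R` modulo the action of
`0`-cochains.

The induction. For `n = 1` the group is trivial and the functor is represented by `Spec K`. Suppose
that `Spec X` represents the classes for `Uₙ`, with universal cocycle `c`. The defect of a lift of
`c` to `Uₙ₊₁` is a `2`-cochain with values in `V`. Cochains over `R` are `R ⊗ -` of cochains over
`K`, so the locus where this defect is a coboundary is closed, given by an ideal `𝔞`
(`exists_lifting_ideal`). Over `X ⧸ 𝔞` a lift exists, and all lifts differ from it by `1`-cocycles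
of `V`, which modulo coboundaries form `R ⊗ H¹(G, V)` by flatness. Since `H⁰` of every graded piece
vanishes, cocycles have trivial stabilizers; hence lifts of the same cocycle are equivalent only if
they differ by a coboundary. So the classes for `Uₙ₊₁` are represented by the affine space of
dimension `dim H¹(G, V)` over `X ⧸ 𝔞` (`CentralExt.exists_cocyclesRepresentedBy`), which gives
finite type and the bound on the dimension. -/

/-! ### Contraction of tensors with linear forms -/

section Slices

variable {L : Type u} [Field L] {V W : Type u} [AddCommGroup V] [Module L V]
  [AddCommGroup W] [Module L W]

/-- Contraction of the second tensor factor with a linear form. -/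
noncomputable def rslice (V : Type u) [AddCommGroup V] [Module L V] (φ : W →ₗ[L] L) :
    V ⊗[L] W →ₗ[L] V :=
  (TensorProduct.rid L V).toLinearMap ∘ₗ φ.lTensor V

/-- Contraction of the first tensor factor with a linear form. -/
noncomputable def lslice (V : Type u) [AddCommGroup V] [Module L V] (φ : W →ₗ[L] L) :
    W ⊗[L] V →ₗ[L] V :=
  (TensorProduct.lid L V).toLinearMap ∘ₗ φ.rTensor V

@[simp] lemma rslice_tmul (φ : W →ₗ[L] L) (v : V) (w : W) : rslice V φ (v ⊗ₜ w) = φ w • v := by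
  simp [rslice]

@[simp] lemma lslice_tmul (φ : W →ₗ[L] L) (v : V) (w : W) : lslice V φ (w ⊗ₜ v) = φ w • v := by
  simp [lslice]

lemma eq_zero_of_lslice (z : W ⊗[L] V) (h : ∀ φ : W →ₗ[L] L, lslice V φ z = 0) : z = 0 :=
  EquivariantGroup.eq_zero_of_forall_rTensor z h

lemma lslice_comm (φ : W →ₗ[L] L) (z : V ⊗[L] W) :
    lslice V φ (TensorProduct.comm L V W z) = rslice V φ z := by
  induction z with
  | zero => simp
  | tmul a b => simp
  | add a b ha hb => simp only [map_add, ha, hb]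

lemma eq_zero_of_rslice (z : V ⊗[L] W) (h : ∀ φ : W →ₗ[L] L, rslice V φ z = 0) : z = 0 := by
  apply (TensorProduct.comm L V W).injective
  rw [map_zero]
  exact eq_zero_of_lslice _ fun φ => by rw [lslice_comm, h]

lemma rslice_rTensor {V' : Type u} [AddCommGroup V'] [Module L V'] (g : V →ₗ[L] V')
    (φ : W →ₗ[L] L) (z : V ⊗[L] W) : rslice V' φ (g.rTensor W z) = g (rslice V φ z) := by
  induction z with
  | zero => simp
  | tmul a b => simp
  | add a b ha hb => simp only [map_add, ha, hb]

lemma lslice_lTensor {V' : Type u} [AddCommGroup V'] [Module L V'] (g : V →ₗ[L] V')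
    (φ : W →ₗ[L] L) (z : W ⊗[L] V) : lslice V' φ (g.lTensor W z) = g (lslice V φ z) := by
  induction z with
  | zero => simp
  | tmul a b => simp
  | add a b ha hb => simp only [map_add, ha, hb]

lemma rslice_lTensor {W' : Type u} [AddCommGroup W'] [Module L W'] (g : W →ₗ[L] W')
    (φ : W' →ₗ[L] L) (z : V ⊗[L] W) :
    rslice V φ (g.lTensor V z) = rslice V (φ ∘ₗ g) z := by
  induction z with
  | zero => simp
  | tmul a b => simp
  | add a b ha hb => simp only [map_add, ha, hb]

/-- The image of `z` in `(V ⧸ N) ⊗ W` has only zero slices, hence vanishes; then right exactness of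
the tensor product applies. -/
lemma mem_range_rTensor_of_rslice (N : Submodule L V) (z : V ⊗[L] W)
    (h : ∀ φ : W →ₗ[L] L, rslice V φ z ∈ N) : ∃ z', N.subtype.rTensor W z' = z := by
  have hex : Function.Exact N.subtype N.mkQ := LinearMap.exact_subtype_mkQ N
  refine (rTensor_exact W hex N.mkQ_surjective z).1 (eq_zero_of_rslice _ fun φ => ?_)
  rw [rslice_rTensor]
  exact (Submodule.Quotient.mk_eq_zero N).2 (h φ)

end Slices

/-! ### Conilpotent Hopf algebras and the coradical filtration -/

section Conilpotent

variable {L : Type u} [Field L] {H : Type u} [CommRing H] [HopfAlgebra L H]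

variable (L H) in
/-- The linear forms on a Hopf algebra that vanish at `1`, inside the convolution algebra. -/
def augDual : Submodule L (WithConv (H →ₗ[L] L)) where
  carrier := {φ | φ.ofConv 1 = 0}
  add_mem' {φ ψ} hφ hψ := by
    change φ.ofConv 1 + ψ.ofConv 1 = 0
    rw [Set.mem_ofPred.1 hφ, Set.mem_ofPred.1 hψ, add_zero]
  zero_mem' := rfl
  smul_mem' c φ hφ := by
    change c • φ.ofConv 1 = 0
    rw [Set.mem_ofPred.1 hφ, smul_zero]

lemma mem_augDual {φ : WithConv (H →ₗ[L] L)} : φ ∈ augDual L H ↔ φ.ofConv 1 = 0 := Iff.rfl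

variable (L H) in
/-- The coradical filtration of a Hopf algebra with trivial coradical: the elements killed by all
products of `n + 1` linear forms vanishing at `1`. -/
def coradFil (n : ℕ) : Submodule L H where
  carrier := {f | ∀ φ ∈ augDual L H ^ (n + 1), φ.ofConv f = 0}
  add_mem' {f g} hf hg φ hφ := by rw [map_add, hf φ hφ, hg φ hφ, add_zero]
  zero_mem' φ _ := map_zero _
  smul_mem' c f hf φ hφ := by rw [map_smul, hf φ hφ, smul_zero]

variable (L H) in
/-- A Hopf algebra is conilpotent if its coradical filtration is exhaustive. -/
def IsConilpotent : Prop := ∀ f : H, ∃ n, f ∈ coradFil L H n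

/-- This converts statements about powers of `augDual` into statements about slices of coproducts.
-/
lemma conv_apply_rslice (φ ψ : WithConv (H →ₗ[L] L)) (f : H) :
    (φ * ψ).ofConv f = φ.ofConv (rslice H ψ.ofConv (Coalgebra.comul (R := L) f)) := by
  change (LinearMap.mul' L L (TensorProduct.map φ.ofConv ψ.ofConv (Coalgebra.comul f))) = _
  generalize Coalgebra.comul (R := L) f = z
  induction z with
  | zero => simp
  | tmul a b => simp [mul_comm]
  | add a b ha hb => simp only [map_add, ha, hb]

lemma conv_apply_lslice (φ ψ : WithConv (H →ₗ[L] L)) (f : H) :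
    (φ * ψ).ofConv f = ψ.ofConv (lslice H φ.ofConv (Coalgebra.comul (R := L) f)) := by
  change (LinearMap.mul' L L (TensorProduct.map φ.ofConv ψ.ofConv (Coalgebra.comul f))) = _
  generalize Coalgebra.comul (R := L) f = z
  induction z with
  | zero => simp
  | tmul a b => simp
  | add a b ha hb => simp only [map_add, ha, hb]

lemma augDual_mul_le : augDual L H * augDual L H ≤ augDual L H := by
  rw [Submodule.mul_le]
  intro φ hφ ψ _
  rw [mem_augDual] at *
  rw [conv_apply_lslice, Bialgebra.comul_one, Algebra.TensorProduct.one_def, lslice_tmul, hφ,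
    zero_smul, map_zero]

lemma Submodule.pow_le_pow_left_of_le {A : Type u} [Semiring A] [Algebra L A]
    {M N : Submodule L A} (h : M ≤ N) : ∀ n : ℕ, M ^ n ≤ N ^ n
  | 0 => le_rfl
  | n + 1 => by
    rw [Submodule.pow_succ, Submodule.pow_succ]
    exact Submodule.mul_le.2 fun a ha b hb =>
      Submodule.mul_mem_mul (Submodule.pow_le_pow_left_of_le h n ha) (h hb)

lemma coradFil_le_succ (n : ℕ) : coradFil L H n ≤ coradFil L H (n + 1) := by
  intro f hf φ hφ
  refine hf φ ?_
  have : ∀ n : ℕ, augDual L H ^ (n + 1 + 1) ≤ augDual L H ^ (n + 1) := by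
    intro n
    induction n with
    | zero =>
      rw [Submodule.pow_succ, zero_add, Submodule.pow_one]
      exact augDual_mul_le
    | succ n ih =>
      rw [Submodule.pow_succ, Submodule.pow_succ (n := n + 1)]
      exact Submodule.mul_le.2 fun a ha b hb => Submodule.mul_mem_mul (ih ha) hb
  exact this n hφ

lemma coradFil_mono : Monotone (coradFil L H) := monotone_nat_of_le_succ coradFil_le_succ

/-- Slicing the coproduct with a form that vanishes at `1` uses up one of the factors of the
products that kill `f`, so it lowers the filtration by one. -/
lemma rslice_comul_mem {n : ℕ} {f : H} (hf : f ∈ coradFil L H (n + 1)) {φ : H →ₗ[L] L}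
    (hφ : φ 1 = 0) : rslice H φ (Coalgebra.comul (R := L) f) ∈ coradFil L H n := by
  intro ψ hψ
  have := hf (ψ * WithConv.toConv φ) (by
    rw [Submodule.pow_succ]
    exact Submodule.mul_mem_mul hψ hφ)
  rwa [conv_apply_rslice] at this

lemma lslice_comul_mem {n : ℕ} {f : H} (hf : f ∈ coradFil L H (n + 1)) {φ : H →ₗ[L] L}
    (hφ : φ 1 = 0) : lslice H φ (Coalgebra.comul (R := L) f) ∈ coradFil L H n := by
  intro ψ hψ
  have := hf (WithConv.toConv φ * ψ) (by
    rw [Submodule.pow_succ' _ (Nat.succ_ne_zero n)]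
    exact Submodule.mul_mem_mul hφ hψ)
  rwa [conv_apply_lslice] at this

lemma eq_of_forall_form {V : Type u} [AddCommGroup V] [Module L V] {v w : V}
    (h : ∀ φ : V →ₗ[L] L, φ v = φ w) : v = w :=
  sub_eq_zero.1 ((Module.forall_dual_apply_eq_zero_iff L _).1 fun φ => by
    rw [map_sub, h, sub_self])

lemma sub_counit_form (φ : H →ₗ[L] L) : (φ - φ 1 • Coalgebra.counit : H →ₗ[L] L) 1 = 0 := by
  simp

/-- Each form `φ - φ(1) ε` vanishes at `1` and therefore kills `f`, so no linear form separates `f`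
from the scalar `ε(f)`. -/
lemma mem_coradFil_zero {f : H} (hf : f ∈ coradFil L H 0) :
    f = algebraMap L H (Coalgebra.counit (R := L) f) := by
  refine eq_of_forall_form (L := L) fun φ => ?_
  have := hf (WithConv.toConv (φ - φ 1 • Coalgebra.counit (R := L))) (by
    rw [zero_add, Submodule.pow_one]
    exact sub_counit_form φ)
  change φ f - φ 1 * Coalgebra.counit (R := L) f = 0 at this
  rw [Algebra.algebraMap_eq_smul_one, map_smul, smul_eq_mul, mul_comm, sub_eq_zero.1 this]

lemma rslice_counit (f : H) :
    rslice H (Coalgebra.counit (R := L)) (Coalgebra.comul (R := L) f) = f := by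
  rw [rslice, LinearMap.comp_apply, Coalgebra.lTensor_counit_comul]
  simp

lemma lslice_counit (f : H) :
    lslice H (Coalgebra.counit (R := L)) (Coalgebra.comul (R := L) f) = f := by
  rw [lslice, LinearMap.comp_apply, Coalgebra.rTensor_counit_comul]
  simp

/-- For `f` in the `(n+1)`-st step, `Δ f - f ⊗ 1` lies in `Fₙ ⊗ H`. -/
lemma exists_comul_eq {n : ℕ} {f : H} (hf : f ∈ coradFil L H (n + 1)) :
    ∃ z : coradFil L H n ⊗[L] H,
      Coalgebra.comul (R := L) f = f ⊗ₜ 1 + (coradFil L H n).subtype.rTensor H z := by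
  obtain ⟨z, hz⟩ := mem_range_rTensor_of_rslice (coradFil L H n)
    (Coalgebra.comul (R := L) f - f ⊗ₜ 1) (fun φ => by
      have h := rslice_comul_mem hf (sub_counit_form φ)
      -- Slicing the coproduct with the counit returns `f`. So correcting `φ` by `φ(1) ε`, which
      -- makes it vanish at `1`, has the same effect as subtracting `f ⊗ 1` from the coproduct.
      have e : rslice H (φ - φ 1 • Coalgebra.counit (R := L)) (Coalgebra.comul (R := L) f) =
          rslice H φ (Coalgebra.comul (R := L) f - f ⊗ₜ 1) := by
        have h1 : ∀ z : H ⊗[L] H, rslice H (φ - φ 1 • Coalgebra.counit (R := L)) z =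
            rslice H φ z - φ 1 • rslice H (Coalgebra.counit (R := L)) z := by
          intro z
          induction z with
          | zero => simp
          | tmul a b => simp [sub_smul, mul_smul]
          | add a b ha hb => simp only [map_add, ha, hb, smul_add]; abel
        rw [h1, rslice_counit, map_sub, rslice_tmul]
      rwa [e] at h)
  exact ⟨z, by rw [hz]; abel⟩

variable {X : Type u} [CommRing X] [Algebra L X]

/-- In `Δ f = f ⊗ 1 + z` with `z ∈ Fₙ ⊗ H`, the first term is killed by `ψ(1) = 0` and the second by
`φ`. -/
lemma conv_mul_apply_eq_zero {n : ℕ} (φ ψ : WithConv (H →ₗ[L] X)) (hψ : ψ.ofConv 1 = 0)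
    (h : ∀ f ∈ coradFil L H n, φ.ofConv f = 0) {f : H} (hf : f ∈ coradFil L H (n + 1)) :
    (φ * ψ).ofConv f = 0 := by
  obtain ⟨z, hz⟩ := exists_comul_eq hf
  change (LinearMap.mul' L X (TensorProduct.map φ.ofConv ψ.ofConv (Coalgebra.comul f))) = _
  rw [hz, map_add, map_add, TensorProduct.map_tmul, LinearMap.mul'_apply, hψ, mul_zero, zero_add]
  clear hz
  induction z with
  | zero => simp
  | tmul a b => simp [h a.1 a.2]
  | add a b ha hb => simp only [map_add, ha, hb, add_zero]

/-- Linear maps vanishing at `1` are locally nilpotent for convolution. -/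
lemma conv_pow_apply_eq_zero (J : WithConv (H →ₗ[L] X)) (hJ : J.ofConv 1 = 0) :
    ∀ (n : ℕ) {f : H}, f ∈ coradFil L H n → (J ^ (n + 1)).ofConv f = 0
  | 0, f, hf => by
    rw [zero_add, pow_one, mem_coradFil_zero hf, Algebra.algebraMap_eq_smul_one, map_smul, hJ,
      smul_zero]
  | n + 1, f, hf => by
    rw [pow_succ]
    exact conv_mul_apply_eq_zero _ _ hJ (fun f hf => conv_pow_apply_eq_zero J hJ n hf) hf

/-- The bound depends only on `f`, not on the target ring or the map. This is what turns binomial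
and exponential series into polynomials. -/
lemma IsConilpotent.exists_forall_pow (h : IsConilpotent L H) (f : H) :
    ∃ N : ℕ, ∀ k, N ≤ k → ∀ {X : Type u} [CommRing X] [Algebra L X]
      (J : WithConv (H →ₗ[L] X)), J.ofConv 1 = 0 → (J ^ k).ofConv f = 0 := by
  obtain ⟨n, hn⟩ := h f
  refine ⟨n + 1, fun k hk X _ _ J hJ => ?_⟩
  obtain ⟨m, rfl⟩ := Nat.exists_eq_add_of_le hk
  have := conv_pow_apply_eq_zero J hJ (n + m) (coradFil_mono (Nat.le_add_right n m) hn)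
  rwa [show n + 1 + m = n + m + 1 by ring]

section Maps

variable {H' : Type u} [CommRing H'] [HopfAlgebra L H']

/-- Pullback of linear forms along a homomorphism of bialgebras. -/
noncomputable def convPullback (g : H →ₐc[L] H') :
    WithConv (H' →ₗ[L] L) →ₐ[L] WithConv (H →ₗ[L] L) :=
  AlgHom.ofLinearMap
    { toFun := fun φ => WithConv.toConv (φ.ofConv ∘ₗ (g : H →ₗc[L] H').toLinearMap)
      map_add' := fun _ _ => rfl
      map_smul' := fun _ _ => rfl }
    (by
      refine WithConv.ext (LinearMap.ext fun f => ?_)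
      exact LinearMap.congr_fun (g : H →ₗc[L] H').counit_comp f)
    (fun φ ψ => WithConv.ext
      (LinearMap.convMul_comp_coalgHom_distrib φ ψ (g : H →ₗc[L] H')))

lemma convPullback_apply (g : H →ₐc[L] H') (φ : WithConv (H' →ₗ[L] L)) (f : H) :
    (convPullback g φ).ofConv f = φ.ofConv (g f) := rfl

lemma map_augDual_le (g : H →ₐc[L] H') :
    (augDual L H').map (convPullback g).toLinearMap ≤ augDual L H := by
  rintro _ ⟨φ, hφ, rfl⟩
  refine (convPullback_apply g φ 1).trans ?_
  rw [map_one]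
  exact hφ

lemma map_mem_coradFil (g : H →ₐc[L] H') {n : ℕ} {f : H} (hf : f ∈ coradFil L H n) :
    g f ∈ coradFil L H' n := by
  intro φ hφ
  refine hf (convPullback g φ) ?_
  have h1 := Submodule.mem_map_of_mem (f := (convPullback g).toLinearMap) hφ
  rw [Submodule.map_pow] at h1
  exact Submodule.pow_le_pow_left_of_le (map_augDual_le g) (n + 1) h1

lemma IsConilpotent.of_surjective (h : IsConilpotent L H) (g : H →ₐc[L] H')
    (hg : Function.Surjective g) : IsConilpotent L H' := by
  intro f
  obtain ⟨f, rfl⟩ := hg f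
  obtain ⟨n, hn⟩ := h f
  exact ⟨n, map_mem_coradFil g hn⟩

/-- A linear retraction of `g` extends every form on `H` vanishing at `1` to such a form on `H'`;
hence products of these forms extend as well. -/
lemma IsConilpotent.of_injective (h : IsConilpotent L H') (g : H →ₐc[L] H')
    (hg : Function.Injective g) : IsConilpotent L H := by
  have hle : augDual L H ≤ (augDual L H').map (convPullback g).toLinearMap := by
    intro φ hφ
    obtain ⟨r, hr⟩ := LinearMap.exists_leftInverse_of_injective
      (g : H →ₗc[L] H').toLinearMap (LinearMap.ker_eq_bot.2 hg)
    have hr' : ∀ f, r (g f) = f := fun f => LinearMap.congr_fun hr f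
    refine ⟨WithConv.toConv (φ.ofConv ∘ₗ r), ?_, ?_⟩
    · change φ.ofConv (r 1) = 0
      rw [← map_one g, hr']
      exact hφ
    · refine WithConv.ext (LinearMap.ext fun f => ?_)
      change φ.ofConv (r (g f)) = _
      rw [hr']
  intro f
  obtain ⟨n, hn⟩ := h (g f)
  refine ⟨n, fun φ hφ => ?_⟩
  have h1 := Submodule.pow_le_pow_left_of_le hle (n + 1) hφ
  rw [← Submodule.map_pow] at h1
  obtain ⟨ψ, hψ, rfl⟩ := h1
  exact hn ψ hψ

end Maps

end Conilpotent

/-! ### Unipotent groups have conilpotent Hopf algebras -/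

section Unipotent

variable {L : Type u} [Field L] {H : Type u} [CommRing H] [HopfAlgebra L H]

lemma mem_coradFil_succ_of {n : ℕ} {f : H} (h : ∀ χ : H →ₗ[L] L, χ 1 = 0 →
    rslice H χ (Coalgebra.comul (R := L) f) ∈ coradFil L H n) : f ∈ coradFil L H (n + 1) := by
  intro φ hφ
  rw [Submodule.pow_succ] at hφ
  refine Submodule.mul_induction_on hφ (fun ψ hψ χ hχ => ?_) fun φ ψ h1 h2 => ?_
  · rw [conv_apply_rslice]
    exact h _ hχ ψ hψ
  · exact (congrArg₂ (· + ·) h1 h2).trans (add_zero _)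

lemma one_mem_coradFil (n : ℕ) : (1 : H) ∈ coradFil L H n := by
  refine coradFil_mono (Nat.zero_le n) fun φ hφ => ?_
  rw [zero_add, Submodule.pow_one] at hφ
  exact hφ

variable {M : Type u} [AddCommGroup M] [Module L M]

/-- Coassociativity says that slicing the coaction makes `M` a module over the convolution algebra
of linear forms. -/
lemma rslice_coassoc (c : M →ₗ[L] M ⊗[L] H)
    (h : (TensorProduct.assoc L M H H).toLinearMap ∘ₗ c.rTensor H ∘ₗ c =
      (Coalgebra.comul (R := L) (A := H)).lTensor M ∘ₗ c) (φ ψ : H →ₗ[L] L) (m : M) :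
    rslice M ψ (c (rslice M φ (c m))) =
      rslice M (WithConv.toConv ψ * WithConv.toConv φ).ofConv (c m) := by
  have h1 : ∀ z : M ⊗[L] H, rslice M ψ (c (rslice M φ z)) =
      rslice M ψ (rslice (M ⊗[L] H) φ (c.rTensor H z)) := fun z => by rw [rslice_rTensor]
  have h2 : ∀ z : (M ⊗[L] H) ⊗[L] H, rslice M ψ (rslice (M ⊗[L] H) φ z) =
      rslice M (LinearMap.mul' L L ∘ₗ TensorProduct.map ψ φ)
        (TensorProduct.assoc L M H H z) := by
    intro z
    induction z with
    | zero => simp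
    | add a b ha hb => simp only [map_add, ha, hb]
    | tmul a b =>
      induction a with
      | zero => simp
      | add a c ha hc => simp only [map_add, TensorProduct.add_tmul, ha, hc]
      | tmul a c => simp [smul_smul, mul_comm]
  have h3 := LinearMap.congr_fun h m
  simp only [LinearMap.comp_apply, LinearEquiv.coe_coe] at h3
  rw [h1, h2, h3, rslice_lTensor]
  rfl

/-- Every element of a comodule lies in a finite dimensional subcomodule. -/
lemma exists_finite_subcomodule (c : M →ₗ[L] M ⊗[L] H)
    (h : (TensorProduct.assoc L M H H).toLinearMap ∘ₗ c.rTensor H ∘ₗ c =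
      (Coalgebra.comul (R := L) (A := H)).lTensor M ∘ₗ c)
    (h' : (TensorProduct.rid L M).toLinearMap ∘ₗ
      (Coalgebra.counit (R := L) (A := H)).lTensor M ∘ₗ c = LinearMap.id) (m : M) :
    ∃ V : Submodule L M, m ∈ V ∧ Module.Finite L V ∧
      ∀ v ∈ V, ∃ z : V ⊗[L] H, V.subtype.rTensor H z = c v := by
  -- The subcomodule is the orbit of `m` under the convolution algebra. It lies in the span of the
  -- finitely many first components of `c m`, and it is stable by `rslice_coassoc`.
  let F : (H →ₗ[L] L) →ₗ[L] M :=
    { toFun := fun φ => rslice M φ (c m)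
      map_add' := fun φ ψ => by
        simp [rslice, LinearMap.lTensor_add]
      map_smul' := fun a φ => by simp [rslice, LinearMap.lTensor_smul] }
  refine ⟨LinearMap.range F, ⟨Coalgebra.counit (R := L), LinearMap.congr_fun h' m⟩, ?_, ?_⟩
  · obtain ⟨S, hS⟩ := TensorProduct.exists_finset (c m)
    classical
    have hle : LinearMap.range F ≤ Submodule.span L (S.image Prod.fst : Set M) := by
      rintro _ ⟨φ, rfl⟩
      change rslice M φ (c m) ∈ _
      rw [hS, map_sum]
      refine Submodule.sum_mem _ fun i hi => ?_
      rw [rslice_tmul]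
      refine Submodule.smul_mem _ _ (Submodule.subset_span ?_)
      exact Finset.mem_coe.2 (Finset.mem_image_of_mem _ hi)
    have : Module.Finite L (Submodule.span L (S.image Prod.fst : Set M)) :=
      Module.Finite.span_finset L _
    exact Submodule.finiteDimensional_of_le hle
  · rintro _ ⟨φ, rfl⟩
    refine mem_range_rTensor_of_rslice _ _ fun ψ => ?_
    exact ⟨_, (rslice_coassoc c h φ ψ m).symm⟩

/-- The definition of unipotence speaks of finite dimensional comodules only. Local finiteness of
comodules removes this restriction, as needed for quotients of `H` itself. -/
lemma IsUnipotentGroup.exists_fixed (hU : IsUnipotentGroup L H) [Nontrivial M]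
    (c : M →ₗ[L] M ⊗[L] H)
    (h : (TensorProduct.assoc L M H H).toLinearMap ∘ₗ c.rTensor H ∘ₗ c =
      (Coalgebra.comul (R := L) (A := H)).lTensor M ∘ₗ c)
    (h' : (TensorProduct.rid L M).toLinearMap ∘ₗ
      (Coalgebra.counit (R := L) (A := H)).lTensor M ∘ₗ c = LinearMap.id) :
    ∃ m : M, m ≠ 0 ∧ c m = m ⊗ₜ 1 := by
  obtain ⟨m, hm⟩ := exists_ne (0 : M)
  obtain ⟨V, hmV, hfin, hV⟩ := exists_finite_subcomodule c h h' m
  have hinj : ∀ (N : Type u) [AddCommGroup N] [Module L N],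
      Function.Injective (V.subtype.rTensor N) := fun N _ _ =>
    Module.Flat.rTensor_preserves_injective_linearMap _ Subtype.val_injective
  choose cV hcV using fun v : V => hV v.1 v.2
  let d : V →ₗ[L] V ⊗[L] H :=
    { toFun := cV
      map_add' := fun a b => hinj H (by rw [map_add, hcV, hcV, hcV]; exact map_add c _ _)
      map_smul' := fun a b => hinj H (by
        rw [map_smul, hcV, hcV]; exact map_smul c _ _) }
  have hd : ∀ v, V.subtype.rTensor H (d v) = c v := hcV
  have : Nontrivial V := ⟨⟨⟨m, hmV⟩, 0, fun e => hm (congrArg Subtype.val e)⟩⟩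
  have hco : (TensorProduct.assoc L V H H).toLinearMap ∘ₗ d.rTensor H ∘ₗ d =
      (Coalgebra.comul (R := L) (A := H)).lTensor V ∘ₗ d := by
    refine LinearMap.ext fun v => hinj (H ⊗[L] H) ?_
    have e1 : ∀ z : V ⊗[L] H, V.subtype.rTensor (H ⊗[L] H)
        (TensorProduct.assoc L V H H (d.rTensor H z)) =
        TensorProduct.assoc L M H H (c.rTensor H (V.subtype.rTensor H z)) := by
      intro z
      induction z with
      | zero => simp
      | add a b ha hb => simp only [map_add, ha, hb]
      | tmul a b =>
        rw [LinearMap.rTensor_tmul, LinearMap.rTensor_tmul, LinearMap.rTensor_tmul,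
          Submodule.subtype_apply, ← hd]
        generalize d a = w
        induction w with
        | zero => simp
        | add a b ha hb => simp only [map_add, TensorProduct.add_tmul, ha, hb]
        | tmul a c => rfl
    have e2 : ∀ z : V ⊗[L] H, V.subtype.rTensor (H ⊗[L] H)
        ((Coalgebra.comul (R := L) (A := H)).lTensor V z) =
        (Coalgebra.comul (R := L) (A := H)).lTensor M (V.subtype.rTensor H z) := by
      intro z
      induction z with
      | zero => simp
      | add a b ha hb => simp only [map_add, ha, hb]
      | tmul a b => rfl
    refine (e1 (d v)).trans (Eq.trans ?_ (e2 (d v)).symm)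
    rw [hd]
    exact LinearMap.congr_fun h v.1
  have hcu : (TensorProduct.rid L V).toLinearMap ∘ₗ
      (Coalgebra.counit (R := L) (A := H)).lTensor V ∘ₗ d = LinearMap.id := by
    refine LinearMap.ext fun v => Subtype.ext ?_
    have e1 := rslice_rTensor V.subtype (Coalgebra.counit (R := L) (A := H)) (d v)
    rw [hd] at e1
    exact e1.symm.trans (LinearMap.congr_fun h' v.1)
  obtain ⟨v, hv0, hv⟩ := hU.2 V d hco hcu
  refine ⟨v, fun e => hv0 (Subtype.ext e), ?_⟩
  rw [← hd, hv, LinearMap.rTensor_tmul]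
  rfl

/-- The Hopf algebra of a unipotent group is conilpotent. -/
theorem IsUnipotentGroup.isConilpotent (hU : IsUnipotentGroup L H) : IsConilpotent L H := by
  let N : Submodule L H := ⨆ n, coradFil L H n
  have hN : ∀ f, f ∈ N ↔ ∃ n, f ∈ coradFil L H n :=
    fun f => Submodule.mem_iSup_of_directed _ coradFil_mono.directed_le
  suffices hNtop : N = ⊤ from fun f => (hN f).1 (hNtop ▸ Submodule.mem_top)
  by_contra hne
  have : Nontrivial (H ⧸ N) := Submodule.Quotient.nontrivial_iff.2 hne
  let c0 : H →ₗ[L] (H ⧸ N) ⊗[L] H := N.mkQ.rTensor H ∘ₗ Coalgebra.comul (R := L)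
  -- For `f` in `N`, both terms of `Δ f = f ⊗ 1 + z` with `z ∈ Fₙ ⊗ H` lie in `N ⊗ H`, so the
  -- coproduct induces a coaction on `H ⧸ N`.
  have hc0 : N ≤ LinearMap.ker c0 := by
    intro f hf
    obtain ⟨n, hn⟩ := (hN f).1 hf
    obtain ⟨z, hz⟩ := exists_comul_eq (coradFil_le_succ n hn)
    have e : ∀ z : coradFil L H n ⊗[L] H,
        N.mkQ.rTensor H ((coradFil L H n).subtype.rTensor H z) = 0 := by
      intro z
      induction z with
      | zero => simp
      | add a b ha hb => simp only [map_add, ha, hb, add_zero]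
      | tmul a b =>
        have ha : N.mkQ ((coradFil L H n).subtype a) = 0 :=
          (Submodule.Quotient.mk_eq_zero N).2 ((hN _).2 ⟨n, a.2⟩)
        rw [LinearMap.rTensor_tmul, LinearMap.rTensor_tmul, ha, TensorProduct.zero_tmul]
    change N.mkQ.rTensor H (Coalgebra.comul (R := L) f) = 0
    rw [hz, map_add, e, add_zero, LinearMap.rTensor_tmul, Submodule.mkQ_apply,
      (Submodule.Quotient.mk_eq_zero N).2 hf, TensorProduct.zero_tmul]
  let c : (H ⧸ N) →ₗ[L] (H ⧸ N) ⊗[L] H := N.liftQ c0 hc0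
  have hc : ∀ f, c (N.mkQ f) = N.mkQ.rTensor H (Coalgebra.comul (R := L) f) := fun f => rfl
  have hco : (TensorProduct.assoc L (H ⧸ N) H H).toLinearMap ∘ₗ c.rTensor H ∘ₗ c =
      (Coalgebra.comul (R := L) (A := H)).lTensor (H ⧸ N) ∘ₗ c := by
    refine LinearMap.ext fun m => ?_
    obtain ⟨f, rfl⟩ := N.mkQ_surjective m
    have e1 : ∀ z : H ⊗[L] H, TensorProduct.assoc L (H ⧸ N) H H
        (c.rTensor H (N.mkQ.rTensor H z)) = N.mkQ.rTensor (H ⊗[L] H)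
          (TensorProduct.assoc L H H H ((Coalgebra.comul (R := L)).rTensor H z)) := by
      intro z
      induction z with
      | zero => simp
      | add a b ha hb => simp only [map_add, ha, hb]
      | tmul a b =>
        rw [LinearMap.rTensor_tmul, LinearMap.rTensor_tmul, LinearMap.rTensor_tmul, hc]
        generalize Coalgebra.comul (R := L) a = w
        induction w with
        | zero => simp
        | add a b ha hb => simp only [map_add, TensorProduct.add_tmul, ha, hb]
        | tmul a c => rfl
    have e2 : ∀ z : H ⊗[L] H, N.mkQ.rTensor (H ⊗[L] H)
        ((Coalgebra.comul (R := L) (A := H)).lTensor H z) =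
        (Coalgebra.comul (R := L) (A := H)).lTensor (H ⧸ N) (N.mkQ.rTensor H z) := by
      intro z
      induction z with
      | zero => simp
      | add a b ha hb => simp only [map_add, ha, hb]
      | tmul a b => rfl
    change TensorProduct.assoc L (H ⧸ N) H H (c.rTensor H (c (N.mkQ f))) =
      (Coalgebra.comul (R := L) (A := H)).lTensor (H ⧸ N) (c (N.mkQ f))
    rw [hc, e1, Coalgebra.coassoc_apply, e2]
  have hcu : (TensorProduct.rid L (H ⧸ N)).toLinearMap ∘ₗ
      (Coalgebra.counit (R := L) (A := H)).lTensor (H ⧸ N) ∘ₗ c = LinearMap.id := by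
    refine LinearMap.ext fun m => ?_
    obtain ⟨f, rfl⟩ := N.mkQ_surjective m
    change rslice _ (Coalgebra.counit (R := L) (A := H)) (c (N.mkQ f)) = N.mkQ f
    rw [hc, rslice_rTensor, rslice_counit]
  -- A nonzero fixed vector is the class of some `f ∉ N` with `Δ f - f ⊗ 1` in `N ⊗ H`. A tensor
  -- involves finitely many elements of `N`, so all its slices lie in a single `Fₙ`; this forces `f
  -- ∈ Fₙ₊₁ ⊆ N`, a contradiction.
  obtain ⟨m, hm0, hm⟩ := hU.exists_fixed c hco hcu
  obtain ⟨f, rfl⟩ := N.mkQ_surjective m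
  apply hm0
  refine (Submodule.Quotient.mk_eq_zero N).2 ?_
  rw [hc] at hm
  obtain ⟨z, hz⟩ := (rTensor_exact H (LinearMap.exact_subtype_mkQ N) N.mkQ_surjective
    (Coalgebra.comul (R := L) f - f ⊗ₜ 1)).1 (by
      rw [map_sub, hm, LinearMap.rTensor_tmul, sub_self])
  have key : ∀ z : N ⊗[L] H, ∃ n, ∀ φ, rslice H φ (N.subtype.rTensor H z) ∈ coradFil L H n := by
    intro z
    induction z with
    | zero => exact ⟨0, fun φ => by simp⟩
    | tmul a b =>
      obtain ⟨n, hn⟩ := (hN a.1).1 a.2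
      refine ⟨n, fun φ => ?_⟩
      rw [LinearMap.rTensor_tmul, rslice_tmul]
      exact Submodule.smul_mem _ _ hn
    | add a b ha hb =>
      obtain ⟨n, hn⟩ := ha
      obtain ⟨k, hk⟩ := hb
      refine ⟨max n k, fun φ => ?_⟩
      rw [map_add, map_add]
      exact Submodule.add_mem _ (coradFil_mono (le_max_left n k) (hn φ))
        (coradFil_mono (le_max_right n k) (hk φ))
  obtain ⟨n, hn⟩ := key z
  refine (hN f).2 ⟨n + 1, mem_coradFil_succ_of fun χ hχ => ?_⟩
  have := hn χ
  rwa [hz, map_sub, rslice_tmul, hχ, zero_smul, sub_zero] at this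

end Unipotent

/-! ### Primitive elements in Hopf ideals -/

section Primitive

variable {L : Type u} [Field L] {H : Type u} [CommRing H] [HopfAlgebra L H]

/-- A nonzero Hopf ideal of a conilpotent Hopf algebra contains a nonzero primitive element. -/
theorem IsConilpotent.exists_primitive_mem (hH : IsConilpotent L H) (I : Ideal H)
    [I.IsHopfIdeal L] (hI : I ≠ ⊥) :
    ∃ f ∈ I, f ≠ 0 ∧ Coalgebra.comul (R := L) f = f ⊗ₜ 1 + 1 ⊗ₜ f := by
  classical
  -- A nonzero element of `I` of least degree in the filtration will turn out to be primitive.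
  have hex : ∃ n, ∃ f ∈ I, f ≠ 0 ∧ f ∈ coradFil L H n := by
    obtain ⟨f, hf, hf0⟩ := Submodule.exists_mem_ne_zero_of_ne_bot hI
    obtain ⟨n, hn⟩ := hH f
    exact ⟨n, f, hf, hf0, hn⟩
  obtain ⟨f, hfI, hf0, hfn⟩ := Nat.find_spec hex
  have hmin := fun m (hm : m < Nat.find hex) => Nat.find_min hex hm
  have hε : Coalgebra.counit (R := L) f = 0 :=
    Submodule.IsCoideal.counit_eq_zero (I := I.restrictScalars L) hfI
  revert hfn hmin
  rcases Nat.find hex with _ | m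
  · intro hfn _
    refine absurd ?_ hf0
    rw [mem_coradFil_zero hfn, hε, map_zero]
  intro hfn hmin
  have hzero : ∀ g ∈ I, g ∈ coradFil L H m → g = 0 := fun g hg hgm => by
    by_contra hg0
    exact hmin m (Nat.lt_succ_self m) ⟨g, hg, hg0, hgm⟩
  refine ⟨f, hfI, hf0, ?_⟩
  -- Both counit slices of `z` vanish because `ε(f) = 0`. So forms may be corrected to vanish at `1`
  -- without changing the slices of `z`, which therefore lie one step lower in the filtration on
  -- either side.
  set z := Coalgebra.comul (R := L) f - f ⊗ₜ 1 - 1 ⊗ₜ f with hz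
  have hr : ∀ φ : H →ₗ[L] L, rslice H φ z ∈ coradFil L H m := by
    intro φ
    have h0 : rslice H (Coalgebra.counit (R := L)) z = 0 := by
      simp [hz, rslice_counit, hε]
    have h1 : rslice H φ z = rslice H (φ - φ 1 • Coalgebra.counit (R := L)) z := by
      have : ∀ z : H ⊗[L] H, rslice H (φ - φ 1 • Coalgebra.counit (R := L)) z =
          rslice H φ z - φ 1 • rslice H (Coalgebra.counit (R := L)) z := by
        intro z
        induction z with
        | zero => simp
        | tmul a b => simp [sub_smul, mul_smul]
        | add a b ha hb => simp only [map_add, ha, hb, smul_add]; abel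
      rw [this, h0, smul_zero, sub_zero]
    rw [h1, hz, map_sub, map_sub, rslice_tmul, rslice_tmul, sub_counit_form, zero_smul, sub_zero]
    exact Submodule.sub_mem _ (rslice_comul_mem hfn (sub_counit_form φ))
      (Submodule.smul_mem _ _ (one_mem_coradFil m))
  have hl : ∀ φ : H →ₗ[L] L, lslice H φ z ∈ coradFil L H m := by
    intro φ
    have h0 : lslice H (Coalgebra.counit (R := L)) z = 0 := by
      simp [hz, lslice_counit, hε]
    have h1 : lslice H φ z = lslice H (φ - φ 1 • Coalgebra.counit (R := L)) z := by
      have : ∀ z : H ⊗[L] H, lslice H (φ - φ 1 • Coalgebra.counit (R := L)) z =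
          lslice H φ z - φ 1 • lslice H (Coalgebra.counit (R := L)) z := by
        intro z
        induction z with
        | zero => simp
        | tmul a b => simp [sub_smul, mul_smul]
        | add a b ha hb => simp only [map_add, ha, hb, smul_add]; abel
      rw [this, h0, smul_zero, sub_zero]
    rw [h1, hz, map_sub, map_sub, lslice_tmul, lslice_tmul, sub_counit_form, zero_smul, sub_zero]
    exact Submodule.sub_mem _ (lslice_comul_mem hfn (sub_counit_form φ))
      (Submodule.smul_mem _ _ (one_mem_coradFil m))
  obtain ⟨z', hz'⟩ := mem_range_rTensor_of_rslice _ z hr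
  let q : H →ₗ[L] H ⧸ I := (Ideal.Quotient.mkₐ L I).toLinearMap
  have hqz : TensorProduct.map q q z = 0 := by
    have h1 : TensorProduct.map q q (Coalgebra.comul (R := L) f) = 0 :=
      Submodule.IsCoideal.map_mkQ_comul_eq_zero (I := I.restrictScalars L) hfI
    have h2 : q f = 0 := Ideal.Quotient.eq_zero_iff_mem.2 hfI
    rw [hz, map_sub, map_sub, h1, TensorProduct.map_tmul, TensorProduct.map_tmul, h2,
      TensorProduct.zero_tmul, TensorProduct.tmul_zero, sub_zero, sub_zero]
  -- By minimality `I` meets `Fₘ` in zero, so `Fₘ` embeds in `H ⧸ I`. As `z` dies in `(H ⧸ I) ⊗ (H ⧸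
  -- I)`, it already dies in `Fₘ ⊗ (H ⧸ I)`; its left slices then lie in both `I` and `Fₘ`, so they
  -- are zero.
  let i : coradFil L H m →ₗ[L] H ⧸ I := q ∘ₗ (coradFil L H m).subtype
  have hi : Function.Injective i := by
    rw [← LinearMap.ker_eq_bot, LinearMap.ker_eq_bot']
    intro g hg
    exact Subtype.ext (hzero g.1 (Ideal.Quotient.eq_zero_iff_mem.1 hg) g.2)
  have hz'' : q.lTensor _ z' = 0 := by
    have hinj : Function.Injective (i.rTensor (H ⧸ I)) :=
      Module.Flat.rTensor_preserves_injective_linearMap _ hi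
    apply hinj
    rw [map_zero, ← hqz, ← hz']
    generalize z' = w
    induction w with
    | zero => simp
    | tmul a b => rfl
    | add a b ha hb => simp only [map_add, ha, hb]
  have hlI : ∀ φ : H →ₗ[L] L, lslice H φ z ∈ I := by
    intro φ
    have e : lslice H φ z = lslice H (φ ∘ₗ (coradFil L H m).subtype) z' := by
      rw [← hz']
      generalize z' = w
      induction w with
      | zero => simp
      | tmul a b => simp
      | add a b ha hb => simp only [map_add, ha, hb]
    have h1 := lslice_lTensor q (φ ∘ₗ (coradFil L H m).subtype) z'
    rw [hz'', map_zero, ← e] at h1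
    exact Ideal.Quotient.eq_zero_iff_mem.1 h1.symm
  have hz0 : z = 0 := eq_zero_of_lslice z fun φ => hzero _ (hlI φ) (hl φ)
  rw [hz, sub_sub, sub_eq_zero] at hz0
  exact hz0

end Primitive

/-! ### Polynomials determined by their values at natural numbers -/

section PolynomialLemmas

/-- `X` may have zero divisors, so roots cannot be counted there. Linear forms applied to the
coefficients reduce the claim to polynomials over the field `L`, where infinitely many roots force
zero. -/
lemma Polynomial.eq_zero_of_forall_eval_natCast (L : Type u) [Field L] [CharZero L] {X : Type u}
    [CommRing X] [Algebra L X] (Q : Polynomial X)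
    (hQ : ∀ n : ℕ, Q.eval (n : X) = 0) : Q = 0 := by
  ext k
  rw [Polynomial.coeff_zero]
  refine (Module.forall_dual_apply_eq_zero_iff L _).1 fun μ => ?_
  let q : Polynomial L := ∑ i ∈ Q.support, Polynomial.monomial i (μ (Q.coeff i))
  have hq : ∀ i, q.coeff i = μ (Q.coeff i) := by
    intro i
    simp only [q, Polynomial.finsetSum_coeff, Polynomial.coeff_monomial]
    rw [Finset.sum_ite_eq' Q.support i]
    split_ifs with hi
    · rfl
    · rw [Polynomial.notMem_support_iff.1 hi, map_zero]
  have hq0 : q = 0 := by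
    refine Polynomial.eq_zero_of_infinite_isRoot q ?_
    refine (Set.infinite_range_of_injective (Nat.cast_injective (R := L))).mono ?_
    rintro _ ⟨n, rfl⟩
    change q.eval (n : L) = 0
    have h1 := congrArg μ (hQ n)
    rw [Polynomial.eval_eq_sum, Polynomial.sum, map_sum, map_zero] at h1
    rw [Polynomial.eval_finsetSum, ← h1]
    refine Finset.sum_congr rfl fun i _ => ?_
    rw [Polynomial.eval_monomial]
    have : Q.coeff i * (n : X) ^ i = ((n : L) ^ i) • Q.coeff i := by
      rw [Algebra.smul_def, mul_comm, map_pow, map_natCast]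
    rw [this, map_smul, smul_eq_mul, mul_comm]
  rw [← hq, hq0, Polynomial.coeff_zero]

lemma Polynomial.ext_of_forall_eval_natCast (L : Type u) [Field L] [CharZero L] {X : Type u}
    [CommRing X] [Algebra L X] {P Q : Polynomial X}
    (h : ∀ n : ℕ, P.eval (n : X) = Q.eval (n : X)) : P = Q :=
  sub_eq_zero.1 (Polynomial.eq_zero_of_forall_eval_natCast L _ fun n => by
    rw [Polynomial.eval_sub, h, sub_self])

end PolynomialLemmas

/-! ### Powers with a polynomial exponent, and the logarithm -/

section Power

variable {L : Type u} [Field L] {H : Type u} [CommRing H] [HopfAlgebra L H]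

/-- In this form powers of the universal point can be expanded by the binomial theorem in the
convolution algebra. -/
lemma Pt.taut_pow_hom (n : ℕ) (f : H) :
    ((Pt.taut (L := L) H) ^ n).hom f =
      ((WithConv.toConv (LinearMap.id : H →ₗ[L] H)) ^ n).ofConv f := by
  induction n generalizing f with
  | zero => rfl
  | succ n ih =>
    rw [pow_succ, pow_succ, Pt.mul_hom]
    change _ = LinearMap.mul' L H (TensorProduct.map _ _ (Coalgebra.comul f))
    generalize Coalgebra.comul (R := L) f = z
    induction z with
    | zero => simp
    | tmul a b =>
      rw [Pt.pair_tmul, ih]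
      rfl
    | add a b ha hb => simp only [map_add, ha, hb]

section

variable {T : Type u} [CommRing T] {x : L →+* T}

lemma Pt.eval_mul (P Q : Pt H ((Polynomial.C : T →+* Polynomial T).comp x)) (f : H) (t : T)
    (u v : Pt H x) (hP : ∀ f, (P.hom f).eval t = u.hom f) (hQ : ∀ f, (Q.hom f).eval t = v.hom f) :
    ((P * Q).hom f).eval t = (u * v).hom f := by
  rw [Pt.mul_hom, Pt.mul_hom]
  generalize Coalgebra.comul (R := L) f = z
  induction z with
  | zero => simp
  | tmul a b => rw [Pt.pair_tmul, Pt.pair_tmul, Polynomial.eval_mul, hP, hQ]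
  | add a b ha hb => rw [map_add, map_add, Polynomial.eval_add, ha, hb]

lemma Pt.mul_hom_primitive {p : H} (hp : Coalgebra.comul (R := L) p = p ⊗ₜ 1 + 1 ⊗ₜ p)
    (u v : Pt H x) : (u * v).hom p = u.hom p + v.hom p := by
  rw [Pt.mul_hom, hp, _root_.map_add, Pt.pair_tmul, Pt.pair_tmul, _root_.map_one,
    _root_.map_one, mul_one, one_mul]

lemma Pt.pow_hom_primitive {p : H} (hp : Coalgebra.comul (R := L) p = p ⊗ₜ 1 + 1 ⊗ₜ p)
    (u : Pt H x) (n : ℕ) : (u ^ n).hom p = n * u.hom p := by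
  induction n with
  | zero =>
    have := Pt.mul_hom_primitive hp (1 : Pt H x) 1
    rw [one_mul] at this
    rw [pow_zero, Nat.cast_zero, zero_mul]
    exact left_eq_add.1 this
  | succ n ih => rw [pow_succ, Pt.mul_hom_primitive hp, ih]; push_cast; ring

end

variable [CharZero L]

/-- With `J = id - 1` in the convolution algebra, `idⁿ = ∑ C(n, k) Jᵏ`. On `f` the sum stops at a
bound independent of `n`, and in characteristic zero `C(n, k)` is a polynomial in `n`. -/
lemma IsConilpotent.exists_powPoly (h : IsConilpotent L H) (f : H) :
    ∃ Q : Polynomial H, ∀ n : ℕ, Q.eval (n : H) = ((Pt.taut (L := L) H) ^ n).hom f := by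
  obtain ⟨N, hN⟩ := h.exists_forall_pow f
  let J : WithConv (H →ₗ[L] H) := WithConv.toConv LinearMap.id - 1
  have hJ : J.ofConv 1 = 0 := by
    change (1 : H) - algebraMap L H (Coalgebra.counit (R := L) (1 : H)) = 0
    rw [Bialgebra.counit_one, map_one, sub_self]
  refine ⟨∑ k ∈ Finset.range N, Polynomial.C ((k.factorial : L)⁻¹ • (J ^ k).ofConv f) *
    descPochhammer H k, fun n => ?_⟩
  have h1 : (WithConv.toConv (LinearMap.id : H →ₗ[L] H)) ^ n =
      ∑ k ∈ Finset.range (n + 1), (n.choose k : L) • J ^ k := by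
    have : (WithConv.toConv (LinearMap.id : H →ₗ[L] H)) = J + 1 := by simp [J]
    rw [this, (Commute.one_right J).add_pow]
    refine Finset.sum_congr rfl fun k _ => ?_
    rw [one_pow, mul_one, Algebra.smul_def, map_natCast]
    exact (Nat.cast_commute _ _).eq.symm
  rw [Pt.taut_pow_hom, h1, WithConv.ofConv_sum, LinearMap.sum_apply, Polynomial.eval_finsetSum]
  have h2 : ∀ k, Polynomial.eval (n : H) (Polynomial.C ((k.factorial : L)⁻¹ • (J ^ k).ofConv f) *
      descPochhammer H k) = ((n.choose k : L) • J ^ k).ofConv f := by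
    intro k
    rw [Polynomial.eval_mul, Polynomial.eval_C, descPochhammer_eval_eq_descFactorial,
      Nat.descFactorial_eq_factorial_mul_choose, WithConv.ofConv_smul, LinearMap.smul_apply]
    have h3 : ((k.factorial * n.choose k : ℕ) : H) =
        algebraMap L H ((k.factorial : L) * (n.choose k : L)) := by simp
    rw [h3, mul_comm, ← Algebra.smul_def, smul_smul]
    congr 1
    have : (k.factorial : L) ≠ 0 := Nat.cast_ne_zero.2 k.factorial_ne_zero
    field_simp
  simp only [h2]
  have h4 : ∀ k, N ≤ k → ((n.choose k : L) • J ^ k).ofConv f = 0 := fun k hk => by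
    rw [WithConv.ofConv_smul, LinearMap.smul_apply, hN k hk J hJ, smul_zero]
  have h5 : ∀ k, n + 1 ≤ k → ((n.choose k : L) • J ^ k).ofConv f = 0 := fun k hk => by
    rw [Nat.choose_eq_zero_of_lt hk, Nat.cast_zero, zero_smul]
    rfl
  -- Both ranges of summation give the same sum: terms with `k ≥ N` vanish by local nilpotence,
  -- terms with `k > n` because the binomial coefficient is zero.
  rcases le_total N (n + 1) with hle | hle
  · exact Finset.sum_subset (Finset.range_mono hle) fun k _ hk =>
      h4 k (by simpa using hk)
  · exact (Finset.sum_subset (Finset.range_mono hle) fun k _ hk =>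
      h5 k (by simpa using hk)).symm

variable (h : IsConilpotent L H)

/-- The homomorphism `H ⟶ H[t]` describing the powers `uᵗ` of points `u` of a unipotent group. -/
noncomputable def IsConilpotent.powAlg : H →ₐ[L] Polynomial H :=
  -- For each `n` the map `f ↦ f(uⁿ)` is an algebra homomorphism; since values at naturals determine
  -- a polynomial, the interpolating map is one too.
  have ev := fun f => (h.exists_powPoly f).choose_spec
  { toFun := fun f => (h.exists_powPoly f).choose
    map_one' := Polynomial.ext_of_forall_eval_natCast L fun n => by
      rw [ev, map_one, Polynomial.eval_one]
    map_mul' := fun f g => Polynomial.ext_of_forall_eval_natCast L fun n => by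
      rw [Polynomial.eval_mul, ev, ev, ev, map_mul]
    map_zero' := Polynomial.ext_of_forall_eval_natCast L fun n => by
      rw [ev, map_zero, Polynomial.eval_zero]
    map_add' := fun f g => Polynomial.ext_of_forall_eval_natCast L fun n => by
      rw [Polynomial.eval_add, ev, ev, ev, map_add]
    commutes' := fun l => Polynomial.ext_of_forall_eval_natCast L fun n => by
      rw [ev, Pt.base, Polynomial.algebraMap_apply, Polynomial.eval_C] }

lemma IsConilpotent.eval_powAlg (f : H) (n : ℕ) :
    (h.powAlg f).eval (n : H) = ((Pt.taut (L := L) H) ^ n).hom f :=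
  (h.exists_powPoly f).choose_spec n

variable {T : Type u} [CommRing T] {x : L →+* T}

/-- The power `uᵗ` of a point of a unipotent group, as a point over `T[t]`. -/
noncomputable def IsConilpotent.tpow (u : Pt H x) :
    Pt H ((Polynomial.C : T →+* Polynomial T).comp x) :=
  ⟨(Polynomial.mapRingHom u.hom).comp h.powAlg.toRingHom, fun l => by
    change Polynomial.map u.hom (h.powAlg (algebraMap L H l)) = _
    rw [AlgHom.commutes, Polynomial.algebraMap_apply, Polynomial.map_C]
    exact congrArg Polynomial.C (u.base l)⟩

lemma IsConilpotent.tpow_hom (u : Pt H x) (f : H) :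
    (h.tpow u).hom f = (h.powAlg f).map u.hom := rfl

lemma IsConilpotent.eval_tpow (u : Pt H x) (f : H) (n : ℕ) :
    ((h.tpow u).hom f).eval (n : T) = (u ^ n).hom f := by
  have hu : Pt.mapTo u.hom u.base (Pt.taut H) = u := Pt.ext' fun f => Pt.mapTo_hom _ _ _ _
  rw [h.tpow_hom, ← map_natCast u.hom n, Polynomial.eval_map, Polynomial.eval₂_hom,
    h.eval_powAlg]
  conv_rhs => rw [← hu, ← map_pow, Pt.mapTo_hom]

lemma Pt.eq_of_eval {P Q : Pt H ((Polynomial.C : T →+* Polynomial T).comp x)}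
    (hPQ : ∀ (f : H) (n : ℕ), (P.hom f).eval (n : T) = (Q.hom f).eval (n : T)) : P = Q := by
  let _ := x.toAlgebra
  exact Pt.ext' fun f => Polynomial.ext_of_forall_eval_natCast L (hPQ f)

/-- True for natural exponents, hence identically in `t`. -/
lemma IsConilpotent.tpow_mul (u v : Pt H x) (huv : Commute u v) :
    h.tpow (u * v) = h.tpow u * h.tpow v :=
  Pt.eq_of_eval fun f n => by
    rw [h.eval_tpow, huv.mul_pow]
    exact (Pt.eval_mul _ _ f (n : T) _ _ (fun f => h.eval_tpow u f n)
      fun f => h.eval_tpow v f n).symm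

lemma IsConilpotent.coeff_zero_powAlg (f : H) :
    (h.powAlg f).coeff 0 = algebraMap L H (Coalgebra.counit (R := L) f) := by
  rw [Polynomial.coeff_zero_eq_eval_zero]
  have := h.eval_powAlg f 0
  rw [Nat.cast_zero, pow_zero] at this
  rw [this]
  rfl

/-- The first Eulerian idempotent, i.e. the logarithm of the identity for convolution. -/
noncomputable def IsConilpotent.logEnd : H →ₗ[L] H where
  toFun f := (h.powAlg f).coeff 1
  map_add' f g := by rw [map_add, Polynomial.coeff_add]
  map_smul' l f := by rw [map_smul, Polynomial.coeff_smul, RingHom.id_apply]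

/-- The coefficient of `t` in a product obeys the Leibniz rule, and the constant term of `f(uᵗ)` is
the counit of `f`. -/
lemma IsConilpotent.logEnd_mul (f g : H) : h.logEnd (f * g) =
    Coalgebra.counit (R := L) f • h.logEnd g + Coalgebra.counit (R := L) g • h.logEnd f := by
  change (h.powAlg (f * g)).coeff 1 = _ • (h.powAlg g).coeff 1 + _ • (h.powAlg f).coeff 1
  rw [map_mul, Polynomial.mul_coeff_one, h.coeff_zero_powAlg, h.coeff_zero_powAlg,
    Algebra.smul_def, Algebra.smul_def]
  ring

/-- An additive function satisfies `p(uⁿ) = n p(u)`, so `p(uᵗ) = t p(u)`. -/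
lemma IsConilpotent.logEnd_primitive {p : H}
    (hp : Coalgebra.comul (R := L) p = p ⊗ₜ 1 + 1 ⊗ₜ p) : h.logEnd p = p := by
  have : h.powAlg p = Polynomial.X * Polynomial.C p :=
    Polynomial.ext_of_forall_eval_natCast L fun n => by
      rw [h.eval_powAlg, Pt.pow_hom_primitive hp, Polynomial.eval_mul, Polynomial.eval_X,
        Polynomial.eval_C]
      rfl
  change (h.powAlg p).coeff 1 = p
  rw [this, Polynomial.coeff_X_mul, Polynomial.coeff_C_zero]

/-- In a commutative unipotent group the logarithm takes values in the additive functions. -/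
lemma IsConilpotent.comul_logEnd
    (hc : ∀ {T : Type u} [CommRing T] {x : L →+* T} (u v : Pt H x), u * v = v * u) (f : H) :
    Coalgebra.comul (R := L) (h.logEnd f) = h.logEnd f ⊗ₜ 1 + 1 ⊗ₜ h.logEnd f := by
  let u : Pt H (algebraMap L (H ⊗[L] H)) := Pt.ofAlgHom Algebra.TensorProduct.includeLeft
  let v : Pt H (algebraMap L (H ⊗[L] H)) := Pt.ofAlgHom Algebra.TensorProduct.includeRight
  have huv : ∀ g, (u * v).hom g = Coalgebra.comul (R := L) g := fun g => by
    rw [Pt.mul_hom, coinvariants.pair_includes]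
    rfl
  -- For the universal pair `u, v` of points, compare the coefficients of `t` in `(u v)ᵗ = uᵗ vᵗ`.
  have h1 := congrArg (fun w => (w.hom f).coeff 1) (h.tpow_mul u v (hc u v))
  have h2 : ∀ z : H ⊗[L] H, ((Pt.pair (h.tpow u) (h.tpow v)).hom z).coeff 1 =
      u.hom (h.logEnd (rslice H (Coalgebra.counit (R := L)) z)) +
        v.hom (h.logEnd (lslice H (Coalgebra.counit (R := L)) z)) := by
    intro z
    induction z with
    | zero => simp
    | add a b ha hb => rw [map_add, Polynomial.coeff_add, ha, hb]; simp only [map_add]; ring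
    | tmul a b =>
      rw [Pt.pair_tmul, Polynomial.mul_coeff_one, h.tpow_hom, h.tpow_hom, Polynomial.coeff_map,
        Polynomial.coeff_map, Polynomial.coeff_map, Polynomial.coeff_map, h.coeff_zero_powAlg,
        h.coeff_zero_powAlg, rslice_tmul, lslice_tmul, h.logEnd.map_smul, h.logEnd.map_smul,
        Algebra.smul_def, Algebra.smul_def, u.hom.map_mul, v.hom.map_mul, u.base, v.base, u.base,
        v.base, add_comm]
      congr 1
      exact mul_comm _ _
  change ((h.tpow (u * v)).hom f).coeff 1 = ((h.tpow u * h.tpow v).hom f).coeff 1 at h1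
  rw [Pt.mul_hom, h2, rslice_counit, lslice_counit, h.tpow_hom, Polynomial.coeff_map] at h1
  rw [← huv]
  exact h1

/-- The curve `t ↦ uᵗ` is a one-parameter subgroup whose velocity at the identity is the logarithm
of `u`. If this is zero, every `f(uᵗ)` is constant in `t`, and `t = 1` may be compared with `t = 0`.
-/
lemma IsConilpotent.eq_one_of_logEnd (u : Pt H x) (hu : ∀ f, u.hom (h.logEnd f) = 0) : u = 1 := by
  let _ := x.toAlgebra
  refine Pt.ext' fun f => ?_
  set Q := (h.tpow u).hom f with hQ
  have hder : Q.derivative = 0 := by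
    refine Polynomial.eq_zero_of_forall_eval_natCast L _ fun m => ?_
    rw [← Polynomial.taylor_coeff_one]
    -- The Taylor expansion at `m` reflects `uᵐ⁺ᵗ = uᵐ uᵗ`; its linear coefficient involves `uᵗ`
    -- only through the logarithm.
    have hshift : Polynomial.taylor (m : T) Q =
        ((u ^ m).map Polynomial.C * h.tpow u).hom f := by
      refine Polynomial.ext_of_forall_eval_natCast L fun n => ?_
      rw [Polynomial.taylor_eval, ← Nat.cast_add, hQ, h.eval_tpow, add_comm, pow_add]
      refine (Pt.eval_mul _ _ f (n : T) _ _ (fun f => ?_) fun f => h.eval_tpow u f n).symm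
      rw [Pt.map_hom, Polynomial.eval_C]
    rw [hshift, Pt.mul_hom]
    generalize Coalgebra.comul (R := L) f = z
    induction z with
    | zero => simp
    | add a b ha hb => rw [map_add, Polynomial.coeff_add, ha, hb, add_zero]
    | tmul a b =>
      rw [Pt.pair_tmul, Pt.map_hom, Polynomial.coeff_C_mul, h.tpow_hom, Polynomial.coeff_map]
      exact (congrArg _ (hu b)).trans (mul_zero _)
  have hconst : Q = Polynomial.C (Q.coeff 0) := by
    ext k
    rcases k with _ | k
    · rw [Polynomial.coeff_C_zero]
    · rw [Polynomial.coeff_C_succ]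
      have := congrArg (fun q => Polynomial.coeff q k) hder
      simp only [Polynomial.coeff_derivative, Polynomial.coeff_zero] at this
      have hk : IsUnit ((k : T) + 1) := by
        have : ((k : T) + 1) = algebraMap L T ((k : L) + 1) := by simp
        rw [this]
        exact (Ne.isUnit (Nat.cast_add_one_ne_zero k)).map _
      exact (hk.mul_left_eq_zero).1 this
  have h1 := h.eval_tpow u f 1
  have h0 := h.eval_tpow u f 0
  rw [pow_one, ← hQ, hconst, Polynomial.eval_C] at h1
  rw [pow_zero, ← hQ, hconst, Polynomial.eval_C] at h0
  rw [← h1, ← h0]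

end Power

/-! ### Exponentials of derivations at the counit -/

section Exponential

variable {L : Type u} [Field L] {H : Type u} [CommRing H] [HopfAlgebra L H]
  {X : Type u} [CommRing X] [Algebra L X]

/-- A linear map that is a derivation at the counit. -/
def IsCounitDerivation (Θ : H →ₗ[L] X) : Prop :=
  ∀ f g : H, Θ (f * g) = Coalgebra.counit (R := L) f • Θ g + Coalgebra.counit (R := L) g • Θ f

variable {Θ : H →ₗ[L] X}

lemma IsCounitDerivation.map_one (hΘ : IsCounitDerivation Θ) : Θ 1 = 0 := by
  have := hΘ 1 1
  rw [mul_one, Bialgebra.counit_one, one_smul] at this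
  exact left_eq_add.1 this

lemma conv_mul_eval (φ ψ : WithConv (H →ₗ[L] X)) (f : H) : (φ * ψ).ofConv f =
    LinearMap.mul' L X (TensorProduct.map φ.ofConv ψ.ofConv (Coalgebra.comul (R := L) f)) := rfl

/-- The Leibniz rule for convolution powers of a derivation at the counit. -/
lemma IsCounitDerivation.pow_mul (hΘ : IsCounitDerivation Θ) (k : ℕ) (f g : H) :
    ((WithConv.toConv Θ) ^ k).ofConv (f * g) = ∑ ij ∈ Finset.HasAntidiagonal.antidiagonal k,
      k.choose ij.1 • (((WithConv.toConv Θ) ^ ij.1).ofConv f *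
        ((WithConv.toConv Θ) ^ ij.2).ofConv g) := by
  set D := WithConv.toConv Θ with hD
  induction k generalizing f g with
  | zero =>
    have h1 : ∀ f, (1 : WithConv (H →ₗ[L] X)).ofConv f =
        algebraMap L X (Coalgebra.counit (R := L) f) := fun f => rfl
    simp [h1]
  | succ k ih =>
    -- Stated for arbitrary tensors in place of the two coproducts, since the formula is bilinear.
    -- On pure tensors it is the induction hypothesis together with the derivation rule for the last
    -- factor; Pascal's rule then collects the two sums.
    have key : ∀ z w : H ⊗[L] H,
        LinearMap.mul' L X (TensorProduct.map (D ^ k).ofConv D.ofConv (z * w)) =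
        ∑ ij ∈ Finset.HasAntidiagonal.antidiagonal k, k.choose ij.1 •
          ((D ^ ij.1).ofConv (rslice H (Coalgebra.counit (R := L)) z) *
            LinearMap.mul' L X (TensorProduct.map (D ^ ij.2).ofConv D.ofConv w)) +
        ∑ ij ∈ Finset.HasAntidiagonal.antidiagonal k, k.choose ij.2 •
          (LinearMap.mul' L X (TensorProduct.map (D ^ ij.1).ofConv D.ofConv z) *
            (D ^ ij.2).ofConv (rslice H (Coalgebra.counit (R := L)) w)) := by
      intro z w
      induction z with
      | zero => simp
      | add a b ha hb =>
        rw [add_mul, map_add, map_add, ha, hb]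
        simp only [map_add, add_mul, smul_add, Finset.sum_add_distrib]
        abel
      | tmul a b =>
        induction w with
        | zero => simp
        | add c d hc hd =>
          rw [mul_add, map_add, map_add, hc, hd]
          simp only [map_add, mul_add, smul_add, Finset.sum_add_distrib]
          abel
        | tmul c d =>
          rw [Algebra.TensorProduct.tmul_mul_tmul, TensorProduct.map_tmul, LinearMap.mul'_apply,
            ih, Finset.sum_mul, ← Finset.sum_add_distrib]
          refine Finset.sum_congr rfl fun ij hij => ?_
          have hch : k.choose ij.2 = k.choose ij.1 := by
            rw [← Finset.HasAntidiagonal.mem_antidiagonal.1 hij, Nat.choose_symm_add]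
          rw [hch, TensorProduct.map_tmul, TensorProduct.map_tmul, LinearMap.mul'_apply,
            LinearMap.mul'_apply, rslice_tmul, rslice_tmul, map_smul, map_smul, ← smul_add,
            smul_mul_assoc]
          congr 1
          change _ * Θ (b * d) = _ • _ * (_ * Θ d) + _ * Θ b * (_ • _)
          rw [hΘ, Algebra.smul_def, Algebra.smul_def, Algebra.smul_def, Algebra.smul_def]
          ring
    rw [pow_succ, conv_mul_eval, Bialgebra.comul_mul, key, rslice_counit, rslice_counit]
    simp only [← conv_mul_eval, ← pow_succ]
    rw [Finset.sum_antidiagonal_choose_succ_nsmul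
      (fun i j => (D ^ i).ofConv f * (D ^ j).ofConv g)]

variable (h : IsConilpotent L H)

include h in
lemma IsConilpotent.exists_expPoly (hΘ : Θ 1 = 0) (f : H) : ∃ Q : Polynomial X, ∀ k,
    Q.coeff k = (k.factorial : L)⁻¹ • ((WithConv.toConv Θ) ^ k).ofConv f := by
  obtain ⟨N, hN⟩ := h.exists_forall_pow f
  refine ⟨∑ k ∈ Finset.range N, Polynomial.monomial k
    ((k.factorial : L)⁻¹ • ((WithConv.toConv Θ) ^ k).ofConv f), fun k => ?_⟩
  simp only [Polynomial.finsetSum_coeff, Polynomial.coeff_monomial]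
  rw [Finset.sum_ite_eq' (Finset.range N) k]
  split_ifs with hk
  · rfl
  · rw [hN k (by simpa using hk) _ hΘ, smul_zero]

variable [CharZero L]

/-- The homomorphism `f ↦ ∑ Θᵏ(f) tᵏ / k!` defined by a derivation `Θ` at the counit. -/
noncomputable def IsConilpotent.expAlg (hΘ : IsCounitDerivation Θ) : H →ₐ[L] Polynomial X :=
  have co := fun f => (h.exists_expPoly hΘ.map_one f).choose_spec
  AlgHom.ofLinearMap
    { toFun := fun f => (h.exists_expPoly hΘ.map_one f).choose
      map_add' := fun f g => Polynomial.ext fun k => by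
        rw [Polynomial.coeff_add, co, co, co, map_add, smul_add]
      map_smul' := fun l f => Polynomial.ext fun k => by
        rw [Polynomial.coeff_smul, co, co, map_smul, smul_comm, RingHom.id_apply] }
    (Polynomial.ext fun k => by
      refine (co 1 k).trans ?_
      rcases k with _ | k
      · rw [Nat.factorial_zero, Nat.cast_one, inv_one, one_smul, Polynomial.coeff_one_zero,
          pow_zero]
        change algebraMap L X (Coalgebra.counit (R := L) (1 : H)) = 1
        rw [Bialgebra.counit_one, _root_.map_one]
      · rw [pow_succ, conv_mul_eval, Bialgebra.comul_one, Algebra.TensorProduct.one_def,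
          TensorProduct.map_tmul, LinearMap.mul'_apply]
        change _ • (_ * Θ 1) = _
        rw [hΘ.map_one, mul_zero, smul_zero, Polynomial.coeff_one, if_neg k.succ_ne_zero])
    -- Multiplicativity of the exponential is the Leibniz rule divided by `k!`.
    (fun f g => Polynomial.ext fun k => by
      rw [Polynomial.coeff_mul]
      refine (co (f * g) k).trans ?_
      rw [hΘ.pow_mul, Finset.smul_sum]
      refine Finset.sum_congr rfl fun ij hij => ?_
      refine Eq.trans ?_ (congrArg₂ (· * ·) (co f _) (co g _)).symm
      rw [smul_mul_smul_comm, ← Nat.cast_smul_eq_nsmul L, smul_smul]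
      congr 1
      rw [← Finset.HasAntidiagonal.mem_antidiagonal.1 hij, Nat.choose_symm_add, Nat.add_choose,
        Nat.cast_div (Nat.factorial_mul_factorial_dvd_factorial_add _ _)
          (by exact_mod_cast mul_ne_zero (Nat.factorial_ne_zero _) (Nat.factorial_ne_zero _))]
      have h1 : ((ij.1 + ij.2).factorial : L) ≠ 0 := Nat.cast_ne_zero.2 (Nat.factorial_ne_zero _)
      have h2 : (ij.1.factorial : L) ≠ 0 := Nat.cast_ne_zero.2 (Nat.factorial_ne_zero _)
      have h3 : (ij.2.factorial : L) ≠ 0 := Nat.cast_ne_zero.2 (Nat.factorial_ne_zero _)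
      push_cast
      field_simp)

lemma IsConilpotent.coeff_expAlg (hΘ : IsCounitDerivation Θ) (f : H) (k : ℕ) :
    (h.expAlg hΘ f).coeff k = (k.factorial : L)⁻¹ • ((WithConv.toConv Θ) ^ k).ofConv f :=
  (h.exists_expPoly hΘ.map_one f).choose_spec k

/-- Only the linear term survives: `ε(p) = 0` removes the constant term, and `Θ(1) = 0` kills the
convolution powers of order at least two on a primitive element. -/
lemma IsConilpotent.expAlg_primitive (hΘ : IsCounitDerivation Θ) {p : H}
    (hp : Coalgebra.comul (R := L) p = p ⊗ₜ 1 + 1 ⊗ₜ p) :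
    h.expAlg hΘ p = Polynomial.X * Polynomial.C (Θ p) := by
  have hε : Coalgebra.counit (R := L) p = 0 := by
    have := rslice_counit (L := L) p
    rw [hp, map_add, rslice_tmul, rslice_tmul, Bialgebra.counit_one, one_smul] at this
    have := congrArg (Coalgebra.counit (R := L)) (add_eq_left.1 this)
    simpa using this
  ext k
  rw [h.coeff_expAlg]
  rcases k with _ | _ | k
  · rw [pow_zero, Polynomial.coeff_X_mul_zero]
    change _ • algebraMap L X (Coalgebra.counit (R := L) p) = 0
    rw [hε, map_zero, smul_zero]
  · rw [zero_add, pow_one, Polynomial.coeff_X_mul, Polynomial.coeff_C_zero, Nat.factorial_one,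
      Nat.cast_one, inv_one, one_smul]
  · rw [Polynomial.coeff_X_mul, Polynomial.coeff_C_succ, pow_succ, conv_mul_eval, hp, map_add,
      map_add, TensorProduct.map_tmul, TensorProduct.map_tmul, LinearMap.mul'_apply,
      LinearMap.mul'_apply]
    have h1 : ((WithConv.toConv Θ) ^ (k + 1)).ofConv 1 = 0 := by
      rw [pow_succ, conv_mul_eval, Bialgebra.comul_one, Algebra.TensorProduct.one_def,
        TensorProduct.map_tmul, LinearMap.mul'_apply]
      exact (congrArg _ hΘ.map_one).trans (mul_zero _)
    rw [h1, zero_mul, add_zero]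
    change _ • (_ * Θ 1) = _
    rw [hΘ.map_one, mul_zero, smul_zero]

include h in
/-- A nonzero additive function on a unipotent group has a section. -/
lemma IsConilpotent.exists_section {p : H} (hp0 : p ≠ 0)
    (hp : Coalgebra.comul (R := L) p = p ⊗ₜ 1 + 1 ⊗ₜ p) :
    ∃ s : H →ₐ[L] Polynomial L, s p = Polynomial.X := by
  obtain ⟨μ, hμ⟩ : ∃ μ : H →ₗ[L] L, μ p ≠ 0 := by
    by_contra! hcon
    exact hp0 ((Module.forall_dual_apply_eq_zero_iff L _).1 hcon)
  -- Since `logEnd` fixes `p`, this derivation has value `1` on `p`, so its exponential sends `p` to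
  -- the variable. It is a one-parameter subgroup on which `p` is the parameter.
  have hΘ : IsCounitDerivation ((μ p)⁻¹ • μ ∘ₗ h.logEnd) := fun f g => by
    simp only [LinearMap.smul_apply, LinearMap.comp_apply, h.logEnd_mul, map_add, map_smul,
      smul_eq_mul]
    ring
  refine ⟨h.expAlg hΘ, ?_⟩
  rw [h.expAlg_primitive hΘ hp]
  simp only [LinearMap.smul_apply, LinearMap.comp_apply, h.logEnd_primitive hp, smul_eq_mul]
  rw [inv_mul_cancel₀ hμ, map_one, mul_one]

variable {T : Type u} [CommRing T] {x : L →+* T}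

/-- Every semilinear map on the space of additive functions is the restriction of a point. -/
lemma IsConilpotent.exists_point {P : Submodule L H}
    (hP : ∀ f, h.logEnd f ∈ P) (hP' : ∀ p ∈ P, Coalgebra.comul (R := L) p = p ⊗ₜ 1 + 1 ⊗ₜ p)
    (θ : P →ₛₗ[x] T) : ∃ u : Pt H x, ∀ p : P, u.hom p = θ p := by
  let _ := x.toAlgebra
  let θ' : P →ₗ[L] T :=
    { toFun := θ, map_add' := map_add θ, map_smul' := fun l p => map_smulₛₗ θ l p }
  let Θ : H →ₗ[L] T := θ' ∘ₗ h.logEnd.codRestrict P hP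
  have hΘ : IsCounitDerivation Θ := fun f g => by
    have : h.logEnd.codRestrict P hP (f * g) =
        Coalgebra.counit (R := L) f • h.logEnd.codRestrict P hP g +
          Coalgebra.counit (R := L) g • h.logEnd.codRestrict P hP f :=
      Subtype.ext (h.logEnd_mul f g)
    change θ' _ = _ • θ' _ + _ • θ' _
    rw [this, map_add, map_smul, map_smul]
  -- The exponential of `θ ∘ log` at time `1`; on a primitive element `p` its value is `θ(log p) =
  -- θ(p)`.
  let w : H →ₐ[L] T := ((Polynomial.aeval (1 : T)).restrictScalars L).comp (h.expAlg hΘ)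
  refine ⟨⟨w.toRingHom, w.commutes⟩, fun p => ?_⟩
  change Polynomial.aeval (1 : T) (h.expAlg hΘ p) = _
  rw [h.expAlg_primitive hΘ (hP' p p.2)]
  have : Θ p = θ p := congrArg θ (Subtype.ext (h.logEnd_primitive (hP' p p.2)))
  simp [this]

end Exponential

/-! ### Equivariant retractions onto closed subgroups, and lifting of points -/

section Retraction

variable {L : Type u} [Field L] {H : Type u} [CommRing H] [HopfAlgebra L H]

/-- A morphism from a group scheme to a closed subgroup, equivariant for right translations
by the subgroup; it is given by an endomorphism of the coordinate ring. -/
def HasEquivariantRetraction (L : Type u) [Field L] {H : Type u} [CommRing H] [HopfAlgebra L H]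
    (J : Ideal H) : Prop :=
  ∃ ρ : H →ₐ[L] H, (∀ {T : Type u} [CommRing T] {x : L →+* T} (u : Pt H x), (u.res ρ).Mem J) ∧
    ∀ {T : Type u} [CommRing T] {x : L →+* T} (u m : Pt H x), m.Mem J →
      (u * m).res ρ = u.res ρ * m

lemma hasEquivariantRetraction_bot : HasEquivariantRetraction L (⊥ : Ideal H) :=
  ⟨AlgHom.id L H, fun _ => mem_bot _, fun _ _ _ => rfl⟩

lemma Pt.mapTo_taut {B : Type u} [CommRing B] [HopfAlgebra L B] {T : Type u} [CommRing T]
    {x : L →+* T} (u : Pt B x) : Pt.mapTo u.hom u.base (Pt.taut B) = u :=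
  Pt.ext' fun _ => Pt.mapTo_hom _ _ _ _

/-- The morphism given by a point with values in the coordinate ring. -/
def Pt.toAlgHom {B C : Type u} [CommRing B] [Algebra L B] [CommRing C] [Algebra L C]
    (r : Pt B (algebraMap L C)) : B →ₐ[L] C := { r.hom with commutes' := r.base }

lemma Pt.res_toAlgHom {B : Type u} [CommRing B] [Algebra L B] {T : Type u} [CommRing T]
    {x : L →+* T} (r : Pt H (algebraMap L B)) (u : Pt B x) :
    u.res r.toAlgHom = Pt.mapTo u.hom u.base r :=
  Pt.ext' fun _ => (Pt.mapTo_hom _ _ _ _).symm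

/-- Here `p` is additive only modulo `J`, that is, on the subgroup defined by `J`. -/
lemma Pt.mul_hom_of_mem {J : Ideal H} [J.IsHopfIdeal L] {p : H}
    (hp : Coalgebra.comul (R := L) (Ideal.Quotient.mk J p) =
      Ideal.Quotient.mk J p ⊗ₜ 1 + 1 ⊗ₜ Ideal.Quotient.mk J p)
    {T : Type u} [CommRing T] {x : L →+* T} {u v : Pt H x} (hu : u.Mem J) (hv : v.Mem J) :
    (u * v).hom p = u.hom p + v.hom p := by
  have h1 : Pt.ofQuot (u.desc hu * v.desc hv) = u * v := Pt.ofQuot_mul J _ _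
  rw [← h1]
  exact Pt.mul_hom_primitive hp (u.desc hu) (v.desc hv)

variable [CharZero L]

/-- Modulo `J` the ideal `I` contains a nonzero primitive element `p`, an additive function on the
subgroup of `J`. Its kernel is a smaller subgroup, and a section of `p` allows the retraction to be
corrected so that it lands there. -/
lemma exists_larger_retraction (hH : IsConilpotent L H) {I J : Ideal H} [hI : I.IsHopfIdeal L]
    [hJ : J.IsHopfIdeal L] (hJI : J < I) (hret : HasEquivariantRetraction L J) :
    ∃ J' : Ideal H, J < J' ∧ J' ≤ I ∧ J'.IsHopfIdeal L ∧ HasEquivariantRetraction L J' := by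
  have hQ : IsConilpotent L (H ⧸ J) := hH.of_surjective
    (Bialgebra.Quotient.mkBialgHom (R := L) J) Ideal.Quotient.mk_surjective
  have hne : I.map (Ideal.Quotient.mk J) ≠ ⊥ := by
    intro h
    have := Ideal.map_eq_bot_iff_le_ker (Ideal.Quotient.mk J) |>.1 h
    rw [Ideal.mk_ker] at this
    exact absurd (hJI.trans_le this) (lt_irrefl _)
  obtain ⟨p', hp'I, hp'0, hp'⟩ := hQ.exists_primitive_mem _ hne
  obtain ⟨p, hpI, rfl⟩ := (Ideal.mem_map_iff_of_surjective _ Ideal.Quotient.mk_surjective).1 hp'I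
  obtain ⟨s, hs⟩ := hQ.exists_section hp'0 hp'
  have hpJ : p ∉ J := fun h => hp'0 (Ideal.Quotient.eq_zero_iff_mem.2 h)
  let J' : Ideal H := J ⊔ Ideal.span {p}
  have hmem : ∀ {T : Type u} [CommRing T] {x : L →+* T} (u : Pt H x),
      u.Mem J' ↔ u.Mem J ∧ u.hom p = 0 := by
    intro T _ x u
    have : ∀ I : Ideal H, u.Mem I ↔ I ≤ RingHom.ker u.hom := fun I => Iff.rfl
    rw [this, this, sup_le_iff, Ideal.span_singleton_le_iff_mem]
    rfl
  have hone : ∀ {T : Type u} [CommRing T] (x : L →+* T), (1 : Pt H x).hom p = 0 := by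
    intro T _ x
    have := Pt.mul_hom_of_mem hp' (Pt.mem_one (x := x)) Pt.mem_one
    rw [mul_one] at this
    exact left_eq_add.1 this
  have hinv : ∀ {T : Type u} [CommRing T] {x : L →+* T} {u : Pt H x}, u.Mem J →
      (u⁻¹).hom p = - u.hom p := by
    intro T _ x u hu
    have := Pt.mul_hom_of_mem hp' hu.inv hu
    rw [inv_mul_cancel, hone] at this
    exact eq_neg_of_add_eq_zero_left this.symm
  refine ⟨J', lt_of_le_of_ne le_sup_left fun e => hpJ ?_, sup_le hJI.le ?_, ?_, ?_⟩
  · rw [e]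
    exact Ideal.mem_sup_right (Ideal.mem_span_singleton_self p)
  · exact (Ideal.span_singleton_le_iff_mem I).2 hpI
  · refine isHopfIdeal_of_points _ (fun x => ?_) (fun u v hu hv => ?_) (fun u hu => ?_)
    · exact (hmem _).2 ⟨Pt.mem_one, hone x⟩
    · rw [hmem] at *
      exact ⟨hu.1.mul hv.1, by rw [Pt.mul_hom_of_mem hp' hu.1 hv.1, hu.2, hv.2, add_zero]⟩
    · rw [hmem] at *
      exact ⟨hu.1.inv, by rw [hinv hu.1, hu.2, neg_zero]⟩
  · obtain ⟨ρ, hρ, hρm⟩ := hret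
    -- The section of `p`: a family of points `σ(c)` of the subgroup of `J` with `p(σ(c)) = c`.
    let σ : ∀ {T : Type u} [CommRing T] (x : L →+* T) (c : T), Pt H x := fun x c =>
      ⟨(Polynomial.eval₂RingHom x c).comp (s.toRingHom.comp (Ideal.Quotient.mk J)), fun l => by
        have h1 : s (Ideal.Quotient.mk J (algebraMap L H l)) = Polynomial.C l := s.commutes l
        change Polynomial.eval₂ x c (s (Ideal.Quotient.mk J (algebraMap L H l))) = x l
        rw [h1, Polynomial.eval₂_C]⟩
    have hσJ : ∀ {T : Type u} [CommRing T] (x : L →+* T) (c : T), (σ x c).Mem J := by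
      intro T _ x c f hf
      change Polynomial.eval₂ x c (s (Ideal.Quotient.mk J f)) = 0
      rw [Ideal.Quotient.eq_zero_iff_mem.2 hf, map_zero, Polynomial.eval₂_zero]
    have hσp : ∀ {T : Type u} [CommRing T] (x : L →+* T) (c : T), (σ x c).hom p = c := by
      intro T _ x c
      change Polynomial.eval₂ x c (s (Ideal.Quotient.mk J p)) = c
      rw [hs, Polynomial.eval₂_X]
    let τ : Pt H (algebraMap L H) := Pt.taut H
    -- The new retraction is `u ↦ σ(p(ρ(u)))⁻¹ ρ(u)`, on which `p` vanishes. The correction stands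
    -- on the left and does not change when `u` is translated on the right by a point with `p = 0`,
    -- so equivariance survives.
    let r : Pt H (algebraMap L H) := (σ _ ((τ.res ρ).hom p))⁻¹ * τ.res ρ
    have hr : ∀ {T : Type u} [CommRing T] {x : L →+* T} (u : Pt H x),
        u.res r.toAlgHom = (σ x ((u.res ρ).hom p))⁻¹ * u.res ρ := by
      intro T _ x u
      rw [Pt.res_toAlgHom, map_mul, map_inv]
      congr 2
      · refine Pt.ext' fun f => ?_
        rw [Pt.mapTo_hom]
        change u.hom (Polynomial.eval₂ _ _ _) = Polynomial.eval₂ _ _ _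
        rw [Polynomial.hom_eval₂]
        congr 1
        exact RingHom.ext u.base
      · exact Pt.ext' fun f => Pt.mapTo_hom _ _ _ _
    refine ⟨r.toAlgHom, fun u => ?_, fun u m hm => ?_⟩
    · rw [hr, hmem]
      refine ⟨(hσJ _ _).inv.mul (hρ u), ?_⟩
      rw [Pt.mul_hom_of_mem hp' (hσJ _ _).inv (hρ u), hinv (hσJ _ _), hσp, neg_add_cancel]
    · rw [hmem] at hm
      rw [hr, hr, hρm u m hm.1, Pt.mul_hom_of_mem hp' (hρ u) hm.1, hm.2, add_zero, mul_assoc]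

/-- A unipotent group in characteristic zero retracts equivariantly onto its closed subgroups. -/
theorem IsConilpotent.hasEquivariantRetraction (hH : IsConilpotent L H) [IsNoetherianRing H]
    (I : Ideal H) [hI : I.IsHopfIdeal L] : HasEquivariantRetraction L I := by
  have hwf : WellFounded ((· > ·) : Ideal H → Ideal H → Prop) := IsWellFounded.wf
  obtain ⟨J, ⟨hJI, hJ, hret⟩, hmax⟩ := hwf.has_min
    {J : Ideal H | J ≤ I ∧ J.IsHopfIdeal L ∧ HasEquivariantRetraction L J}
    ⟨⊥, bot_le, isHopfIdeal_bot, hasEquivariantRetraction_bot⟩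
  rcases hJI.lt_or_eq with hlt | rfl
  · obtain ⟨J', h1, h2, h3, h4⟩ := exists_larger_retraction hH hlt hret
    exact absurd h1 (hmax J' ⟨h2, h3, h4⟩)
  · exact hret

-- The morphism `u ↦ u ρ(u)⁻¹` is constant on cosets because `ρ` commutes with right translations by
-- the subgroup, so it descends to a section of the quotient map. Functions on the quotient do not
-- see the factor `ρ(u)⁻¹`, which gives `r b = b`.
omit [CharZero L] in
lemma HasEquivariantRetraction.exists_splitting {I : Ideal H} [hI : I.IsHopfIdeal L]
    (hret : HasEquivariantRetraction L I) : ∃ (r : H →ₐ[L] coinvariants L I) (ρ : H →ₐ[L] H),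
      (∀ b : coinvariants L I, r b = b) ∧
      (∀ {T : Type u} [CommRing T] {x : L →+* T} (u : Pt H x), (u.res ρ).Mem I) ∧
      ∀ {T : Type u} [CommRing T] {x : L →+* T} (u : Pt H x),
        (u.res (coinvariants L I).val).res r = u * (u.res ρ)⁻¹ := by
  obtain ⟨ρ, hρ, hρm⟩ := hret
  let τ : Pt H (algebraMap L H) := Pt.taut H
  let R : Pt H (algebraMap L H) := τ * (τ.res ρ)⁻¹
  have hR : ∀ {T : Type u} [CommRing T] {x : L →+* T} (u : Pt H x),
      u.res R.toAlgHom = u * (u.res ρ)⁻¹ := by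
    intro T _ x u
    rw [Pt.res_toAlgHom, map_mul, map_inv, Pt.mapTo_taut]
    congr 2
    exact Pt.ext' fun f => Pt.mapTo_hom _ _ _ _
  have hmem : ∀ f, R.toAlgHom f ∈ coinvariants L I := fun f => by
    refine coinvariants.mem_of_points fun u n hn => ?_
    have := congrArg (fun w => w.hom f)
      (((hR (u * n)).trans (by rw [hρm u n hn]; group)).trans (hR u).symm)
    exact this
  refine ⟨R.toAlgHom.codRestrict _ hmem, ρ, fun b => Subtype.ext ?_, hρ, fun u => hR u⟩
  exact coinvariants.apply_mul b.2 τ _ (hρ τ).inv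

variable {T : Type u} [CommRing T] {x : L →+* T} {I : Ideal H} [hI : I.IsHopfIdeal L]

/-- Points of the quotient of a unipotent group lift. -/
theorem IsConilpotent.exists_lift (hH : IsConilpotent L H) [IsNoetherianRing H]
    (v : Pt (coinvariants L I) x) : ∃ u : Pt H x, u.res (coinvariants L I).val = v := by
  obtain ⟨r, ρ, hr, -, -⟩ := (hH.hasEquivariantRetraction I).exists_splitting
  refine ⟨v.res r, Pt.ext' fun b => ?_⟩
  rw [Pt.res_hom, Pt.res_hom]
  exact congrArg v.hom (hr b)

/-- The kernel of the projection to the quotient of a unipotent group is the given subgroup. -/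
theorem IsConilpotent.mem_of_res_eq_one (hH : IsConilpotent L H) [IsNoetherianRing H]
    [IsNormalIdeal L I] (u : Pt H x)
    (hu : u.res (coinvariants L I).val = 1) : u.Mem I := by
  obtain ⟨r, ρ, -, hρ, hr⟩ := (hH.hasEquivariantRetraction I).exists_splitting
  have h1 : (1 : Pt H x).res (coinvariants L I).val = 1 := rfl
  -- As `u` and `1` have the same image, `u ρ(u)⁻¹ = ρ(1)⁻¹`; thus `u` is a product of two points of
  -- the subgroup.
  have h2 := (hr u).symm.trans ((congrArg (fun w => Pt.res w r) (hu.trans h1.symm)).trans (hr 1))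
  rw [one_mul] at h2
  rw [mul_inv_eq_iff_eq_mul.1 h2]
  exact (hρ 1).inv.mul (hρ u)

omit [CharZero L] in
lemma Pt.res_eq_one_of_mem [IsNormalIdeal L I] {u : Pt H x} (hu : u.Mem I) :
    u.res (coinvariants L I).val = 1 :=
  Pt.ext' fun b => by
    have := coinvariants.apply_mul b.2 1 u hu
    rw [one_mul] at this
    exact this

end Retraction

/-! ### Commutative unipotent groups are vector groups -/

namespace EquivariantGroup

variable {K L : Type u} [Field K] [Field L] [Algebra K L] {G : AffineGroupoid K L}

section Log

variable (D : EquivariantGroup G) {T T' : Type u} [CommRing T] [CommRing T'] {x : L →+* T}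

/-- The restriction of a point to the space of additive functions. -/
def logPt (u : Pt D.O x) : D.VSec x where
  toFun p := u.hom p
  map_add' p q := map_add u.hom _ _
  map_smul' l p := by
    change u.hom (l • (p : D.O)) = x l * u.hom p
    rw [Algebra.smul_def, map_mul, u.base]

lemma logPt_apply (u : Pt D.O x) (p : D.prim) : D.logPt u p = u.hom p := rfl

lemma logPt_mul (u v : Pt D.O x) : D.logPt (u * v) = D.logPt u + D.logPt v :=
  VSec.ext fun p => mul_hom_prim p.2 u v

lemma logPt_map (u : Pt D.O x) (f : T →+* T') : D.logPt (u.map f) = vmap (D.logPt u) f := rfl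

lemma logPt_act {T : Type u} [CommRing T] [Algebra K T] {x y : L →ₐ[K] T} (g : G.Hom x y)
    (u : Pt D.O (x : L →+* T)) : D.logPt (D.act g u) = vact g (D.logPt u) := by
  refine VSec.ext fun p => ?_
  rw [logPt_apply, act_hom, ← lTensor_coactPrim]
  change _ = evalSec g (D.logPt u) (D.coactPrim p)
  generalize D.coactPrim p = z
  induction z with
  | zero => simp only [map_zero]
  | tmul a b =>
    rw [LinearMap.lTensor_tmul, Pt.pair_tmul]
    rfl
  | add a b ha hb => rw [map_add, map_add, map_add, ha, hb]

variable [CharZero L] (hD : IsConilpotent L D.O)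
  (hc : ∀ {T : Type u} [CommRing T] {x : L →+* T} (u v : Pt D.O x), u * v = v * u)

include hD hc

/-- A commutative unipotent group is a vector group. -/
lemma logPt_bijective : Function.Bijective (D.logPt : Pt D.O x → D.VSec x) := by
  have hlog : ∀ f, hD.logEnd f ∈ D.prim := fun f => mem_prim_iff.2 (hD.comul_logEnd hc f)
  constructor
  · intro u v huv
    -- The point `u v⁻¹` vanishes on all primitive elements, in particular on the values of
    -- `logEnd`, which are primitive by commutativity.
    have h1 : u * v⁻¹ = 1 := by
      refine hD.eq_one_of_logEnd _ fun f => ?_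
      have h2 : D.logPt (u * v⁻¹ * v) = D.logPt v := by rw [inv_mul_cancel_right, huv]
      rw [logPt_mul] at h2
      have h3 : D.logPt (u * v⁻¹) = 0 := add_eq_right.1 h2
      exact congrArg (fun θ : D.VSec x => θ ⟨_, hlog f⟩) h3
    exact mul_inv_eq_one.1 h1
  · intro θ
    obtain ⟨u, hu⟩ := hD.exists_point hlog (fun p hp => mem_prim_iff.1 hp) (x := x) θ
    exact ⟨u, VSec.ext hu⟩

/-- The space of additive functions on a commutative unipotent group is finite dimensional if
the group is contained in a group of finite type. -/
lemma finite_prim {B : Type u} [CommRing B] [Algebra L B] [Algebra.FiniteType L B]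
    (i : D.O →ₐ[L] B) (hi : Function.Injective i) : Module.Finite L D.prim := by
  have hlog : ∀ f, hD.logEnd f ∈ D.prim := fun f => mem_prim_iff.2 (hD.comul_logEnd hc f)
  let b := Module.Free.chooseBasis L D.prim
  let ι := Module.Free.ChooseBasisIndex L D.prim
  let θ : D.prim →ₗ[L] MvPolynomial ι L := b.constr L fun i => MvPolynomial.X i
  let θ' : D.prim →ₛₗ[algebraMap L (MvPolynomial ι L)] MvPolynomial ι L :=
    { toFun := θ
      map_add' := map_add θ
      map_smul' := fun l p => by rw [map_smul, Algebra.smul_def, smul_eq_mul] }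
  obtain ⟨u, hu⟩ := hD.exists_point hlog (fun p hp => mem_prim_iff.1 hp) θ'
  -- Some point with values in a polynomial ring sends the chosen basis to the variables, so the
  -- basis is algebraically independent. Its cardinality is then bounded by the transcendence degree
  -- of `B`, which is finite.
  have hind : AlgebraicIndependent L fun k => ((b k : D.prim) : D.O) := by
    refine AlgebraicIndependent.of_comp (Pt.toAlgHom u) ?_
    have : (Pt.toAlgHom u ∘ fun k => ((b k : D.prim) : D.O)) = MvPolynomial.X := by
      funext k
      refine (hu (b k)).trans ?_
      exact b.constr_basis L _ k
    rw [this]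
    exact MvPolynomial.algebraicIndependent_X ι L
  have h1 := (hind.map' hi).cardinalMk_le_trdeg
  obtain ⟨n, f, hf⟩ := Algebra.FiniteType.iff_quotient_mvPolynomial''.1 ‹Algebra.FiniteType L B›
  have h2 := h1.trans (trdeg_le_of_surjective f hf)
  rw [MvPolynomial.trdeg_of_isDomain] at h2
  have : Finite ι := by
    rw [← Cardinal.lt_aleph0_iff_finite]
    refine h2.trans_lt ?_
    simp
  exact Module.Finite.of_basis b

end Log

/-! ### Subgroups of quotient groups and central extensions -/

section Extension

/-- An extension of `W''` by the vector group `V` with `G`-action given by the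
additive functions on `D`, whose kernel is central and which is split as a map of schemes. -/
structure CentralExt (W' W'' D : EquivariantGroup G) where
  p : W''.O →ₐ[L] W'.O
  ι : ∀ {T : Type u} [CommRing T] {x : L →+* T}, D.VSec x → Pt W'.O x
  res_mul : ∀ {T : Type u} [CommRing T] {x : L →+* T} (u v : Pt W'.O x),
    (u * v).res p = u.res p * v.res p
  surj : ∀ {T : Type u} [CommRing T] {x : L →+* T} (v : Pt W''.O x), ∃ u : Pt W'.O x, u.res p = v
  act_res : ∀ {T : Type u} [CommRing T] [Algebra K T] {x y : L →ₐ[K] T} (g : G.Hom x y)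
    (u : Pt W'.O (x : L →+* T)), (W'.act g u).res p = W''.act g (u.res p)
  ι_add : ∀ {T : Type u} [CommRing T] {x : L →+* T} (θ η : D.VSec x), ι (θ + η) = ι θ * ι η
  ι_map : ∀ {T T' : Type u} [CommRing T] [CommRing T'] {x : L →+* T} (f : T →+* T')
    (θ : D.VSec x), (ι θ).map f = ι (vmap θ f)
  ι_injective : ∀ {T : Type u} [CommRing T] {x : L →+* T},
    Function.Injective (ι : D.VSec x → Pt W'.O x)
  ι_comm : ∀ {T : Type u} [CommRing T] {x : L →+* T} (θ : D.VSec x) (u : Pt W'.O x),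
    ι θ * u = u * ι θ
  ι_act : ∀ {T : Type u} [CommRing T] [Algebra K T] {x y : L →ₐ[K] T} (g : G.Hom x y)
    (θ : D.VSec (x : L →+* T)), W'.act g (ι θ) = ι (vact g θ)
  res_eq_one_iff : ∀ {T : Type u} [CommRing T] {x : L →+* T} (u : Pt W'.O x),
    u.res p = 1 ↔ ∃ θ, ι θ = u

section

variable {T : Type u} [CommRing T] {x : L →+* T}

lemma coinvariants_mono {H : Type u} [CommRing H] [HopfAlgebra L H] {I J : Ideal H}
    (hIJ : I ≤ J) : coinvariants L I ≤ coinvariants L J := fun _ hf =>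
  coinvariants.mem_of_points fun u n hn => coinvariants.apply_mul hf u n fun f hf => hn f (hIJ hf)

/-- The restriction of functions from `U / N` to `M / N`. -/
noncomputable def restrictCoinv (L : Type u) [Field L] {H : Type u} [CommRing H] [HopfAlgebra L H]
    (I J : Ideal H) [I.IsHopfIdeal L] :
    coinvariants L J →ₐ[L] coinvariants L (J.map (Ideal.Quotient.mk I)) :=
  ((Ideal.Quotient.mkₐ L I).comp (coinvariants L J).val).codRestrict _ fun b =>
    coinvariants.mem_of_points fun u n hn => by
      have h1 := (mem_map_iff I J n).1 hn
      have h2 := coinvariants.apply_mul b.2 (Pt.ofQuot u) (Pt.ofQuot n) h1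
      rw [← Pt.ofQuot_mul] at h2
      exact h2

variable {H : Type u} [CommRing H] [HopfAlgebra L H] {I J : Ideal H} [hI : I.IsHopfIdeal L]

/-- The inclusion of `M / N` into `U / N`, on points. -/
noncomputable def subToQuot (d : Pt (coinvariants L (J.map (Ideal.Quotient.mk I))) x) :
    Pt (coinvariants L J) x := d.res (restrictCoinv L I J)

lemma subToQuot_res (m : Pt (H ⧸ I) x) :
    subToQuot (m.res (coinvariants L (J.map (Ideal.Quotient.mk I))).val) =
      (Pt.ofQuot m).res (coinvariants L J).val := rfl

variable [hJ : J.IsHopfIdeal L] [IsNormalIdeal L J] [CharZero L] (hH : IsConilpotent L H)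
  [IsNoetherianRing H]

include hH

-- Through this lemma, identities between points of `M / N` are verified on points of `M`, where the
-- inclusion into `U` is given by an explicit formula.
omit hJ [IsNormalIdeal L J] in
lemma exists_lift_sub [hJ : J.IsHopfIdeal L] [IsNormalIdeal L J]
    (d : Pt (coinvariants L (J.map (Ideal.Quotient.mk I))) x) :
    ∃ m : Pt (H ⧸ I) x, m.res (coinvariants L (J.map (Ideal.Quotient.mk I))).val = d :=
  IsConilpotent.exists_lift (hH.of_surjective
    (Bialgebra.Quotient.mkBialgHom (R := L) I) Ideal.Quotient.mk_surjective) d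

lemma subToQuot_mul (d e : Pt (coinvariants L (J.map (Ideal.Quotient.mk I))) x) :
    subToQuot (d * e) = subToQuot d * subToQuot e := by
  obtain ⟨m, rfl⟩ := exists_lift_sub hH d
  obtain ⟨n, rfl⟩ := exists_lift_sub hH e
  rw [← Pt.res_coinvariants_mul, subToQuot_res, subToQuot_res, subToQuot_res, Pt.ofQuot_mul,
    Pt.res_coinvariants_mul]

/-- A point of `M` that is trivial in `U / N` lies in `N` by `IsConilpotent.mem_of_res_eq_one`, so
it is already trivial in `M / N`. -/
lemma subToQuot_injective : Function.Injective
    (subToQuot : Pt (coinvariants L (J.map (Ideal.Quotient.mk I))) x →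
      Pt (coinvariants L J) x) := by
  have hone : ∀ d : Pt (coinvariants L (J.map (Ideal.Quotient.mk I))) x, subToQuot d = 1 →
      d = 1 := by
    intro d hd
    obtain ⟨m, rfl⟩ := exists_lift_sub hH d
    rw [subToQuot_res] at hd
    have h1 := (mem_map_iff I J m).2 (hH.mem_of_res_eq_one _ hd)
    exact Pt.res_eq_one_of_mem h1
  intro d e hde
  have h1 : subToQuot (d * e⁻¹) * subToQuot e = subToQuot e := by
    rw [← subToQuot_mul hH, inv_mul_cancel_right, hde]
  exact mul_inv_eq_one.1 (hone _ (mul_eq_right.1 h1))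

-- The two products differ by a commutator, which lies in the subgroup of `J` and dies in the
-- quotient.
omit hI [CharZero L] [IsNoetherianRing H] hH in
lemma ofQuot_comm (hcomm : ∀ {T : Type u} [CommRing T] {x : L →+* T} (u v : Pt H x),
    u.Mem I → (u * v * u⁻¹ * v⁻¹).Mem J) (u v : Pt H x) (hu : u.Mem I) :
    u.res (coinvariants L J).val * v.res (coinvariants L J).val =
      v.res (coinvariants L J).val * u.res (coinvariants L J).val := by
  have h1 := Pt.res_eq_one_of_mem (hcomm u v hu)
  have h2 : u * v = (u * v * u⁻¹ * v⁻¹) * (v * u) := by group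
  rw [← Pt.res_coinvariants_mul, ← Pt.res_coinvariants_mul, h2, Pt.res_coinvariants_mul, h1,
    one_mul]

lemma subToQuot_comm (hcomm : ∀ {T : Type u} [CommRing T] {x : L →+* T} (u v : Pt H x),
    u.Mem I → (u * v * u⁻¹ * v⁻¹).Mem J)
    (d : Pt (coinvariants L (J.map (Ideal.Quotient.mk I))) x) (v : Pt (coinvariants L J) x) :
    subToQuot d * v = v * subToQuot d := by
  obtain ⟨m, rfl⟩ := exists_lift_sub hH d
  obtain ⟨v, rfl⟩ := hH.exists_lift v
  rw [subToQuot_res]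
  have h1 := Pt.ofQuot_mem m
  exact ofQuot_comm hcomm _ v h1

end

end Extension

end EquivariantGroup

section Inclusion

variable {L : Type u} [Field L] {H : Type u} [CommRing H] [HopfAlgebra L H] (I : Ideal H)
  [I.IsHopfIdeal L] [IsNormalIdeal L I]

/-- The inclusion of the ring of coinvariants, as a homomorphism of bialgebras. -/
noncomputable def coinvariantsBialgHom : coinvariants L I →ₐc[L] H :=
  BialgHom.ofAlgHom (coinvariants L I).val rfl (AlgHom.ext fun b => coinvariants.incl₂_comulHom b)

lemma IsConilpotent.coinvariants (hH : IsConilpotent L H) :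
    IsConilpotent L (_root_.coinvariants L I) :=
  hH.of_injective (coinvariantsBialgHom I) Subtype.val_injective

omit [IsNormalIdeal L I] in
lemma IsConilpotent.coinvariants_quotient (hH : IsConilpotent L H) (J : Ideal H)
    [J.IsHopfIdeal L] [IsNormalIdeal L J] :
    IsConilpotent L (_root_.coinvariants L (J.map (Ideal.Quotient.mk I))) :=
  IsConilpotent.coinvariants (J.map (Ideal.Quotient.mk I)) (hH.of_surjective
    (Bialgebra.Quotient.mkBialgHom (R := L) I) Ideal.Quotient.mk_surjective)

end Inclusion

/-! ### The central extension attached to a pair of stable normal subgroups -/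

namespace EquivariantGroup

variable {K L : Type u} [Field K] [Field L] [Algebra K L] {G : AffineGroupoid K L}
  (W : EquivariantGroup G) {I J : Ideal W.O} [hI : I.IsHopfIdeal L] [hJ : J.IsHopfIdeal L]
  [IsNormalIdeal L I] [IsNormalIdeal L J] (hIs : W.IsStableIdeal I) (hJs : W.IsStableIdeal J)

section

omit [IsNormalIdeal L I]

variable (hH : IsConilpotent L W.O)

include hH in
lemma isConilpotent_subquot : IsConilpotent L (W.subquot I J hIs hJs).O :=
  hH.coinvariants_quotient I J

variable [CharZero L] [IsNoetherianRing W.O]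

/-- The inclusion of `M / N` into `W / N`, on points. -/
noncomputable def subIncl {T : Type u} [CommRing T] {x : L →+* T}
    (d : Pt (W.subquot I J hIs hJs).O x) : Pt (W.quot J hJs).O x :=
  subToQuot (L := L) (H := W.O) (I := I) (J := J) d

include hH in
lemma subIncl_mul {T : Type u} [CommRing T] {x : L →+* T} (d e : Pt (W.subquot I J hIs hJs).O x) :
    W.subIncl hIs hJs (d * e) = W.subIncl hIs hJs d * W.subIncl hIs hJs e :=
  subToQuot_mul (L := L) (H := W.O) (I := I) (J := J) hH d e

include hH in
lemma subIncl_injective {T : Type u} [CommRing T] {x : L →+* T} : Function.Injective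
    (W.subIncl hIs hJs : Pt (W.subquot I J hIs hJs).O x → Pt (W.quot J hJs).O x) :=
  subToQuot_injective (L := L) (H := W.O) (I := I) (J := J) hH

variable (hcomm : ∀ {T : Type u} [CommRing T] {x : L →+* T} (u v : Pt W.O x),
    u.Mem I → (u * v * u⁻¹ * v⁻¹).Mem J)

include hH hcomm in
lemma subIncl_comm {T : Type u} [CommRing T] {x : L →+* T} (d : Pt (W.subquot I J hIs hJs).O x)
    (v : Pt (W.quot J hJs).O x) :
    W.subIncl hIs hJs d * v = v * W.subIncl hIs hJs d :=
  subToQuot_comm (L := L) (H := W.O) (I := I) (J := J) hH hcomm d v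

include hH hcomm in
lemma subquot_comm {T : Type u} [CommRing T] {x : L →+* T} (d e : Pt (W.subquot I J hIs hJs).O x) :
    d * e = e * d := by
  apply W.subIncl_injective hIs hJs hH
  rw [subIncl_mul _ _ _ hH, subIncl_mul _ _ _ hH, subIncl_comm _ _ _ hH hcomm]

include hH in
lemma subIncl_act {T : Type u} [CommRing T] [Algebra K T] {x y : L →ₐ[K] T} (g : G.Hom x y)
    (d : Pt (W.subquot I J hIs hJs).O (x : L →+* T)) :
    W.subIncl hIs hJs ((W.subquot I J hIs hJs).act g d) =
      (W.quot J hJs).act g (W.subIncl hIs hJs d) := by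
  obtain ⟨m, rfl⟩ := exists_lift_sub (L := L) (H := W.O) (I := I) (J := J) hH d
  have h1 := actB_res (W := W.sub I hIs) (I := J.map (Ideal.Quotient.mk I))
    (fun g u hu => (mem_map_iff I J _).2 (hJs g _ ((mem_map_iff I J u).1 hu))) g m
  have h2 := actB_res (W := W) hJs g (Pt.ofQuot m)
  exact (congrArg (W.subIncl hIs hJs) h1).trans h2.symm

include hH hcomm in
lemma finite_prim_subquot [Algebra.FiniteType L W.O] :
    Module.Finite L (W.subquot I J hIs hJs).prim :=
  (W.subquot I J hIs hJs).finite_prim (W.isConilpotent_subquot hIs hJs hH)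
    (W.subquot_comm hIs hJs hH hcomm) (B := W.O ⧸ I)
    (coinvariants L (J.map (Ideal.Quotient.mk I))).val Subtype.val_injective

/-- The exponential of the vector group `M / N`. -/
noncomputable def expSubquot {T : Type u} [CommRing T] {x : L →+* T} :
    Pt (W.subquot I J hIs hJs).O x ≃ (W.subquot I J hIs hJs).VSec x :=
  Equiv.ofBijective _ ((W.subquot I J hIs hJs).logPt_bijective
    (W.isConilpotent_subquot hIs hJs hH) (W.subquot_comm hIs hJs hH hcomm))

end

section

variable (hH : IsConilpotent L W.O) [CharZero L] [IsNoetherianRing W.O]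
  (hcomm : ∀ {T : Type u} [CommRing T] {x : L →+* T} (u v : Pt W.O x),
    u.Mem I → (u * v * u⁻¹ * v⁻¹).Mem J) {T : Type u} [CommRing T] {x : L →+* T}

omit [IsNormalIdeal L I]

lemma logPt_expSubquot (θ : (W.subquot I J hIs hJs).VSec x) : (W.subquot I J hIs hJs).logPt
    ((W.expSubquot hIs hJs hH hcomm).symm θ) = θ :=
  (W.expSubquot hIs hJs hH hcomm).apply_symm_apply θ

include hH hcomm in
lemma logPt_subquot_injective : Function.Injective
    ((W.subquot I J hIs hJs).logPt : Pt _ x → (W.subquot I J hIs hJs).VSec x) :=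
  (W.expSubquot hIs hJs hH hcomm).injective

/-- The inclusion of the vector group `M / N` into `W / N`. -/
noncomputable def vecIncl (θ : (W.subquot I J hIs hJs).VSec x) : Pt (W.quot J hJs).O x :=
  W.subIncl hIs hJs ((W.expSubquot hIs hJs hH hcomm).symm θ)

/-- The exponential is additive because its inverse `logPt` is. -/
lemma vecIncl_add (θ η : (W.subquot I J hIs hJs).VSec x) :
    W.vecIncl hIs hJs hH hcomm (θ + η) =
      W.vecIncl hIs hJs hH hcomm θ * W.vecIncl hIs hJs hH hcomm η := by
  refine Eq.trans ?_ (W.subIncl_mul hIs hJs hH _ _)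
  refine congrArg (W.subIncl hIs hJs) (W.logPt_subquot_injective hIs hJs hH hcomm ?_)
  rw [logPt_mul, logPt_expSubquot, logPt_expSubquot, logPt_expSubquot]

lemma vecIncl_map {T' : Type u} [CommRing T'] (f : T →+* T')
    (θ : (W.subquot I J hIs hJs).VSec x) :
    (W.vecIncl hIs hJs hH hcomm θ).map f = W.vecIncl hIs hJs hH hcomm (vmap θ f) := by
  have h1 : ((W.expSubquot hIs hJs hH hcomm).symm θ).map f =
      (W.expSubquot hIs hJs hH hcomm).symm (vmap θ f) := by
    apply W.logPt_subquot_injective hIs hJs hH hcomm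
    rw [logPt_expSubquot, logPt_map, logPt_expSubquot]
  exact congrArg (W.subIncl hIs hJs) h1

lemma vecIncl_injective : Function.Injective
    (W.vecIncl hIs hJs hH hcomm : (W.subquot I J hIs hJs).VSec x → Pt (W.quot J hJs).O x) :=
  fun _ _ h => (Equiv.injective _) (W.subIncl_injective hIs hJs hH h)

lemma vecIncl_act {T : Type u} [CommRing T] [Algebra K T] {x y : L →ₐ[K] T} (g : G.Hom x y)
    (θ : (W.subquot I J hIs hJs).VSec (x : L →+* T)) :
    (W.quot J hJs).act g (W.vecIncl hIs hJs hH hcomm θ) =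
      W.vecIncl hIs hJs hH hcomm (vact g θ) := by
  refine (W.subIncl_act hIs hJs hH g _).symm.trans ?_
  refine congrArg (W.subIncl hIs hJs) (W.logPt_subquot_injective hIs hJs hH hcomm ?_)
  rw [logPt_act, logPt_expSubquot, logPt_expSubquot]

end

section

/-- The quotient map `W / N ⟶ W / M`. -/
noncomputable def quotProj (hIJ : I ≤ J) (hIs : W.IsStableIdeal I) (hJs : W.IsStableIdeal J) :
    (W.quot I hIs).O →ₐ[L] (W.quot J hJs).O :=
  Subalgebra.inclusion (coinvariants_mono (L := L) (H := W.O) hIJ)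

variable (hH : IsConilpotent L W.O) [CharZero L] [IsNoetherianRing W.O]
  (hcomm : ∀ {T : Type u} [CommRing T] {x : L →+* T} (u v : Pt W.O x),
    u.Mem I → (u * v * u⁻¹ * v⁻¹).Mem J) (hIJ : I ≤ J) {T : Type u} [CommRing T] {x : L →+* T}

include hH in
lemma exists_lift_quot (u : Pt (W.quot I hIs).O x) :
    ∃ v : Pt W.O x, v.res (coinvariants L I).val = u :=
  hH.exists_lift (I := I) u

include hH in
lemma quotProj_mul (u v : Pt (W.quot J hJs).O x) : (u * v).res (W.quotProj hIJ hIs hJs) =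
    u.res (W.quotProj hIJ hIs hJs) * v.res (W.quotProj hIJ hIs hJs) := by
  obtain ⟨u, rfl⟩ := W.exists_lift_quot hJs hH u
  obtain ⟨v, rfl⟩ := W.exists_lift_quot hJs hH v
  have h1 := Pt.res_coinvariants_mul J u v
  have h2 := Pt.res_coinvariants_mul I u v
  exact (congrArg (fun w : Pt (W.quot J hJs).O x => w.res (W.quotProj hIJ hIs hJs))
    h1.symm).trans h2

include hH in
lemma quotProj_act {T : Type u} [CommRing T] [Algebra K T] {x y : L →ₐ[K] T} (g : G.Hom x y)
    (u : Pt (W.quot J hJs).O (x : L →+* T)) :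
    ((W.quot J hJs).act g u).res (W.quotProj hIJ hIs hJs) =
      (W.quot I hIs).act g (u.res (W.quotProj hIJ hIs hJs)) := by
  obtain ⟨u, rfl⟩ := W.exists_lift_quot hJs hH u
  have h1 := actB_res (W := W) hJs g u
  have h2 := actB_res (W := W) hIs g u
  exact (congrArg (fun w : Pt (W.quot J hJs).O (y : L →+* T) => w.res (W.quotProj hIJ hIs hJs))
    h1).trans h2.symm

/-- A point of `W / N` that dies in `W / M` lifts to a point of `W` lying in `M`; the logarithm of
its class in `M / N` is the required section. -/
lemma quotProj_eq_one_iff (u : Pt (W.quot J hJs).O x) :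
    u.res (W.quotProj hIJ hIs hJs) = 1 ↔ ∃ θ, W.vecIncl hIs hJs hH hcomm θ = u := by
  constructor
  · intro hu
    obtain ⟨u, rfl⟩ := W.exists_lift_quot hJs hH u
    have h1 : u.Mem I := hH.mem_of_res_eq_one u hu
    refine ⟨W.expSubquot hIs hJs hH hcomm
      ((u.desc h1).res (coinvariants L (J.map (Ideal.Quotient.mk I))).val), ?_⟩
    refine (congrArg (W.subIncl hIs hJs) (Equiv.symm_apply_apply _ _)).trans ?_
    rfl
  · rintro ⟨θ, rfl⟩
    change (W.subIncl hIs hJs ((W.expSubquot hIs hJs hH hcomm).symm θ)).res _ = 1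
    generalize (W.expSubquot hIs hJs hH hcomm).symm θ = d
    obtain ⟨m, rfl⟩ := exists_lift_sub (L := L) (H := W.O) (I := I) (J := J) hH d
    exact Pt.res_eq_one_of_mem (Pt.ofQuot_mem m)

end

/-- For closed normal subgroups `N ⊆ M` with `[M, W] ⊆ N`, the group `W / N` is a central
extension of `W / M` by the vector group `M / N`. -/
noncomputable def quotExt (hH : IsConilpotent L W.O) [CharZero L] [IsNoetherianRing W.O]
    (hcomm : ∀ {T : Type u} [CommRing T] {x : L →+* T} (u v : Pt W.O x),
      u.Mem I → (u * v * u⁻¹ * v⁻¹).Mem J) (hIJ : I ≤ J) :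
    CentralExt (W.quot J hJs) (W.quot I hIs) (W.subquot I J hIs hJs) where
  p := W.quotProj hIJ hIs hJs
  ι θ := W.vecIncl hIs hJs hH hcomm θ
  res_mul u v := W.quotProj_mul hIs hJs hH hIJ u v
  surj v := by
    obtain ⟨u, hu⟩ := W.exists_lift_quot hIs hH v
    exact ⟨u.res (coinvariants L J).val, hu⟩
  act_res g u := W.quotProj_act hIs hJs hH hIJ g u
  ι_add θ η := W.vecIncl_add hIs hJs hH hcomm θ η
  ι_map f θ := W.vecIncl_map hIs hJs hH hcomm f θ
  ι_injective {_ _ _} := W.vecIncl_injective hIs hJs hH hcomm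
  ι_comm _ u := W.subIncl_comm hIs hJs hH hcomm _ u
  ι_act g θ := W.vecIncl_act hIs hJs hH hcomm g θ
  res_eq_one_iff u := W.quotProj_eq_one_iff hIs hJs hH hcomm hIJ u

section LowerCentralSeries

/-- The bound `1 ≤ n` is essential: the term of index `0` is a mere convention, and the term of
index `1` is not its commutator subgroup. -/
lemma commutator_mem_lcsIdeal {n : ℕ} (hn : 1 ≤ n) {T : Type u} [CommRing T] {x : L →+* T}
    (u v : Pt W.O x) (hu : u.Mem (lcsIdeal L W.O n)) :
    (u * v * u⁻¹ * v⁻¹).Mem (lcsIdeal L W.O (n + 1)) := by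
  obtain ⟨n, rfl⟩ := Nat.exists_eq_add_of_le' hn
  exact commutator_mem _ u v hu

lemma isNoetherianRing_of_finiteType [Algebra.FiniteType L W.O] : IsNoetherianRing W.O :=
  Algebra.FiniteType.isNoetherianRing L W.O

variable (hH : IsConilpotent L W.O) [CharZero L] [Algebra.FiniteType L W.O]

/-- The central extension `Uₙ₊₁` of `Uₙ` by `Uⁿ / Uⁿ⁺¹`. -/
noncomputable def lcsExt {n : ℕ} (hn : 1 ≤ n) :
    CentralExt (W.lcsQuot (n + 1)) (W.lcsQuot n) (W.gr n) :=
  haveI := W.isNoetherianRing_of_finiteType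
  W.quotExt (W.isStableIdeal_lcsIdeal n) (W.isStableIdeal_lcsIdeal (n + 1)) hH
    (W.commutator_mem_lcsIdeal hn) (lcsIdeal_le_succ n)

include hH in
lemma finite_prim_gr {n : ℕ} (hn : 1 ≤ n) : Module.Finite L (W.gr n).prim :=
  haveI := W.isNoetherianRing_of_finiteType
  W.finite_prim_subquot (W.isStableIdeal_lcsIdeal n) (W.isStableIdeal_lcsIdeal (n + 1)) hH
    (W.commutator_mem_lcsIdeal hn)

-- `U¹ = U`, so `U₁` has only the trivial point. This starts the induction.
include hH in
lemma subsingleton_lcsQuot_one {T : Type u} [CommRing T] {x : L →+* T}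
    (u v : Pt (W.lcsQuot 1).O x) : u = v := by
  have := W.isNoetherianRing_of_finiteType
  have key : ∀ u : Pt (W.lcsQuot 1).O x, u = 1 := fun u => by
    obtain ⟨u, rfl⟩ := W.exists_lift_quot (W.isStableIdeal_lcsIdeal 1) hH u
    exact Pt.res_eq_one_of_mem (mem_bot u)
  rw [key u, key v]

include hH in
lemma logPt_gr_bijective {n : ℕ} (hn : 1 ≤ n) {T : Type u} [CommRing T] {x : L →+* T} :
    Function.Bijective ((W.gr n).logPt : Pt (W.gr n).O x → (W.gr n).VSec x) :=
  haveI := W.isNoetherianRing_of_finiteType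
  (W.expSubquot (W.isStableIdeal_lcsIdeal n) (W.isStableIdeal_lcsIdeal (n + 1)) hH
    (W.commutator_mem_lcsIdeal hn)).bijective

end LowerCentralSeries

end EquivariantGroup

/-! ### Points with values in `R ⊗ B` -/

section BaseChange

variable {K L : Type u} [Field K] [Field L] [Algebra K L]
  {R R' B T T' : Type u} [CommRing R] [Algebra K R] [CommRing R'] [Algebra K R'] [CommRing B]
  [Algebra K B] [CommRing T] [Algebra K T] [CommRing T'] [Algebra K T']

variable (R B) in
/-- The structure morphism of `R ⊗ B` as an `R`-algebra. -/
abbrev incLeft : R →ₐ[K] R ⊗[K] B := Algebra.TensorProduct.includeLeft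

variable (R B) in
/-- The extension of scalars from `B` to `R ⊗ B`. -/
abbrev incRight : B →ₐ[K] R ⊗[K] B := Algebra.TensorProduct.includeRight

/-- The point of `Spec L` with values in `R ⊗ B` defined by a point with values in `B`. -/
abbrev incPt (R : Type u) [CommRing R] [Algebra K R] (x : L →ₐ[K] B) : L →ₐ[K] R ⊗[K] B :=
  (incRight R B).comp x

lemma AlgHom.apply_id_apply (y : L →ₐ[K] T) (l : L) : y (AlgHom.id K L l) = y l := rfl

lemma AlgHom.coe_comm {f : B →ₐ[K] T} {x : L →ₐ[K] B} {y : L →ₐ[K] T} (h : ∀ l, f (x l) = y l)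
    (l : L) : (f : B →+* T) ((x : L →+* B) l) = (y : L →+* T) l := h l

/-- The homomorphism `R ⊗ B ⟶ T` defined by homomorphisms on the factors. -/
noncomputable abbrev evHom (φ : R →ₐ[K] T) (f : B →ₐ[K] T) : R ⊗[K] B →ₐ[K] T :=
  Algebra.TensorProduct.lift φ f fun _ _ => Commute.all _ _

lemma evHom_tmul (φ : R →ₐ[K] T) (f : B →ₐ[K] T) (r : R) (b : B) :
    evHom φ f (r ⊗ₜ b) = φ r * f b := by simp

lemma evHom_incPt (φ : R →ₐ[K] T) {f : B →ₐ[K] T} {x : L →ₐ[K] B} {y : L →ₐ[K] T}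
    (h : ∀ l, f (x l) = y l) (l : L) : evHom φ f (incPt R x l) = y l := by
  simp [h]

lemma evHom_incRight (φ : R →ₐ[K] T) (f : B →ₐ[K] T) (b : B) :
    evHom φ f (incRight R B b) = f b := by
  simp

lemma evHom_incLeft (φ : R →ₐ[K] T) (f : B →ₐ[K] T) (r : R) : evHom φ f (incLeft R B r) = φ r := by
  simp

lemma evHom_hom (F : R ⊗[K] B →ₐ[K] T) : evHom (F.comp Algebra.TensorProduct.includeLeft)
    (F.comp Algebra.TensorProduct.includeRight) = F := by
  ext <;> simp

end BaseChange

namespace Pt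

variable {L : Type u} [Field L] {H : Type u} [CommRing H] [HopfAlgebra L H]
  {T T' T'' : Type u} [CommRing T] [CommRing T'] [CommRing T''] {x : L →+* T} {x' : L →+* T'}
  {x'' : L →+* T''}

lemma mapTo_mapTo {φ : T →+* T'} {h : ∀ l, φ (x l) = x' l} {ψ : T' →+* T''}
    {h' : ∀ l, ψ (x' l) = x'' l} {χ : T →+* T''} {h'' : ∀ l, χ (x l) = x'' l}
    (hχ : ∀ a, ψ (φ a) = χ a) (u : Pt H x) :
    mapTo ψ h' (mapTo φ h u) = mapTo χ h'' u :=
  ext' fun b => by rw [mapTo_hom, mapTo_hom, mapTo_hom, hχ]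

lemma mapTo_eq_self {φ : T →+* T} {h : ∀ l, φ (x l) = x l} (hφ : ∀ a, φ a = a) (u : Pt H x) :
    mapTo φ h u = u :=
  ext' fun b => by rw [mapTo_hom, hφ]

lemma mapTo_res {H' : Type u} [CommRing H'] [HopfAlgebra L H'] (p : H' →ₐ[L] H) {φ : T →+* T'}
    (h : ∀ l, φ (x l) = x' l) (u : Pt H x) : (mapTo φ h u).res p = mapTo φ h (u.res p) :=
  ext' fun b => by rw [res_hom, mapTo_hom, mapTo_hom, res_hom]

end Pt

/-! ### Naturality of the action, and the universal composable pair -/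

namespace EquivariantGroup

variable {K L : Type u} [Field K] [Field L] [Algebra K L] {G : AffineGroupoid K L}

section Naturality

variable {T T' T'' : Type u} [CommRing T] [Algebra K T] [CommRing T'] [Algebra K T']
  [CommRing T''] [Algebra K T'']

/-- A form of `act_map` in which sources and targets need to agree only up to proved equations, so
that no transport between types of points appears later. -/
lemma act_mapTo (W : EquivariantGroup G) {x y : L →ₐ[K] T} {x' y' : L →ₐ[K] T'} (F : T →ₐ[K] T')
    (g : G.Hom x y) (g' : G.Hom x' y') (hg : ∀ a, F (g.hom a) = g'.hom a)
    (hx : ∀ l, (F : T →+* T') ((x : L →+* T) l) = (x' : L →+* T') l)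
    (hy : ∀ l, (F : T →+* T') ((y : L →+* T) l) = (y' : L →+* T') l)
    (u : Pt W.O (x : L →+* T)) :
    W.act g' (Pt.mapTo (F : T →+* T') hx u) = Pt.mapTo (F : T →+* T') hy (W.act g u) := by
  obtain rfl : F.comp x = x' := AlgHom.ext hx
  obtain rfl : F.comp y = y' := AlgHom.ext hy
  obtain rfl : g.map F = g' := Arr.ext (AlgHom.ext hg)
  exact (W.act_map F g u).symm

variable {D : EquivariantGroup G}

instance VSec.module {T : Type u} [CommRing T] (x : L →+* T) : Module T (D.VSec x) :=
  inferInstanceAs (Module T (D.prim →ₛₗ[x] T))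

lemma VSec.add_apply {T : Type u} [CommRing T] {x : L →+* T} (η θ : D.VSec x)
    (p : D.prim) : (η + θ) p = η p + θ p := rfl

lemma VSec.sub_apply {T : Type u} [CommRing T] {x : L →+* T} (η θ : D.VSec x)
    (p : D.prim) : (η - θ) p = η p - θ p := rfl

lemma VSec.zero_apply {T : Type u} [CommRing T] {x : L →+* T} (p : D.prim) :
    (0 : D.VSec x) p = 0 := rfl

/-- Functoriality of sections in the test ring. -/
def vmapTo {T T' : Type u} [CommRing T] [CommRing T'] {x : L →+* T} {x' : L →+* T'} (φ : T →+* T')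
    (h : ∀ l, φ (x l) = x' l) : D.VSec x →+ D.VSec x' where
  toFun θ :=
    { toFun := fun p => φ (θ p)
      map_add' := fun p q => by rw [map_add, map_add]
      map_smul' := fun l p => by rw [map_smulₛₗ, smul_eq_mul, map_mul, h, smul_eq_mul] }
  map_zero' := VSec.ext fun _ => map_zero φ
  map_add' _ _ := VSec.ext fun _ => map_add φ _ _

lemma vmapTo_apply {T T' : Type u} [CommRing T] [CommRing T'] {x : L →+* T} {x' : L →+* T'}
    (φ : T →+* T') (h : ∀ l, φ (x l) = x' l) (θ : D.VSec x) (p : D.prim) :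
    vmapTo φ h θ p = φ (θ p) := rfl

lemma vact_tsmul {x y : L →ₐ[K] T} (g : G.Hom x y) (τ : T) (θ : D.VSec (x : L →+* T)) :
    vact g (τ • θ) = τ • vact g θ := by
  refine VSec.ext fun f => ?_
  change evalSec g (τ • θ) (D.coactPrim f) = τ * evalSec g θ (D.coactPrim f)
  generalize D.coactPrim f = z
  induction z with
  | zero => simp only [map_zero, mul_zero]
  | tmul a b => exact mul_left_comm _ _ _
  | add a b ha hb => rw [map_add, map_add, ha, hb, mul_add]

lemma vact_vmapTo {x y : L →ₐ[K] T} {x' y' : L →ₐ[K] T'} (F : T →ₐ[K] T')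
    (g : G.Hom x y) (g' : G.Hom x' y') (hg : ∀ a, F (g.hom a) = g'.hom a)
    (hx : ∀ l, (F : T →+* T') ((x : L →+* T) l) = (x' : L →+* T') l)
    (hy : ∀ l, (F : T →+* T') ((y : L →+* T) l) = (y' : L →+* T') l)
    (θ : D.VSec (x : L →+* T)) :
    vact g' (vmapTo (F : T →+* T') hx θ) = vmapTo (F : T →+* T') hy (vact g θ) := by
  refine VSec.ext fun f => ?_
  change evalSec g' (vmapTo (F : T →+* T') hx θ) (D.coactPrim f) =
    F (evalSec g θ (D.coactPrim f))
  generalize D.coactPrim f = z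
  induction z with
  | zero => simp only [map_zero]
  | tmul a b =>
    change g'.hom a * F (θ b) = F (g.hom a * θ b)
    rw [map_mul, hg]
  | add a b ha hb => simp only [map_add, ha, hb]

end Naturality

section ComposablePairs

variable (G)

/-- The coordinate ring of the scheme of pairs of arrows with the same source, which is
isomorphic to the scheme of composable arrows. -/
abbrev PairRing : Type u := G.A ⊗[L] G.A

/-- The first projection from the scheme of pairs of arrows with the same source. -/
def pairLeft : G.A →ₐ[K] PairRing G := Algebra.TensorProduct.includeLeft

/-- The second projection from the scheme of pairs of arrows with the same source. -/
def pairRight : G.A →ₐ[K] PairRing G :=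
  (Algebra.TensorProduct.includeRight : G.A →ₐ[L] PairRing G).restrictScalars K

/-- The first arrow of the universal composable pair. -/
def pairFst : G.Hom ((pairLeft G).comp G.s)
    ((pairLeft G).comp G.t) :=
  G.univ.map (pairLeft G)

/-- The composite of the universal composable pair. -/
def pairComp : G.Hom ((pairLeft G).comp G.s)
    ((pairRight G).comp G.t) where
  hom := pairRight G
  source l := ((Algebra.TensorProduct.includeRight : G.A →ₐ[L] PairRing G).commutes l)
  target _ := rfl

/-- The second arrow of the universal composable pair. -/
def pairSnd : G.Hom ((pairLeft G).comp G.t)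
    ((pairRight G).comp G.t) :=
  G.comp (pairComp G) (G.inv (pairFst G))

lemma pair_comp : G.comp (pairSnd G) (pairFst G) = pairComp G := by
  rw [pairSnd, G.assoc, G.inv_comp, G.comp_one]

variable {G}

/-- The arrows `h` and `g h` have the same source, so they define a point of `A ⊗ A`, and `g` is
recovered as `(g h) h⁻¹`. Tensoring over the source alone avoids giving `A` a second `L`-algebra
structure through the target. -/
lemma exists_pair_eq {T : Type u} [CommRing T] [Algebra K T] {x y z : L →ₐ[K] T} (g : G.Hom y z)
    (h : G.Hom x y) : ∃ F : PairRing G →ₐ[K] T, (∀ a, F ((pairSnd G).hom a) = g.hom a) ∧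
      (∀ a, F ((pairFst G).hom a) = h.hom a) ∧
      ∀ a, F ((G.comp (pairSnd G) (pairFst G)).hom a) = (G.comp g h).hom a := by
  let k := G.comp g h
  let F : PairRing G →ₐ[K] T :=
    { (Pt.pair (AffineGroupoid.Hom.pt h) (AffineGroupoid.Hom.pt k)).hom with
      commutes' := fun c => by
        have : algebraMap K (PairRing G) c = (algebraMap K G.A c) ⊗ₜ 1 := rfl
        change (Pt.pair (AffineGroupoid.Hom.pt h) (AffineGroupoid.Hom.pt k)).hom _ = _
        rw [this, Pt.pair_tmul, map_one, mul_one]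
        exact h.hom.commutes c }
  have h1 : ∀ a, F ((pairFst G).hom a) = h.hom a := fun a => by
    change (Pt.pair (AffineGroupoid.Hom.pt h) (AffineGroupoid.Hom.pt k)).hom (a ⊗ₜ 1) = _
    rw [Pt.pair_tmul, map_one, mul_one]
    rfl
  have h2 : ∀ a, F ((pairComp G).hom a) = k.hom a := fun a => by
    change (Pt.pair (AffineGroupoid.Hom.pt h) (AffineGroupoid.Hom.pt k)).hom (1 ⊗ₜ a) = _
    rw [Pt.pair_tmul, map_one, one_mul]
    rfl
  refine ⟨F, ?_, h1, fun a => by rw [pair_comp, h2]⟩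
  clear_value F
  have hx : F.comp ((pairLeft G).comp G.s) = x :=
    AlgHom.ext fun l => (h1 _).trans (h.source l)
  have hy : F.comp ((pairLeft G).comp G.t) = y :=
    AlgHom.ext fun l => (h1 _).trans (h.target l)
  have hz : F.comp ((pairRight G).comp G.t) = z :=
    AlgHom.ext fun l => (h2 _).trans (k.target l)
  subst hx hy hz
  have e1 : (pairFst G).map F = h := Arr.ext (AlgHom.ext h1)
  have e2 : (pairComp G).map F = k := Arr.ext (AlgHom.ext h2)
  have e3 : (pairSnd G).map F = g := by
    have h3 := G.comp_map F (pairSnd G) (pairFst G)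
    rw [pair_comp, e1, e2] at h3
    have h4 := congrArg (fun w => G.comp w (G.inv h)) h3
    simp only [G.assoc, G.comp_inv, G.comp_one, k] at h4
    exact h4.symm
  intro a
  rw [← e3]
  rfl

end ComposablePairs

end EquivariantGroup

/-! ### Cochains over `R` with values in a vector group -/

namespace EquivariantGroup

variable {K L : Type u} [Field K] [Field L] [Algebra K L] {G : AffineGroupoid K L}
  (D : EquivariantGroup G)

section VectorCochains

variable (R : Type u) {R' B T : Type u} [CommRing R] [Algebra K R] [CommRing R'] [Algebra K R']
  [CommRing B] [Algebra K B] [CommRing T] [Algebra K T] (x : L →ₐ[K] B)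

/-- Extension of scalars of sections. -/
noncomputable def vbase :
    R ⊗[K] D.VSec (x : L →+* B) →ₗ[K] D.VSec (incPt R x : L →+* R ⊗[K] B) :=
  TensorProduct.lift (LinearMap.mk₂ K (fun r θ =>
      { toFun := fun p => r ⊗ₜ θ p
        map_add' := fun p q => by rw [map_add, TensorProduct.tmul_add]
        map_smul' := fun l p => by
          rw [map_smulₛₗ, smul_eq_mul, smul_eq_mul]
          change _ = (1 ⊗ₜ x l) * (r ⊗ₜ θ p)
          rw [Algebra.TensorProduct.tmul_mul_tmul, one_mul]
          rfl })
    (fun _ _ _ => VSec.ext fun _ => TensorProduct.add_tmul _ _ _)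
    (fun _ _ _ => VSec.ext fun _ => (TensorProduct.smul_tmul' _ _ _).symm)
    (fun _ _ _ => VSec.ext fun _ => TensorProduct.tmul_add _ _ _)
    (fun _ _ _ => VSec.ext fun _ => TensorProduct.tmul_smul _ _ _))

variable {D R x}

lemma vbase_tmul_apply (r : R) (θ : D.VSec (x : L →+* B)) (p : D.prim) :
    D.vbase R x (r ⊗ₜ θ) p = r ⊗ₜ θ p := rfl

/-- Evaluation of a section at a vector of `Vᵛ`, as a linear map. -/
def vapply (p : D.prim) : D.VSec (x : L →+* B) →ₗ[K] B where
  toFun θ := θ p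
  map_add' _ _ := rfl
  map_smul' _ _ := rfl

lemma vbase_apply (w : R ⊗[K] D.VSec (x : L →+* B)) (p : D.prim) :
    D.vbase R x w p = (vapply (x := x) p).lTensor R w := by
  induction w with
  | zero => simp only [map_zero, VSec.zero_apply]
  | tmul r θ => rfl
  | add a b ha hb => rw [map_add, VSec.add_apply, ha, hb, map_add]

/-- The section `p ↦ x(c(p)) b` for a linear form `c`. -/
def vform (x : L →ₐ[K] B) (c : D.prim →ₗ[L] L) : B →ₗ[K] D.VSec (x : L →+* B) where
  toFun b :=
    { toFun := fun p => x (c p) * b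
      map_add' := fun p q => by rw [map_add, map_add, add_mul]
      map_smul' := fun l p => by
        rw [map_smul, smul_eq_mul, map_mul, smul_eq_mul, mul_assoc]
        rfl }
  map_add' _ _ := VSec.ext fun _ => mul_add _ _ _
  map_smul' _ _ := VSec.ext fun _ => mul_smul_comm _ _ _

lemma vform_apply (c : D.prim →ₗ[L] L) (b : B) (p : D.prim) : vform x c b p = x (c p) * b := rfl

lemma vbase_vform (c : D.prim →ₗ[L] L) (z : R ⊗[K] B) :
    D.vbase R x ((vform x c).lTensor R z) = vform (incPt R x) c z := by
  induction z with
  | zero => simp only [map_zero]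
  | tmul r b =>
    refine VSec.ext fun p => ?_
    rw [LinearMap.lTensor_tmul, vbase_tmul_apply, vform_apply, vform_apply]
    change _ = (1 ⊗ₜ x (c p)) * (r ⊗ₜ b)
    rw [Algebra.TensorProduct.tmul_mul_tmul, one_mul]
  | add a b ha hb => simp only [map_add, ha, hb]

lemma sum_vform {ι : Type*} [Fintype ι] (b : Module.Basis ι L D.prim) (θ : D.VSec (x : L →+* B)) :
    ∑ i, vform x (b.coord i) (θ (b i)) = θ := by
  refine VSec.ext fun p => ?_
  have h1 : ∀ s : Finset ι, (∑ i ∈ s, vform x (b.coord i) (θ (b i))) p =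
      ∑ i ∈ s, x (b.coord i p) * θ (b i) := fun s => by
    classical
    induction s using Finset.induction_on with
    | empty => simp only [Finset.sum_empty, VSec.zero_apply]
    | insert a s ha ih => rw [Finset.sum_insert ha, Finset.sum_insert ha, VSec.add_apply, ih,
        vform_apply]
  rw [h1]
  conv_rhs => rw [← b.sum_repr p, map_sum]
  refine Finset.sum_congr rfl fun i _ => ?_
  rw [map_smulₛₗ, smul_eq_mul]
  rfl

variable [Module.Finite L D.prim]

/-- Sections are families of coordinates with respect to a finite basis of `Vᵛ`, and finite products
commute with `R ⊗ -`. -/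
lemma vbase_bijective : Function.Bijective (D.vbase R x) := by
  let b := Module.finBasis L D.prim
  constructor
  · refine (injective_iff_map_eq_zero _).2 fun w hw => ?_
    have h1 : w = ∑ i, (vform x (b.coord i)).lTensor R ((vapply (x := x) (b i)).lTensor R w) := by
      clear hw
      induction w with
      | zero => simp only [map_zero, Finset.sum_const_zero]
      | tmul r θ =>
        simp only [LinearMap.lTensor_tmul]
        rw [← TensorProduct.tmul_sum]
        exact congrArg (r ⊗ₜ ·) (sum_vform b θ).symm
      | add a b ha hb =>
        simp only [map_add, Finset.sum_add_distrib]
        rw [← ha, ← hb]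
    rw [h1]
    refine Finset.sum_eq_zero fun i _ => ?_
    rw [← vbase_apply, hw, VSec.zero_apply, map_zero]
  · intro θ
    refine ⟨∑ i, (vform x (b.coord i)).lTensor R (θ (b i)), ?_⟩
    rw [map_sum]
    simp only [vbase_vform]
    exact sum_vform b θ

omit [Module.Finite L D.prim]

/-- The value of a cochain over `R` at a point. -/
noncomputable def vev (φ : R →ₐ[K] T) (f : B →ₐ[K] T) {y : L →ₐ[K] T} (h : ∀ l, f (x l) = y l) :
    D.VSec (incPt R x : L →+* R ⊗[K] B) →+ D.VSec (y : L →+* T) :=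
  vmapTo (evHom φ f : R ⊗[K] B →+* T) (AlgHom.coe_comm (evHom_incPt φ h))

lemma vev_vbase_tmul (φ : R →ₐ[K] T) (f : B →ₐ[K] T) {y : L →ₐ[K] T} (h : ∀ l, f (x l) = y l)
    (r : R) (θ : D.VSec (x : L →+* B)) :
    vev φ f h (D.vbase R x (r ⊗ₜ θ)) = φ r • vmapTo (f : B →+* T) (AlgHom.coe_comm h) θ :=
  VSec.ext fun p => evHom_tmul φ f r (θ p)

/-- Base change of cochains. -/
noncomputable abbrev vpush (f : R →ₐ[K] R') (η : D.VSec (incPt R x : L →+* R ⊗[K] B)) :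
    D.VSec (incPt R' x : L →+* R' ⊗[K] B) :=
  vev ((incLeft R' B).comp f) (incRight R' B)
    (fun _ => rfl) η

lemma vpush_vbase (f : R →ₐ[K] R') (w : R ⊗[K] D.VSec (x : L →+* B)) :
    vpush f (D.vbase R x w) = D.vbase R' x (f.toLinearMap.rTensor _ w) := by
  induction w with
  | zero => simp only [map_zero]
  | tmul r θ =>
    refine (vev_vbase_tmul _ (incRight R' B) _ r θ).trans ?_
    refine VSec.ext fun p => ?_
    change (f r ⊗ₜ[K] (1 : B)) * ((1 : R') ⊗ₜ[K] θ p) = f r ⊗ₜ[K] θ p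
    rw [Algebra.TensorProduct.tmul_mul_tmul, one_mul, mul_one]
  | add a b ha hb => simp only [map_add, ha, hb]

/-- The value at an arrow of the coboundary of a `0`-cochain over `R`. -/
noncomputable def vcob0 (v : D.VSec (incPt R (AlgHom.id K L) : L →+* R ⊗[K] L)) (φ : R →ₐ[K] T)
    {x y : L →ₐ[K] T} (g : G.Hom x y) : D.VSec (y : L →+* T) :=
  vact g (vev φ x x.apply_id_apply v) - vev φ y y.apply_id_apply v

/-- The value at a composable pair of arrows of the coboundary of a `1`-cochain over `R`. -/
noncomputable def vcob1 (η : D.VSec (incPt R G.t : L →+* R ⊗[K] G.A)) (φ : R →ₐ[K] T)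
    {x y z : L →ₐ[K] T} (g : G.Hom y z) (h : G.Hom x y) : D.VSec (z : L →+* T) :=
  vact g (vev φ h.hom h.target η) - vev φ (G.comp g h).hom (G.comp g h).target η +
    vev φ g.hom g.target η

variable (G R) in
/-- The universal arrow, over `R`. -/
abbrev genArr : G.Hom (incPt R G.s) (incPt R G.t) := G.univ.map (incRight R G.A)

variable (G R) in
/-- The first arrow of the universal composable pair, over `R`. -/
abbrev genFst : G.Hom (incPt R ((pairLeft G).comp G.s)) (incPt R ((pairLeft G).comp G.t)) :=
  (pairFst G).map (incRight R (PairRing G))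

variable (G R) in
/-- The second arrow of the universal composable pair, over `R`. -/
abbrev genSnd : G.Hom (incPt R ((pairLeft G).comp G.t)) (incPt R ((pairRight G).comp G.t)) :=
  (pairSnd G).map (incRight R (PairRing G))

/-- The coboundary of a `0`-cochain over `R`. -/
noncomputable def vd0 (v : D.VSec (incPt R (AlgHom.id K L) : L →+* R ⊗[K] L)) :
    D.VSec (incPt R G.t : L →+* R ⊗[K] G.A) :=
  vcob0 v (incLeft R G.A) (genArr G R)

/-- The coboundary of a `1`-cochain over `R`. -/
noncomputable def vd1 (η : D.VSec (incPt R G.t : L →+* R ⊗[K] G.A)) :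
    D.VSec (incPt R ((pairRight G).comp G.t) : L →+* R ⊗[K] PairRing G) :=
  vcob1 η (incLeft R (PairRing G)) (genSnd G R) (genFst G R)

variable {x y z : L →ₐ[K] T}

lemma vcob0_eq (v : D.VSec (incPt R (AlgHom.id K L) : L →+* R ⊗[K] L)) (φ : R →ₐ[K] T)
    (g : G.Hom x y) : vcob0 v φ g = vact g (vev φ x x.apply_id_apply v) -
      vev φ y y.apply_id_apply v := rfl

lemma map_comp_hom {T' : Type u} [CommRing T'] [Algebra K T'] (g : G.Hom y z) (h : G.Hom x y)
    (F : T →ₐ[K] T') (a : G.A) : F ((G.comp g h).hom a) = (G.comp (g.map F) (h.map F)).hom a :=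
  congrArg (fun w => w.hom a) (G.comp_map F g h)

/-- Every composable pair over an `R`-algebra is a specialisation of the universal one, so the
cocycle condition needs to be checked only there. -/
lemma exists_vcob1_eq (φ : R →ₐ[K] T) (g : G.Hom y z) (h : G.Hom x y) :
    ∃ (F : R ⊗[K] PairRing G →ₐ[K] T) (_ : ∀ l, (F : R ⊗[K] PairRing G →+* T)
      ((incPt R ((pairRight G).comp G.t) : L →+* R ⊗[K] PairRing G) l) = (z : L →+* T) l),
    (∀ r, F (incLeft R (PairRing G) r) = φ r) ∧
    (∀ a, F ((genSnd G R).hom a) = g.hom a) ∧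
    (∀ a, F ((genFst G R).hom a) = h.hom a) ∧
    (∀ a, F ((G.comp (genSnd G R) (genFst G R)).hom a) = (G.comp g h).hom a) := by
  obtain ⟨F, h1, h2, h3⟩ := exists_pair_eq g h
  have e := evHom_incRight φ F
  refine ⟨evHom φ F, fun l => (e _).trans ?_, evHom_incLeft φ F, fun a => (e _).trans (h1 a),
    fun a => (e _).trans (h2 a), fun a => ?_⟩
  · exact (congrArg F ((pairSnd G).target l).symm).trans ((h1 _).trans (g.target l))
  · rw [← map_comp_hom]
    exact (e _).trans (h3 a)

variable (D)

/-- The coboundary of a `1`-cochain. -/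
noncomputable def d1 : D.VSec (G.t : L →+* G.A) →ₗ[K]
    D.VSec (((pairRight G).comp G.t : L →ₐ[K] PairRing G) : L →+* PairRing G) where
  toFun η := vact (pairSnd G) (D.cochainValue η (pairFst G)) -
    D.cochainValue η (G.comp (pairSnd G) (pairFst G)) + D.cochainValue η (pairSnd G)
  map_add' η θ := by
    have e : ∀ {x y : L →ₐ[K] PairRing G} (g : G.Hom x y), D.cochainValue (η + θ) g =
        D.cochainValue η g + D.cochainValue θ g := fun g => VSec.ext fun f => map_add g.hom _ _
    rw [e, e, e, vact_add]
    abel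
  map_smul' k η := by
    have e : ∀ {x y : L →ₐ[K] PairRing G} (g : G.Hom x y), D.cochainValue (k • η) g =
        k • D.cochainValue η g := fun g => VSec.ext fun f => map_smul g.hom _ _
    rw [e, e, e, vact_smul, ← smul_sub, ← smul_add, RingHom.id_apply]

/-- The cocycle condition at the universal pair implies all others by naturality. The cocycles thus
form the kernel of a single linear map, to which flatness can be applied. -/
lemma mem_Z1_iff (η : D.VSec (G.t : L →+* G.A)) : η ∈ D.Z1 ↔ D.d1 η = 0 := by
  refine ⟨fun h => h (pairSnd G) (pairFst G), fun h T _ _ x y z g k => ?_⟩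
  obtain ⟨F, h1, h2, h3⟩ := exists_pair_eq g k
  have ey : ∀ l, F (((pairLeft G).comp G.t) l) = y l := fun l => by
    rw [← (pairFst G).target, h2, k.target]
  have ez : ∀ l, F (((pairRight G).comp G.t) l) = z l := fun l => by
    rw [← (pairSnd G).target, h1, g.target]
  have e : ∀ {x y : L →ₐ[K] PairRing G} {x' y' : L →ₐ[K] T} (g : G.Hom x y) (g' : G.Hom x' y')
      (h : ∀ a, F (g.hom a) = g'.hom a) (hy : ∀ l, (F : PairRing G →+* T)
        ((y : L →+* PairRing G) l) = (y' : L →+* T) l),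
      D.cochainValue η g' = vmapTo (F : PairRing G →+* T) hy (D.cochainValue η g) :=
    fun g g' h _ => VSec.ext fun p => (h _).symm
  rw [e _ k h2 ey, e _ (G.comp g k) h3 ez, e _ g h1 ez, vact_vmapTo F _ g h1 ey ez, ← map_sub,
    ← map_add]
  exact (congrArg _ h).trans (map_zero _)

/-- The differential `d⁰`, on sections over the identity of `L` as a `K`-algebra. -/
noncomputable def d0Id :
    D.VSec ((AlgHom.id K L : L →ₐ[K] L) : L →+* L) →ₗ[K] D.VSec (G.t : L →+* G.A) := D.d0

variable {D}

lemma vcob0_zero (φ : R →ₐ[K] T) (g : G.Hom x y) : vcob0 (D := D) 0 φ g = 0 := by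
  rw [vcob0_eq, map_zero, map_zero, sub_zero]
  have := vact_smul g (0 : K) (0 : D.VSec (x : L →+* T))
  rwa [zero_smul, zero_smul] at this

lemma vcob0_add (v w : D.VSec (incPt R (AlgHom.id K L) : L →+* R ⊗[K] L)) (φ : R →ₐ[K] T)
    (g : G.Hom x y) : vcob0 (v + w) φ g = vcob0 v φ g + vcob0 w φ g := by
  rw [vcob0_eq, vcob0_eq, vcob0_eq, map_add, map_add, vact_add]
  abel

lemma vd0_neg (v : D.VSec (incPt R (AlgHom.id K L) : L →+* R ⊗[K] L)) : vd0 (-v) = -vd0 v := by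
  refine eq_neg_of_add_eq_zero_left ?_
  rw [vd0, vd0, ← vcob0_add, neg_add_cancel, vcob0_zero]

/-- The coboundary over `R` is `R ⊗ d⁰`. With `vd1_vbase` this reduces cohomology over `R` to linear
algebra over `K`. -/
lemma vd0_vbase (w : R ⊗[K] D.VSec ((AlgHom.id K L : L →ₐ[K] L) : L →+* L)) :
    vd0 (D.vbase R (AlgHom.id K L) w) = D.vbase R G.t (D.d0Id.lTensor R w) := by
  induction w with
  | zero => rw [map_zero, map_zero, map_zero, vd0, vcob0_zero]
  | tmul r θ =>
    refine VSec.ext fun p => ?_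
    have h1 := vact_vmapTo (incRight R G.A) G.univ (genArr G R) (fun _ => rfl) (fun _ => rfl)
      (fun _ => rfl) (vmap θ (G.s : L →+* G.A))
    rw [vd0, vcob0_eq, vev_vbase_tmul, vev_vbase_tmul, LinearMap.lTensor_tmul, vbase_tmul_apply]
    refine (congrArg (fun w => (w - _ : D.VSec _) p) (vact_tsmul _ _ _)).trans ?_
    have h2 := congrArg (fun θ => θ p) h1
    refine (congrArg (fun w => (r ⊗ₜ[K] (1 : G.A)) * w - (r ⊗ₜ 1) * (1 ⊗ₜ (G.t (θ p))))
      h2).trans ?_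
    rw [← mul_sub]
    change (r ⊗ₜ[K] (1 : G.A)) * (1 ⊗ₜ _ - 1 ⊗ₜ (G.t (θ p))) = _
    rw [← TensorProduct.tmul_sub, Algebra.TensorProduct.tmul_mul_tmul, one_mul, mul_one]
    rfl
  | add a b ha hb => rw [map_add, map_add, map_add, ← ha, ← hb, vd0, vcob0_add, vd0, vd0]

lemma vcob1_eq (η : D.VSec (incPt R G.t : L →+* R ⊗[K] G.A)) (φ : R →ₐ[K] T)
    (g : G.Hom y z) (h : G.Hom x y) : vcob1 η φ g h = vact g (vev φ h.hom h.target η) -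
      vev φ (G.comp g h).hom (G.comp g h).target η + vev φ g.hom g.target η := rfl

lemma vcob1_zero (φ : R →ₐ[K] T) (g : G.Hom y z) (h : G.Hom x y) :
    vcob1 (D := D) 0 φ g h = 0 := by
  rw [vcob1_eq, map_zero, map_zero, map_zero, sub_zero, add_zero]
  have := vact_smul g (0 : K) (0 : D.VSec (y : L →+* T))
  rwa [zero_smul, zero_smul] at this

lemma vcob1_add (v w : D.VSec (incPt R G.t : L →+* R ⊗[K] G.A)) (φ : R →ₐ[K] T)
    (g : G.Hom y z) (h : G.Hom x y) : vcob1 (v + w) φ g h = vcob1 v φ g h + vcob1 w φ g h := by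
  rw [vcob1_eq, vcob1_eq, vcob1_eq, map_add, map_add, map_add, vact_add]
  abel

lemma vd1_vbase (w : R ⊗[K] D.VSec (G.t : L →+* G.A)) :
    vd1 (D.vbase R G.t w) = D.vbase R ((pairRight G).comp G.t) (D.d1.lTensor R w) := by
  induction w with
  | zero => rw [map_zero, map_zero, map_zero, vd1, vcob1_zero]
  | tmul r θ =>
    refine VSec.ext fun p => ?_
    have h1 := vact_vmapTo (incRight R (PairRing G)) (pairSnd G) (genSnd G R) (fun _ => rfl)
      (fun _ => rfl) (fun _ => rfl) (D.cochainValue θ (pairFst G))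
    rw [vd1, vcob1_eq, vev_vbase_tmul, vev_vbase_tmul, vev_vbase_tmul, LinearMap.lTensor_tmul,
      vbase_tmul_apply]
    refine (congrArg (fun w => (w - _ + _ : D.VSec _) p) (vact_tsmul _ _ _)).trans ?_
    have h2 := congrArg (fun θ => θ p) h1
    refine (congrArg (fun w => (r ⊗ₜ[K] (1 : PairRing G)) * w - (r ⊗ₜ 1) *
      ((G.comp (genSnd G R) (genFst G R)).hom (θ p)) +
      (r ⊗ₜ 1) * (1 ⊗ₜ ((pairSnd G).hom (θ p)))) h2).trans ?_
    rw [← mul_sub, ← mul_add, ← map_comp_hom]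
    change (r ⊗ₜ[K] (1 : PairRing G)) * (1 ⊗ₜ _ - 1 ⊗ₜ _ + 1 ⊗ₜ _) = _
    rw [← TensorProduct.tmul_sub, ← TensorProduct.tmul_add, Algebra.TensorProduct.tmul_mul_tmul,
      one_mul, mul_one]
    rfl
  | add a b ha hb => rw [map_add, map_add, map_add, ← ha, ← hb, vd1, vcob1_add, vd1, vd1]

end VectorCochains

end EquivariantGroup

/-! ### Linear algebra over `K` after extension of scalars -/

section ExtensionOfScalars

variable {K : Type u} [Field K] {M N V : Type u} [AddCommGroup M] [Module K M] [AddCommGroup N]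
  [Module K N] [AddCommGroup V] [Module K V] {R R' : Type u} [CommRing R] [Algebra K R]
  [CommRing R'] [Algebra K R']

lemma mem_range_lTensor_iff (g : M →ₗ[K] N) (w : R ⊗[K] N) :
    w ∈ LinearMap.range (g.lTensor R) ↔ (LinearMap.range g).mkQ.lTensor R w = 0 :=
  ((lTensor_exact R (LinearMap.exact_map_mkQ_range g) (Submodule.mkQ_surjective _)) w).symm

/-- The ideal of `R` generated by the coordinates of an element of `R ⊗ N`. -/
noncomputable def coordIdeal (w : R ⊗[K] N) : Ideal R :=
  Ideal.span (Set.range fun φ : N →ₗ[K] K => rslice R φ w)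

/-- A tensor vanishes when all its coordinates do. This makes the vanishing of `w` after base change
a closed condition on `Spec R`. -/
lemma rTensor_eq_zero_iff (f : R →ₐ[K] R') (w : R ⊗[K] N) :
    f.toLinearMap.rTensor N w = 0 ↔ coordIdeal w ≤ RingHom.ker f := by
  rw [coordIdeal, Ideal.span_le, Set.range_subset_iff]
  constructor
  · intro h φ
    have h1 := rslice_rTensor f.toLinearMap φ w
    rw [h, map_zero] at h1
    exact h1.symm
  · intro h
    exact eq_zero_of_rslice _ fun φ => (rslice_rTensor _ _ _).trans (h φ)

lemma exists_sum_tmul_basis {ι : Type*} [Fintype ι] (b : Module.Basis ι K N) (w : R ⊗[K] N) :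
    ∃ r : ι → R, w = ∑ i, r i ⊗ₜ b i := by
  refine ⟨fun i => (Algebra.TensorProduct.basis R b).repr w i, ?_⟩
  conv_lhs => rw [← (Algebra.TensorProduct.basis R b).sum_repr w]
  refine Finset.sum_congr rfl fun i _ => ?_
  rw [Algebra.TensorProduct.basis_apply, TensorProduct.smul_tmul', smul_eq_mul, mul_one]

lemma sum_tmul_basis_eq_zero {ι : Type*} [Fintype ι] (b : Module.Basis ι K N) {r : ι → R}
    (h : ∑ i, r i ⊗ₜ[K] b i = 0) (i : ι) : r i = 0 := by
  have h1 : ∑ i, r i • Algebra.TensorProduct.basis R b i = 0 := by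
    rw [← h]
    refine Finset.sum_congr rfl fun i _ => ?_
    rw [Algebra.TensorProduct.basis_apply, TensorProduct.smul_tmul', smul_eq_mul, mul_one]
  exact Fintype.linearIndependent_iff.1 (Algebra.TensorProduct.basis R b).linearIndependent r h1 i

variable (Z : Submodule K N) (d : M →ₗ[K] N)

/-- The cohomology `Z / (im d ∩ Z)` commutes with extension of scalars. -/
lemma exists_eq_sum_add_lTensor {ι : Type*} [Fintype ι]
    (b : Module.Basis ι K (Z ⧸ (LinearMap.range d).submoduleOf Z)) {z : ι → Z}
    (hz : ∀ i, Submodule.Quotient.mk (z i) = b i) (w : R ⊗[K] Z) :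
    ∃ (r : ι → R) (v : R ⊗[K] M),
      Z.subtype.lTensor R w = ∑ i, r i ⊗ₜ (z i : N) + d.lTensor R v := by
  let B := (LinearMap.range d).submoduleOf Z
  obtain ⟨r, hr⟩ := exists_sum_tmul_basis b (B.mkQ.lTensor R w)
  have h1 : B.mkQ.lTensor R (w - ∑ i, r i ⊗ₜ z i) = 0 := by
    rw [map_sub, hr, map_sum, sub_eq_zero]
    exact Finset.sum_congr rfl fun i _ => congrArg (r i ⊗ₜ ·) (hz i).symm
  obtain ⟨w', hw'⟩ := (lTensor_exact R (LinearMap.exact_subtype_mkQ B) B.mkQ_surjective _).1 h1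
  -- `P` consists of the elements with image in `Z`, so `d` maps it onto the coboundaries in `Z`.
  -- Right exactness then lifts the error term to `R ⊗ P`, hence to `R ⊗ M`.
  let P : Submodule K M := Z.comap d
  let e : P →ₗ[K] B :=
    { toFun := fun m => ⟨⟨d m, m.2⟩, ⟨m, rfl⟩⟩
      map_add' := fun m n => Subtype.ext (Subtype.ext (map_add d _ _))
      map_smul' := fun k m => Subtype.ext (Subtype.ext (map_smul d _ _)) }
  have he : Function.Surjective e := fun ⟨⟨n, hn⟩, ⟨m, hm⟩⟩ =>
    ⟨⟨m, by rw [Submodule.mem_comap, hm]; exact hn⟩, Subtype.ext (Subtype.ext hm)⟩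
  obtain ⟨w'', rfl⟩ := LinearMap.lTensor_surjective R he w'
  refine ⟨r, P.subtype.lTensor R w'', ?_⟩
  have h2 : d ∘ₗ P.subtype = Z.subtype ∘ₗ B.subtype ∘ₗ e := rfl
  rw [← LinearMap.comp_apply, ← LinearMap.lTensor_comp, h2, LinearMap.lTensor_comp,
    LinearMap.lTensor_comp, LinearMap.comp_apply, LinearMap.comp_apply, hw', map_sub, map_sum]
  exact (add_sub_cancel _ _).symm

/-- The quotient `Z / (im d ∩ Z)` embeds in `N / im d`, and still does after the flat extension to
`R`; there the relation says that a combination of basis vectors is zero. -/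
lemma eq_zero_of_sum_eq_lTensor {ι : Type*} [Fintype ι]
    (b : Module.Basis ι K (Z ⧸ (LinearMap.range d).submoduleOf Z)) {z : ι → Z}
    (hz : ∀ i, Submodule.Quotient.mk (z i) = b i) {r : ι → R} {v : R ⊗[K] M}
    (h : ∑ i, r i ⊗ₜ (z i : N) = d.lTensor R v) (i : ι) : r i = 0 := by
  let B := (LinearMap.range d).submoduleOf Z
  let j : (Z ⧸ B) →ₗ[K] N ⧸ LinearMap.range d := B.mapQ _ Z.subtype le_rfl
  have hj : Function.Injective j := by
    refine (injective_iff_map_eq_zero _).2 fun q hq => ?_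
    obtain ⟨n, rfl⟩ := B.mkQ_surjective q
    have h2 : (LinearMap.range d).mkQ (Z.subtype n) = 0 := hq
    rw [Submodule.mkQ_apply, Submodule.Quotient.mk_eq_zero] at h2
    exact (Submodule.Quotient.mk_eq_zero B).2 h2
  have h1 : j.lTensor R (∑ i, r i ⊗ₜ b i) = 0 := by
    rw [← (mem_range_lTensor_iff d _).1 ⟨v, rfl⟩, ← h, map_sum, map_sum]
    exact Finset.sum_congr rfl fun i _ => congrArg (r i ⊗ₜ ·) (congrArg j (hz i).symm)
  exact sum_tmul_basis_eq_zero b ((injective_iff_map_eq_zero _).1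
    (Module.Flat.lTensor_preserves_injective_linearMap j hj) _ h1) i

end ExtensionOfScalars

/-! ### Cohomology of a vector group over `R` -/

namespace EquivariantGroup

variable {K L : Type u} [Field K] [Field L] [Algebra K L] {G : AffineGroupoid K L}
  (D : EquivariantGroup G) {R R' : Type u} [CommRing R] [Algebra K R] [CommRing R'] [Algebra K R']

section Injectivity

variable (hlog : Function.Bijective (D.logPt : Pt D.O (RingHom.id L) → D.VSec (RingHom.id L)))
  (hinj : Function.Injective (D.logPt : Pt D.O (G.t : L →+* G.A) → D.VSec (G.t : L →+* G.A)))
  (h0 : D.H0 = ⊥)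

-- Writing `v` as the logarithm of a point `u`, the equation `d⁰ v = 0` says that `u` is fixed by
-- the universal arrow, hence by all arrows.
include hlog hinj h0 in
lemma d0_injective : Function.Injective D.d0 := by
  refine (injective_iff_map_eq_zero _).2 fun v hv => ?_
  obtain ⟨u, rfl⟩ := hlog.2 v
  have hu : u ∈ D.H0 := by
    intro T _ _ x y g
    have h1 : D.act G.univ (D.pull u G.s) = D.pull u G.t := by
      apply hinj
      rw [logPt_act]
      exact sub_eq_zero.1 hv
    have hx : ∀ l, g.hom (G.s l) = x l := g.source
    have hy : ∀ l, g.hom (G.t l) = y l := g.target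
    have e : ∀ {z : L →ₐ[K] G.A} {x : L →ₐ[K] T} (h : ∀ l, g.hom (z l) = x l),
        D.pull u x = Pt.mapTo (g.hom : G.A →+* T) (AlgHom.coe_comm h) (D.pull u z) :=
      fun h => Pt.ext' fun b => by
        rw [Pt.mapTo_hom]
        exact (h _).symm
    rw [e hx, e hy, D.act_mapTo g.hom G.univ g (fun _ => rfl) (AlgHom.coe_comm hx)
      (AlgHom.coe_comm hy), h1]
  rw [h0, Subgroup.mem_bot] at hu
  rw [hu]
  have h2 := D.logPt_mul (1 : Pt D.O (RingHom.id L)) 1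
  rwa [one_mul, left_eq_add] at h2

end Injectivity

variable [Module.Finite L D.prim]

/-- Vanishing of `H⁰` over `K` persists over every `R` because `R` is flat over the field `K`. -/
lemma vd0_injective (h : Function.Injective D.d0)
    (v : D.VSec (incPt R (AlgHom.id K L) : L →+* R ⊗[K] L)) (hv : vd0 v = 0) : v = 0 := by
  obtain ⟨w, rfl⟩ := vbase_bijective.2 v
  rw [vd0_vbase] at hv
  have h1 : D.d0Id.lTensor R w = 0 := vbase_bijective.1 (hv.trans (map_zero _).symm)
  rw [(injective_iff_map_eq_zero _).1
    (Module.Flat.lTensor_preserves_injective_linearMap D.d0Id h) _ h1, map_zero]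

section Classes

variable {D} {ι : Type*} [Fintype ι]

/-- The linear combination of cocycles with coefficients in `R`. -/
noncomputable def vcomb (z : ι → D.Z1) (r : ι → R) : D.VSec (incPt R G.t : L →+* R ⊗[K] G.A) :=
  D.vbase R G.t (∑ i, r i ⊗ₜ (z i : D.VSec (G.t : L →+* G.A)))

omit [Module.Finite L D.prim]

lemma vpush_vcomb (z : ι → D.Z1) (r : ι → R) (f : R →ₐ[K] R') :
    vpush f (vcomb z r) = vcomb z (fun i => f (r i)) := by
  rw [vcomb, vpush_vbase, map_sum]
  rfl

lemma vcomb_sub (z : ι → D.Z1) (r r' : ι → R) : vcomb z (fun i => r i - r' i) =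
    vcomb z r - vcomb z r' := by
  rw [vcomb, vcomb, vcomb, ← map_sub, ← Finset.sum_sub_distrib]
  simp only [TensorProduct.sub_tmul]

lemma vd1_vcomb (z : ι → D.Z1) (r : ι → R) : vd1 (vcomb z r) = 0 := by
  rw [vcomb, vd1_vbase, map_sum, Finset.sum_eq_zero, map_zero]
  intro i _
  rw [LinearMap.lTensor_tmul, (D.mem_Z1_iff _).1 (z i).2, TensorProduct.tmul_zero]

variable [Module.Finite L D.prim] (b : Module.Basis ι K D.VecH1) {z : ι → D.Z1}
  (hz : ∀ i, Submodule.Quotient.mk (z i) = b i)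

include b hz

/-- By flatness the cocycles over `R` are `R ⊗ Z¹`, so their classes are combinations of the basis
of `H¹` with coefficients in `R`. These coefficients become the new coordinates of the representing
scheme. -/
lemma exists_eq_vcomb_add (η : D.VSec (incPt R G.t : L →+* R ⊗[K] G.A)) (hη : vd1 η = 0) :
    ∃ (r : ι → R) (v : _), η = vcomb z r + vd0 v := by
  obtain ⟨w, rfl⟩ := vbase_bijective.2 η
  rw [vd1_vbase] at hη
  have h1 : D.d1.lTensor R w = 0 := vbase_bijective.1 (hη.trans (map_zero _).symm)
  have hex : Function.Exact D.Z1.subtype D.d1 := fun η => by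
    rw [← mem_Z1_iff]
    exact ⟨fun h => ⟨⟨η, h⟩, rfl⟩, fun ⟨a, ha⟩ => ha ▸ a.2⟩
  obtain ⟨w, rfl⟩ := (Module.Flat.lTensor_exact R hex _).1 h1
  obtain ⟨r, v, hrv⟩ := exists_eq_sum_add_lTensor D.Z1 D.d0 b hz w
  refine ⟨r, D.vbase R (AlgHom.id K L) v, ?_⟩
  rw [hrv, map_add]
  exact congrArg (D.vbase R G.t _ + ·) (vd0_vbase v).symm

lemma eq_zero_of_vcomb_eq {r : ι → R} {v : _} (h : vcomb z r = vd0 v) (i : ι) : r i = 0 := by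
  obtain ⟨w, rfl⟩ := vbase_bijective.2 v
  rw [vd0_vbase] at h
  exact eq_zero_of_sum_eq_lTensor D.Z1 D.d0 b hz (vbase_bijective.1 h) i

end Classes

variable {D}

/-- The locus where a `2`-cochain becomes a coboundary is closed. -/
lemma exists_obstruction_ideal
    (β : D.VSec (incPt R ((pairRight G).comp G.t) : L →+* R ⊗[K] PairRing G)) :
    ∃ 𝔞 : Ideal R, ∀ {R' : Type u} [CommRing R'] [Algebra K R'] (f : R →ₐ[K] R'),
      (∃ η, vd1 η = vpush f β) ↔ 𝔞 ≤ RingHom.ker f := by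
  obtain ⟨w, rfl⟩ := vbase_bijective.2 β
  -- Being a coboundary over `R'` means vanishing in `R' ⊗ (C² / im d¹)`, and this quotient is
  -- formed over `K` before the base change.
  refine ⟨coordIdeal ((LinearMap.range D.d1).mkQ.lTensor R w), fun {R'} _ _ f => ?_⟩
  rw [← rTensor_eq_zero_iff, ← LinearMap.comp_apply, LinearMap.rTensor_comp_lTensor,
    ← LinearMap.lTensor_comp_rTensor, LinearMap.comp_apply, ← mem_range_lTensor_iff, vpush_vbase]
  constructor
  · rintro ⟨η, hη⟩
    obtain ⟨w', rfl⟩ := vbase_bijective.2 η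
    rw [vd1_vbase] at hη
    exact ⟨w', vbase_bijective.1 hη⟩
  · rintro ⟨w', hw'⟩
    exact ⟨D.vbase R' G.t w', by rw [vd1_vbase, hw']⟩

end EquivariantGroup

/-! ### Nonabelian cochains and cocycles over `R` -/

namespace EquivariantGroup

variable {K L : Type u} [Field K] [Field L] [Algebra K L] {G : AffineGroupoid K L}
  (W : EquivariantGroup G)

section Cochains

variable (R : Type u) {R' R'' B T T' : Type u} [CommRing R] [Algebra K R] [CommRing R']
  [Algebra K R'] [CommRing R''] [Algebra K R''] [CommRing B] [Algebra K B] [CommRing T]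
  [Algebra K T] [CommRing T'] [Algebra K T']

/-- The group of `0`-cochains over `R`. -/
abbrev C0 : Type u := Pt W.O (incPt R (AlgHom.id K L) : L →+* R ⊗[K] L)

/-- The group of `1`-cochains over `R`. -/
abbrev C1 : Type u := Pt W.O (incPt R G.t : L →+* R ⊗[K] G.A)

variable {W R} {b : L →ₐ[K] B} {x y z : L →ₐ[K] T}

/-- The value of a cochain over `R` at a point. -/
noncomputable def pev (φ : R →ₐ[K] T) (f : B →ₐ[K] T) (h : ∀ l, f (b l) = y l) :
    Pt W.O (incPt R b : L →+* R ⊗[K] B) →* Pt W.O (y : L →+* T) :=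
  Pt.mapTo (evHom φ f : R ⊗[K] B →+* T) (AlgHom.coe_comm (evHom_incPt φ h))

/-- Base change of cochains. -/
noncomputable def ppush (f : R →ₐ[K] R') : Pt W.O (incPt R b : L →+* R ⊗[K] B) →*
    Pt W.O (incPt R' b : L →+* R' ⊗[K] B) :=
  pev ((incLeft R' B).comp f) (incRight R' B) (fun _ => rfl)

lemma pev_ppush (f : R →ₐ[K] R') (φ : R' →ₐ[K] T) (g : B →ₐ[K] T)
    (h : ∀ l, g (b l) = y l) (c : Pt W.O (incPt R b : L →+* R ⊗[K] B)) :
    pev φ g h (ppush f c) = pev (φ.comp f) g h c := by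
  refine Pt.mapTo_mapTo (h := AlgHom.coe_comm (evHom_incPt _ fun _ => rfl)) (fun a => ?_) c
  induction a with
  | zero => simp only [map_zero]
  | tmul r b => simp
  | add a b ha hb => simp only [map_add, ha, hb]

lemma mapTo_pev (φ : R →ₐ[K] T) (g : B →ₐ[K] T) (h : ∀ l, g (b l) = y l) (F : T →ₐ[K] T')
    (φ' : R →ₐ[K] T') (g' : B →ₐ[K] T') {y' : L →ₐ[K] T'} (h' : ∀ l, g' (b l) = y' l)
    (e1 : ∀ r, F (φ r) = φ' r) (e2 : ∀ b, F (g b) = g' b)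
    (e3 : ∀ l, (F : T →+* T') ((y : L →+* T) l) = (y' : L →+* T') l)
    (c : Pt W.O (incPt R b : L →+* R ⊗[K] B)) :
    Pt.mapTo (F : T →+* T') e3 (pev φ g h c) = pev φ' g' h' c := by
  refine Pt.mapTo_mapTo (fun a => ?_) c
  induction a with
  | zero => simp only [map_zero]
  | tmul r b => simp [e1, e2]
  | add a b ha hb => simp only [map_add, ha, hb]

lemma pev_eq_self (c : Pt W.O (incPt R b : L →+* R ⊗[K] B)) (h : ∀ l, incRight R B (b l) =
    incPt R b l) : pev (incLeft R B) (incRight R B) h c = c := by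
  refine Pt.mapTo_eq_self (fun a => ?_) c
  induction a with
  | zero => simp only [map_zero]
  | tmul r b => simp
  | add a b ha hb => simp only [map_add, ha, hb]

lemma ppush_ppush (f : R →ₐ[K] R') (f' : R' →ₐ[K] R'')
    (c : Pt W.O (incPt R b : L →+* R ⊗[K] B)) : ppush f' (ppush f c) = ppush (f'.comp f) c :=
  pev_ppush _ _ _ _ _

/-- The value of a `0`-cochain. -/
noncomputable abbrev val0 (u : W.C0 R) (φ : R →ₐ[K] T) (x : L →ₐ[K] T) : Pt W.O (x : L →+* T) :=
  pev φ x x.apply_id_apply u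

/-- The value of a `1`-cochain. -/
noncomputable abbrev val1 (c : W.C1 R) (φ : R →ₐ[K] T) (g : G.Hom x y) : Pt W.O (y : L →+* T) :=
  pev φ g.hom g.target c

lemma val1_ppush (f : R →ₐ[K] R') (c : W.C1 R) (φ : R' →ₐ[K] T) (g : G.Hom x y) :
    val1 (ppush f c) φ g = val1 c (φ.comp f) g := pev_ppush _ _ _ _ _

lemma C1_ext {c c' : W.C1 R} (h : ∀ {T : Type u} [CommRing T] [Algebra K T] (φ : R →ₐ[K] T)
    {x y : L →ₐ[K] T} (g : G.Hom x y), val1 c φ g = val1 c' φ g) : c = c' := by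
  have h1 := h (incLeft R G.A) (genArr G R)
  rw [← pev_eq_self c (genArr G R).target, ← pev_eq_self c' (genArr G R).target]
  exact h1

/-- The `1`-cocycles over `R`. -/
def IsCocycle (c : W.C1 R) : Prop :=
  ∀ {T : Type u} [CommRing T] [Algebra K T] (φ : R →ₐ[K] T) {x y z : L →ₐ[K] T} (g : G.Hom y z)
    (h : G.Hom x y), val1 c φ (G.comp g h) = val1 c φ g * W.act g (val1 c φ h)

/-- The failure of a `1`-cochain to be a cocycle, at a composable pair. -/
noncomputable def defect (c : W.C1 R) (φ : R →ₐ[K] T) (g : G.Hom y z) (h : G.Hom x y) :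
    Pt W.O (z : L →+* T) :=
  val1 c φ g * W.act g (val1 c φ h) * (val1 c φ (G.comp g h))⁻¹

lemma isCocycle_iff_defect {c : W.C1 R} : IsCocycle c ↔ ∀ {T : Type u} [CommRing T] [Algebra K T]
    (φ : R →ₐ[K] T) {x y z : L →ₐ[K] T} (g : G.Hom y z) (h : G.Hom x y),
    defect c φ g h = 1 := by
  constructor
  · intro hc T _ _ φ x y z g h
    exact mul_inv_eq_one.2 (hc φ g h).symm
  · intro hc T _ _ φ x y z g h
    exact (mul_inv_eq_one.1 (hc φ g h)).symm

lemma mapTo_defect (c : W.C1 R) (φ : R →ₐ[K] T) (g : G.Hom y z) (h : G.Hom x y)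
    (F : T →ₐ[K] T') {φ' : R →ₐ[K] T'} {x' y' z' : L →ₐ[K] T'} {g' : G.Hom y' z'}
    {h' : G.Hom x' y'} (e1 : ∀ r, F (φ r) = φ' r) (e2 : ∀ a, F (g.hom a) = g'.hom a)
    (e3 : ∀ a, F (h.hom a) = h'.hom a)
    (e4 : ∀ a, F ((G.comp g h).hom a) = (G.comp g' h').hom a)
    (ez : ∀ l, (F : T →+* T') ((z : L →+* T) l) = (z' : L →+* T') l) :
    Pt.mapTo (F : T →+* T') ez (defect c φ g h) = defect c φ' g' h' := by
  have ey : ∀ l, F (y l) = y' l := fun l => by rw [← h.target, e3, h'.target]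
  rw [defect, defect, map_mul, map_mul, map_inv, mapTo_pev _ _ _ _ _ _ _ e1 e2,
    mapTo_pev _ _ _ _ _ _ _ e1 e4, ← W.act_mapTo F g g' e2 (AlgHom.coe_comm ey) ez,
    mapTo_pev _ _ _ _ _ _ _ e1 e3]

/-- The defect at the universal composable pair. -/
noncomputable def univDefect (c : W.C1 R) :
    Pt W.O (incPt R ((pairRight G).comp G.t) : L →+* R ⊗[K] PairRing G) :=
  defect c (incLeft R (PairRing G)) (genSnd G R) (genFst G R)

/-- One equation at the universal composable pair suffices, as all other defects are its
specialisations. -/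
lemma isCocycle_iff {c : W.C1 R} : IsCocycle c ↔ univDefect c = 1 := by
  rw [isCocycle_iff_defect]
  refine ⟨fun h => h _ _ _, fun hc T _ _ φ x y z g h => ?_⟩
  obtain ⟨F, e, h1, h2, h3, h4⟩ := exists_vcob1_eq φ g h
  rw [← mapTo_defect c _ _ _ F h1 h2 h3 h4 e]
  exact (congrArg _ hc).trans (map_one _)

lemma univDefect_ppush (f : R →ₐ[K] R') (c : W.C1 R) :
    univDefect (ppush f c) = ppush f (univDefect c) := by
  refine Eq.trans ?_ (mapTo_defect c _ (genSnd G R) (genFst G R)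
    (evHom ((incLeft R' (PairRing G)).comp f) (incRight R' (PairRing G)))
    (φ' := (incLeft R' (PairRing G)).comp f) (g' := genSnd G R') (h' := genFst G R')
    (evHom_incLeft _ _) (fun a => evHom_incRight _ _ _) (fun a => evHom_incRight _ _ _)
    (fun a => ?_) (AlgHom.coe_comm (evHom_incPt _ fun _ => rfl))).symm
  · rw [univDefect, defect, val1_ppush, val1_ppush, val1_ppush]
    rfl
  · rw [← map_comp_hom, ← map_comp_hom]
    exact evHom_incRight _ _ _

lemma IsCocycle.ppush {c : W.C1 R} (hc : IsCocycle c) (f : R →ₐ[K] R') :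
    IsCocycle (ppush f c) := by
  rw [isCocycle_iff, univDefect_ppush, isCocycle_iff.1 hc, map_one]

/-- The action of `0`-cochains on `1`-cochains. -/
noncomputable def conj (u : W.C0 R) (c : W.C1 R) : W.C1 R :=
  val0 u (incLeft R G.A) (incPt R G.t) * c *
    (W.act (genArr G R) (val0 u (incLeft R G.A) (incPt R G.s)))⁻¹

/-- `conj` is defined by its value at the universal arrow; naturality gives the twisted conjugation
formula at every arrow. -/
lemma val1_conj (u : W.C0 R) (c : W.C1 R) (φ : R →ₐ[K] T) (g : G.Hom x y) :
    val1 (conj u c) φ g = val0 u φ y * val1 c φ g * (W.act g (val0 u φ x))⁻¹ := by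
  have ex : ∀ l, evHom φ g.hom (incPt R G.s l) = x l := evHom_incPt φ g.source
  have ey : ∀ l, evHom φ g.hom (incPt R G.t l) = y l := evHom_incPt φ g.target
  have h1 := W.act_mapTo (evHom φ g.hom) (genArr G R) g (evHom_incRight _ _) (AlgHom.coe_comm ex)
    (AlgHom.coe_comm ey) (val0 u (incLeft R G.A) (incPt R G.s))
  rw [mapTo_pev _ _ _ _ φ x x.apply_id_apply (evHom_incLeft _ _) ex] at h1
  have h2 := mapTo_pev (incLeft R G.A) (incPt R G.t) (incPt R G.t).apply_id_apply (evHom φ g.hom)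
    φ y y.apply_id_apply (evHom_incLeft _ _) ey (AlgHom.coe_comm ey) u
  rw [h1, show val0 u φ y = _ from h2.symm, ← map_inv]
  refine (map_mul (pev φ g.hom g.target) _ _).trans ?_
  rw [map_mul]
  rfl

lemma conj_mul (u v : W.C0 R) (c : W.C1 R) : conj (u * v) c = conj u (conj v c) := by
  refine C1_ext fun φ x y g => ?_
  simp only [val1_conj, map_mul, mul_inv_rev, mul_assoc]

lemma conj_one (c : W.C1 R) : conj 1 c = c := by
  refine C1_ext fun φ x y g => ?_
  simp only [val1_conj, map_one, inv_one, mul_one, one_mul]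

lemma IsCocycle.conj {c : W.C1 R} (hc : IsCocycle c) (u : W.C0 R) : IsCocycle (conj u c) := by
  intro T _ _ φ x y z g h
  rw [val1_conj, val1_conj, val1_conj, hc φ g h, map_mul, map_mul, map_inv, W.act_comp]
  group

/-- The automorphisms of cocycles are trivial. -/
def TrivialStabilizers (W : EquivariantGroup G) : Prop :=
  ∀ {R : Type u} [CommRing R] [Algebra K R] (c : W.C1 R) (u : W.C0 R), conj u c = c → u = 1

/-- The classes of cocycles are represented by `X`. -/
def CocyclesRepresentedBy (W : EquivariantGroup G) (X : Type u) [CommRing X] [Algebra K X]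
    (c : W.C1 X) : Prop :=
  IsCocycle c ∧ ∀ {R : Type u} [CommRing R] [Algebra K R] (e : W.C1 R), IsCocycle e →
    ∃! a : X →ₐ[K] R, ∃ u, conj u (ppush a c) = e

end Cochains

end EquivariantGroup

/-! ### Lifting cocycles through a central extension -/

namespace EquivariantGroup

variable {K L : Type u} [Field K] [Field L] [Algebra K L] {G : AffineGroupoid K L}

namespace CentralExt

variable {W' W'' D : EquivariantGroup G} (E : CentralExt W' W'' D)

section Points

variable {T T' : Type u} [CommRing T] [CommRing T'] {x : L →+* T} {x' : L →+* T'}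

/-- The projection of a central extension, on points. -/
noncomputable def proj : Pt W'.O x →* Pt W''.O x where
  toFun u := u.res E.p
  map_mul' u v := E.res_mul u v
  map_one' := by
    have h := E.res_mul (1 : Pt W'.O x) 1
    rw [mul_one] at h
    exact left_eq_mul.1 h

lemma proj_surjective : Function.Surjective (E.proj : Pt W'.O x →* Pt W''.O x) := E.surj

lemma proj_eq_one_iff (u : Pt W'.O x) : E.proj u = 1 ↔ ∃ θ, E.ι θ = u := E.res_eq_one_iff u

lemma proj_ι (θ : D.VSec x) : E.proj (E.ι θ) = 1 := (E.proj_eq_one_iff _).2 ⟨θ, rfl⟩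

lemma ι_zero : E.ι (0 : D.VSec x) = 1 := by
  have h := E.ι_add (0 : D.VSec x) 0
  rw [add_zero] at h
  exact left_eq_mul.1 h

lemma ι_neg (θ : D.VSec x) : E.ι (-θ) = (E.ι θ)⁻¹ :=
  eq_inv_of_mul_eq_one_left (by rw [← E.ι_add, neg_add_cancel, ι_zero])

lemma ι_sub (θ η : D.VSec x) : E.ι (θ - η) = E.ι θ * (E.ι η)⁻¹ := by
  rw [sub_eq_add_neg, E.ι_add, ι_neg]

lemma ι_eq_one_iff (θ : D.VSec x) : E.ι θ = 1 ↔ θ = 0 := by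
  rw [← E.ι_zero]
  exact E.ι_injective.eq_iff

lemma proj_mapTo {φ : T →+* T'} (h : ∀ l, φ (x l) = x' l) (u : Pt W'.O x) :
    E.proj (Pt.mapTo φ h u) = Pt.mapTo φ h (E.proj u) := Pt.mapTo_res _ _ _

lemma mapTo_ι {φ : T →+* T'} (h : ∀ l, φ (x l) = x' l) (θ : D.VSec x) :
    Pt.mapTo φ h (E.ι θ) = E.ι (vmapTo φ h θ) := by
  obtain rfl : φ.comp x = x' := RingHom.ext h
  refine Eq.trans (Pt.ext' fun b => ?_) (E.ι_map φ θ)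
  rw [Pt.mapTo_hom]
  rfl

end Points

section Cochains

variable {R R' B T : Type u} [CommRing R] [Algebra K R] [CommRing R'] [Algebra K R']
  [CommRing B] [Algebra K B] [CommRing T] [Algebra K T] {b : L →ₐ[K] B} {x y z : L →ₐ[K] T}

lemma proj_act (g : G.Hom x y) (u : Pt W'.O (x : L →+* T)) :
    E.proj (W'.act g u) = W''.act g (E.proj u) := E.act_res g u

lemma proj_pev (φ : R →ₐ[K] T) (f : B →ₐ[K] T) (h : ∀ l, f (b l) = y l)
    (c : Pt W'.O (incPt R b : L →+* R ⊗[K] B)) :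
    E.proj (pev φ f h c) = pev φ f h (E.proj c) := E.proj_mapTo _ _

lemma proj_ppush (f : R →ₐ[K] R') (c : Pt W'.O (incPt R b : L →+* R ⊗[K] B)) :
    E.proj (ppush f c) = ppush f (E.proj c) := E.proj_pev _ _ _ _

lemma pev_ι (φ : R →ₐ[K] T) (f : B →ₐ[K] T) (h : ∀ l, f (b l) = y l)
    (η : D.VSec (incPt R b : L →+* R ⊗[K] B)) : pev φ f h (E.ι η) = E.ι (vev φ f h η) :=
  E.mapTo_ι _ _

lemma ppush_ι (f : R →ₐ[K] R') (η : D.VSec (incPt R b : L →+* R ⊗[K] B)) :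
    ppush f (E.ι η) = E.ι (vpush f η) := E.pev_ι _ _ _ _

lemma proj_defect (c : W'.C1 R) (φ : R →ₐ[K] T) (g : G.Hom y z) (h : G.Hom x y) :
    E.proj (defect c φ g h) = defect (E.proj c) φ g h := by
  rw [defect, defect, map_mul, map_mul, map_inv, proj_act, proj_pev, proj_pev, proj_pev]

lemma proj_univDefect (c : W'.C1 R) : E.proj (univDefect c) = univDefect (E.proj c) :=
  E.proj_defect _ _ _ _

/-- The three factors coming from `η` are central, so they can be collected into the abelian
coboundary of `η`. -/
lemma defect_mul_ι (c : W'.C1 R) (η : D.VSec (incPt R G.t : L →+* R ⊗[K] G.A)) (φ : R →ₐ[K] T)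
    (g : G.Hom y z) (h : G.Hom x y) :
    defect (c * E.ι η) φ g h = defect c φ g h * E.ι (vcob1 η φ g h) := by
  have e : ∀ {x y : L →ₐ[K] T} (g : G.Hom x y), val1 (c * E.ι η) φ g =
      val1 c φ g * E.ι (vev φ g.hom g.target η) := fun g => by
    rw [← pev_ι]
    exact map_mul (pev φ g.hom g.target) _ _
  rw [defect, defect, e, e, e, map_mul, E.ι_act, vcob1_eq, E.ι_add, E.ι_sub, mul_inv_rev]
  have h1 := E.ι_comm (vev φ g.hom g.target η)
  have h2 := E.ι_comm (vact g (vev φ h.hom h.target η))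
  have h3 := E.ι_comm (vev φ (G.comp g h).hom (G.comp g h).target η)
  have h4 := fun u => (Commute.inv_left (show Commute _ u from h3 u)).eq
  generalize E.ι (vev φ g.hom g.target η) = a at *
  generalize E.ι (vact g (vev φ h.hom h.target η)) = b at *
  generalize (E.ι (vev φ (G.comp g h).hom (G.comp g h).target η))⁻¹ = d at *
  rw [h4, mul_assoc _ _ (_ * _), mul_assoc _ _ (_ * _), h1]
  simp only [mul_assoc]
  rw [h2 ((val1 c φ (G.comp g h))⁻¹ * _)]
  simp only [mul_assoc]
  rw [← mul_assoc d, h2 (d * a)]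

lemma univDefect_mul_ι (c : W'.C1 R) (η : D.VSec (incPt R G.t : L →+* R ⊗[K] G.A)) :
    univDefect (c * E.ι η) = univDefect c * E.ι (vd1 η) := E.defect_mul_ι _ _ _ _ _

lemma isCocycle_mul_ι {c : W'.C1 R} (hc : IsCocycle c)
    (η : D.VSec (incPt R G.t : L →+* R ⊗[K] G.A)) : IsCocycle (c * E.ι η) ↔ vd1 η = 0 := by
  rw [isCocycle_iff, univDefect_mul_ι, isCocycle_iff.1 hc, one_mul, ι_eq_one_iff]

lemma IsCocycle.proj {c : W'.C1 R} (hc : IsCocycle c) : IsCocycle (E.proj c) := by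
  rw [isCocycle_iff, ← proj_univDefect, isCocycle_iff.1 hc, map_one]

lemma exists_eq_mul_ι {T : Type u} [CommRing T] {x : L →+* T} {u v : Pt W'.O x}
    (h : E.proj u = E.proj v) : ∃ θ, v = u * E.ι θ := by
  obtain ⟨θ, hθ⟩ := (E.proj_eq_one_iff (u⁻¹ * v)).1 (by rw [map_mul, map_inv, h, inv_mul_cancel])
  exact ⟨θ, by rw [hθ, mul_inv_cancel_left]⟩

/-- The locus where a cocycle lifts to a central extension is closed. -/
lemma exists_lifting_ideal [Module.Finite L D.prim] {c : W''.C1 R} (hc : IsCocycle c) :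
    ∃ 𝔞 : Ideal R, ∀ {R' : Type u} [CommRing R'] [Algebra K R'] (f : R →ₐ[K] R'),
      (∃ e : W'.C1 R', IsCocycle e ∧ E.proj e = ppush f c) ↔ 𝔞 ≤ RingHom.ker f := by
  -- Lift `c` merely as a cochain. Its defect is a `2`-cochain `β` of the kernel, and the other
  -- lifts are `c · ι(η)` with defect `β + d η`, so a cocycle lift amounts to solving `d η = -β`.
  obtain ⟨c, rfl⟩ := E.proj_surjective c
  obtain ⟨β, hβ⟩ := (E.proj_eq_one_iff (univDefect c)).1
    (by rw [proj_univDefect, isCocycle_iff.1 hc])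
  obtain ⟨𝔞, h𝔞⟩ := exists_obstruction_ideal (-β)
  refine ⟨𝔞, fun {R'} _ _ f => ?_⟩
  rw [← h𝔞 f]
  have key : ∀ η : D.VSec (incPt R' G.t : L →+* R' ⊗[K] G.A),
      IsCocycle (ppush f c * E.ι η) ↔ vd1 η = vpush f (-β) := fun η => by
    rw [isCocycle_iff, univDefect_mul_ι, univDefect_ppush, ← hβ, ppush_ι, ← E.ι_add, ι_eq_one_iff,
      vpush, vpush, map_neg, add_comm, add_eq_zero_iff_eq_neg]
  constructor
  · rintro ⟨e, he, hec⟩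
    rw [← proj_ppush] at hec
    obtain ⟨η, rfl⟩ := E.exists_eq_mul_ι hec.symm
    exact ⟨η, (key η).1 he⟩
  · rintro ⟨η, hη⟩
    exact ⟨_, (key η).2 hη, by rw [map_mul, proj_ι, mul_one, proj_ppush]⟩

lemma proj_conj (u : W'.C0 R) (c : W'.C1 R) :
    E.proj (conj u c) = conj (E.proj u) (E.proj c) := by
  rw [conj, conj, map_mul, map_mul, map_inv, proj_act, proj_pev, proj_pev]

lemma conj_ι (v : D.VSec (incPt R (AlgHom.id K L) : L →+* R ⊗[K] L)) (c : W'.C1 R) :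
    conj (E.ι v) c = c * E.ι (-vd0 v) := by
  rw [conj, val0, val0, pev_ι, pev_ι, E.ι_act, vd0, vcob0_eq, neg_sub, E.ι_comm, E.ι_sub,
    mul_assoc]

-- The image in `W''` of a stabilizing cochain stabilizes the image of `c`, hence is trivial. So the
-- cochain comes from a section `v` of the kernel, and then it stabilizes `c` only if `d v = 0`.
include E in
lemma trivialStabilizers [Module.Finite L D.prim] (hd : Function.Injective D.d0)
    (h : TrivialStabilizers W'') : TrivialStabilizers W' := by
  intro R _ _ c u hu
  have h1 := congrArg E.proj hu
  rw [proj_conj] at h1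
  obtain ⟨v, rfl⟩ := (E.proj_eq_one_iff u).1 (h _ _ h1)
  rw [conj_ι, mul_eq_left, ι_eq_one_iff, neg_eq_zero] at hu
  rw [ι_eq_one_iff]
  exact vd0_injective D hd v hu

/-! ### The universal family of liftings -/

section Representability

variable {X : Type u} [CommRing X] [Algebra K X] {c : W''.C1 X} {ι : Type u}

/-- The homomorphism from the coordinate ring of the base of a family of cocycles to the
coordinate ring of the family of its liftings. -/
noncomputable def liftingMap (𝔞 : Ideal X) (ι : Type u) : X →ₐ[K] MvPolynomial ι (X ⧸ 𝔞) :=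
  (IsScalarTower.toAlgHom K (X ⧸ 𝔞) (MvPolynomial ι (X ⧸ 𝔞))).comp (Ideal.Quotient.mkₐ K 𝔞)

variable [Fintype ι]

/-- The universal family of liftings of a family of cocycles. -/
noncomputable def liftingFamily {𝔞 : Ideal X} (c₁ : W'.C1 (X ⧸ 𝔞)) (z : ι → D.Z1) :
    W'.C1 (MvPolynomial ι (X ⧸ 𝔞)) :=
  ppush (IsScalarTower.toAlgHom K (X ⧸ 𝔞) (MvPolynomial ι (X ⧸ 𝔞))) c₁ *
    E.ι (vcomb z MvPolynomial.X)

lemma ppush_liftingFamily {𝔞 : Ideal X} (c₁ : W'.C1 (X ⧸ 𝔞)) (z : ι → D.Z1)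
    (a : MvPolynomial ι (X ⧸ 𝔞) →ₐ[K] R) : ppush a (E.liftingFamily c₁ z) =
      ppush (a.comp (IsScalarTower.toAlgHom K (X ⧸ 𝔞) (MvPolynomial ι (X ⧸ 𝔞)))) c₁ *
        E.ι (vcomb z fun i => a (MvPolynomial.X i)) := by
  rw [liftingFamily, map_mul, ppush_ppush, ppush_ι, vpush_vcomb]

variable [Module.Finite L D.prim] (b : Module.Basis ι K D.VecH1) {z : ι → D.Z1}
  (hz : ∀ i, Submodule.Quotient.mk (z i) = b i)
  (hstab : TrivialStabilizers W'') (hrep : CocyclesRepresentedBy W'' X c)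

include hz hstab hrep

/-- Equivalent members of the family have equivalent images, so they lie over the same point of
`Spec X`. Trivial stabilizers downstairs then force the equivalence to come from the kernel, where
it changes the coordinates by a coboundary, hence not at all. -/
lemma liftingFamily_unique {𝔞 : Ideal X} {c₁ : W'.C1 (X ⧸ 𝔞)}
    (hc₁ : E.proj c₁ = ppush (Ideal.Quotient.mkₐ K 𝔞) c)
    (a a' : MvPolynomial ι (X ⧸ 𝔞) →ₐ[K] R) (u : W'.C0 R)
    (hu : conj u (ppush a (E.liftingFamily c₁ z)) = ppush a' (E.liftingFamily c₁ z)) :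
    a = a' := by
  have hp : ∀ a : MvPolynomial ι (X ⧸ 𝔞) →ₐ[K] R, E.proj (ppush a (E.liftingFamily c₁ z)) =
      ppush (a.comp (liftingMap 𝔞 ι)) c := fun a => by
    rw [ppush_liftingFamily, map_mul, proj_ι, mul_one, proj_ppush, hc₁, ppush_ppush]
    rfl
  have h1 := congrArg E.proj hu
  rw [proj_conj, hp, hp] at h1
  have h2 : a.comp (liftingMap 𝔞 ι) = a'.comp (liftingMap 𝔞 ι) :=
    (hrep.2 _ (IsCocycle.ppush hrep.1 _)).unique ⟨_, h1⟩ ⟨1, conj_one _⟩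
  have h3 : a.comp (IsScalarTower.toAlgHom K (X ⧸ 𝔞) (MvPolynomial ι (X ⧸ 𝔞))) =
      a'.comp (IsScalarTower.toAlgHom K (X ⧸ 𝔞) (MvPolynomial ι (X ⧸ 𝔞))) :=
    Ideal.Quotient.algHom_ext _ h2
  rw [h2] at h1
  obtain ⟨v, rfl⟩ := (E.proj_eq_one_iff u).1 (hstab _ _ h1)
  rw [conj_ι, ppush_liftingFamily, ppush_liftingFamily, h3, mul_assoc, mul_right_inj, ← E.ι_add,
    E.ι_injective.eq_iff, ← sub_eq_add_neg, sub_eq_iff_eq_add', ← sub_eq_iff_eq_add,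
    ← vcomb_sub] at hu
  refine AlgHom.coe_ringHom_injective (MvPolynomial.ringHom_ext (fun r => ?_) fun i => ?_)
  · exact congrArg (fun f => f r) h3
  · exact sub_eq_zero.1 (eq_zero_of_vcomb_eq b hz hu i)

include E in
lemma exists_cocyclesRepresentedBy : ∃ (𝔞 : Ideal X) (c' : W'.C1 (MvPolynomial ι (X ⧸ 𝔞))),
    CocyclesRepresentedBy W' (MvPolynomial ι (X ⧸ 𝔞)) c' := by
  obtain ⟨𝔞, h𝔞⟩ := E.exists_lifting_ideal hrep.1
  -- The quotient map has kernel `𝔞` itself, so a lift exists over `X ⧸ 𝔞`. It serves as the origin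
  -- of the family.
  obtain ⟨c₁, hc₁, hcp⟩ := (h𝔞 (Ideal.Quotient.mkₐ K 𝔞)).2 (Ideal.mk_ker).ge
  refine ⟨𝔞, E.liftingFamily c₁ z, (E.isCocycle_mul_ι (hc₁.ppush _) _).2 (vd1_vcomb _ _),
    fun {R} _ _ e he => ?_⟩
  have huniq := fun (a a' : MvPolynomial ι (X ⧸ 𝔞) →ₐ[K] R) u =>
    E.liftingFamily_unique (R := R) b hz hstab hrep hcp a a' u
  obtain ⟨a, ⟨u, hu⟩, -⟩ := hrep.2 _ (IsCocycle.proj E he)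
  -- The equivalence in `W''` lifts to `W'`. Twisting `e` by it makes its image equal, and not just
  -- equivalent, to the pullback of `c`; then `e` and the pullback of `c₁` differ by a cocycle of
  -- the kernel.
  obtain ⟨u, rfl⟩ := E.proj_surjective u
  have he' : IsCocycle (conj u⁻¹ e) := IsCocycle.conj he u⁻¹
  have hpe : E.proj (conj u⁻¹ e) = ppush a c := by
    rw [proj_conj, ← hu, ← conj_mul, map_inv, inv_mul_cancel, conj_one]
  have hker := (h𝔞 a).1 ⟨_, he', hpe⟩
  let a₁ : X ⧸ 𝔞 →ₐ[K] R := Ideal.Quotient.liftₐ 𝔞 a fun r hr => hker hr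
  have ha₁ : a₁.comp (Ideal.Quotient.mkₐ K 𝔞) = a := AlgHom.ext fun r => rfl
  have h1 : E.proj (ppush (b := G.t) a₁ c₁) = E.proj (conj u⁻¹ e) := by
    rw [proj_ppush, hcp, ppush_ppush, ha₁, hpe]
  obtain ⟨η, hη⟩ := E.exists_eq_mul_ι h1
  rw [hη, E.isCocycle_mul_ι (IsCocycle.ppush hc₁ a₁)] at he'
  obtain ⟨r, v, rfl⟩ := exists_eq_vcomb_add b hz η he'
  let a' : MvPolynomial ι (X ⧸ 𝔞) →ₐ[K] R := MvPolynomial.aevalTower a₁ r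
  have ha' : ppush a' (E.liftingFamily c₁ z) = ppush a₁ c₁ * E.ι (vcomb z r) := by
    rw [ppush_liftingFamily]
    congr 3
    · exact AlgHom.ext fun s => MvPolynomial.aevalTower_C _ _ _
    · exact funext fun i => MvPolynomial.aevalTower_X _ _ _
  -- The coboundary part of `η` is absorbed by conjugation with `ι(-v)`, since conjugation by `ι(v)`
  -- subtracts `d v`.
  have hfin : conj (u * E.ι (-v)) (ppush a' (E.liftingFamily c₁ z)) = e := by
    have h2 : -vd0 (-v) = vd0 v := by rw [vd0_neg, neg_neg]
    rw [conj_mul, conj_ι, ha', h2, mul_assoc, ← E.ι_add, ← hη, ← conj_mul, mul_inv_cancel,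
      conj_one]
  refine ⟨a', ⟨_, hfin⟩, fun a'' ⟨u', hu'⟩ => ?_⟩
  refine huniq a'' a' ((u * E.ι (-v))⁻¹ * u') ?_
  rw [conj_mul, hu', ← hfin, ← conj_mul, inv_mul_cancel, conj_one]

end Representability

end Cochains

end CentralExt

end EquivariantGroup

/-! ### The Amitsur complex in low degrees and descent of homomorphisms -/

section Amitsur

variable (S B : Type u) [CommRing S] [CommRing B] [Algebra S B]

namespace Amitsur

/-- The first coface map. -/
noncomputable abbrev d12 : B ⊗[S] B →ₐ[S] B ⊗[S] (B ⊗[S] B) :=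
  Algebra.TensorProduct.map (AlgHom.id S B) Algebra.TensorProduct.includeLeft

/-- The second coface map. -/
noncomputable abbrev d13 : B ⊗[S] B →ₐ[S] B ⊗[S] (B ⊗[S] B) :=
  Algebra.TensorProduct.map (AlgHom.id S B) Algebra.TensorProduct.includeRight

/-- The third coface map. -/
noncomputable abbrev d23 : B ⊗[S] B →ₐ[S] B ⊗[S] (B ⊗[S] B) :=
  Algebra.TensorProduct.includeRight

/-- The differential of the Amitsur complex in degree zero. -/
noncomputable def diff0 : B →ₗ[S] B ⊗[S] B :=
  (Algebra.TensorProduct.includeRight : B →ₐ[S] B ⊗[S] B).toLinearMap -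
    (Algebra.TensorProduct.includeLeft : B →ₐ[S] B ⊗[S] B).toLinearMap

/-- The differential of the Amitsur complex in degree one. -/
noncomputable def diff1 : B ⊗[S] B →ₗ[S] B ⊗[S] (B ⊗[S] B) :=
  (d12 S B).toLinearMap - (d13 S B).toLinearMap + (d23 S B).toLinearMap

variable {S B}

lemma diff0_apply (b : B) : diff0 S B b = 1 ⊗ₜ b - b ⊗ₜ 1 := rfl

lemma diff1_tmul (a b : B) :
    diff1 S B (a ⊗ₜ b) = a ⊗ₜ (b ⊗ₜ 1) - a ⊗ₜ (1 ⊗ₜ b) + 1 ⊗ₜ (a ⊗ₜ b) := rfl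

lemma diff1_diff0 (b : B) : diff1 S B (diff0 S B b) = 0 := by
  rw [diff0_apply, map_sub, diff1_tmul, diff1_tmul]
  abel

variable (S B) in
/-- Contraction of the first two factors. -/
noncomputable def contract (M : Type u) [AddCommGroup M] [Module S M] :
    B ⊗[S] (B ⊗[S] M) →ₗ[S] B ⊗[S] M :=
  (LinearMap.mul' S B).rTensor M ∘ₗ (TensorProduct.assoc S B B M).symm.toLinearMap

lemma contract_tmul {M : Type u} [AddCommGroup M] [Module S M] (a b : B) (m : M) :
    contract S B M (a ⊗ₜ (b ⊗ₜ m)) = (a * b) ⊗ₜ m := rfl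

/-- After tensoring with `B` the covering has a section, and multiplication of the first two factors
is a contracting homotopy. -/
lemma lTensor_diff1_exact : Function.Exact ((diff0 S B).lTensor B) ((diff1 S B).lTensor B) := by
  intro z
  constructor
  · intro hz
    have key : ∀ z : B ⊗[S] (B ⊗[S] B), contract S B (B ⊗[S] B) ((diff1 S B).lTensor B z) +
        (diff0 S B).lTensor B (contract S B B z) = z := by
      intro z
      induction z with
      | zero => simp only [map_zero, add_zero]
      | add a b ha hb =>
        conv_rhs => rw [← ha, ← hb]
        simp only [map_add]
        abel
      | tmul c w =>
        induction w with
        | zero => simp only [TensorProduct.tmul_zero, map_zero, add_zero]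
        | add a b ha hb =>
          rw [TensorProduct.tmul_add]
          conv_rhs => rw [← ha, ← hb]
          simp only [map_add]
          abel
        | tmul a b =>
          rw [LinearMap.lTensor_tmul, diff1_tmul, contract_tmul, LinearMap.lTensor_tmul,
            diff0_apply, TensorProduct.tmul_add, TensorProduct.tmul_sub, TensorProduct.tmul_sub,
            map_add, map_sub, contract_tmul, contract_tmul, contract_tmul, mul_one]
          abel
    refine ⟨contract S B B z, ?_⟩
    have h1 := key z
    rwa [hz, map_zero, zero_add] at h1
  · rintro ⟨w, rfl⟩
    rw [← LinearMap.comp_apply, ← LinearMap.lTensor_comp]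
    have h0 : diff1 S B ∘ₗ diff0 S B = 0 := LinearMap.ext diff1_diff0
    rw [h0, LinearMap.lTensor_zero, LinearMap.zero_apply]

/-- The Amitsur complex of a faithfully flat algebra is exact in degree one. -/
lemma exact_diff1 [Module.FaithfullyFlat S B] : Function.Exact (diff0 S B) (diff1 S B) :=
  (Module.FaithfullyFlat.lTensor_exact_iff_exact S B _ _).1 lTensor_diff1_exact

/-- By faithfully flat descent `S` is the equalizer of the two maps `B ⇉ B ⊗ B`, so the values of
`f` come from unique elements of `S`. -/
lemma exists_of_equalizer [Module.FaithfullyFlat S B] {H : Type u} [CommRing H] (f : H →+* B)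
    (h : ∀ a, f a ⊗ₜ[S] (1 : B) = 1 ⊗ₜ f a) :
    ∃ f' : H →+* S, ∀ a, algebraMap S B (f' a) = f a := by
  have hinj : Function.Injective (algebraMap S B) := FaithfulSMul.algebraMap_injective S B
  have hr : ∀ a, ∃ s, algebraMap S B s = f a := fun a =>
    (Algebra.IsEffective.of_faithfullyFlat S B (f a)).1 (by
      rw [Algebra.TensorProduct.includeLeftSubRight_apply, h, sub_self])
  choose g hg using hr
  exact ⟨{ toFun := g
           map_one' := hinj (by rw [hg, map_one, map_one])
           map_mul' := fun a b => hinj (by rw [hg, map_mul, map_mul, hg, hg])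
           map_zero' := hinj (by rw [hg, map_zero, map_zero])
           map_add' := fun a b => hinj (by rw [hg, map_add, map_add, hg, hg]) }, hg⟩

end Amitsur

end Amitsur

/-! ### Čech cocycles for faithfully flat coverings -/

namespace EquivariantGroup

variable {K L : Type u} [Field K] [Field L] [Algebra K L] {G : AffineGroupoid K L}

lemma exists_section {D : EquivariantGroup G} [Module.Finite L D.prim] {T : Type u} [CommRing T]
    (x : L →+* T) (t : Fin (Module.finrank L D.prim) → T) :
    ∃ θ : D.VSec x, ∀ i, θ (Module.finBasis L D.prim i) = t i := by
  let b := Module.finBasis L D.prim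
  refine ⟨{ toFun := fun p => ∑ i, x (b.repr p i) * t i
            map_add' := fun p q => by
              simp only [map_add, Finsupp.add_apply, add_mul, Finset.sum_add_distrib]
            map_smul' := fun l p => by
              simp only [map_smul, Finsupp.smul_apply, smul_eq_mul, map_mul, Finset.mul_sum,
                mul_assoc] }, fun i => ?_⟩
  change ∑ j, x (b.repr (b i) j) * t j = t i
  rw [Finset.sum_eq_single i]
  · simp
  · intro j _ hj
    rw [b.repr_self, Finsupp.single_eq_of_ne hj, map_zero, zero_mul]
  · simp

lemma VSec.ext_basis {D : EquivariantGroup G} [Module.Finite L D.prim] {T : Type u} [CommRing T]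
    {x : L →+* T} {θ η : D.VSec x}
    (h : ∀ i, θ (Module.finBasis L D.prim i) = η (Module.finBasis L D.prim i)) : θ = η := by
  refine VSec.ext fun p => ?_
  rw [← (Module.finBasis L D.prim).sum_repr p, map_sum, map_sum]
  exact Finset.sum_congr rfl fun i _ => by rw [map_smulₛₗ, map_smulₛₗ, h]

open Amitsur

lemma comp_algebraMap_apply {S B C : Type u} [CommRing S] [CommRing B] [CommRing C] [Algebra S B]
    [Algebra S C] (f : B →ₐ[S] C) (x : L →+* S) (l : L) :
    (f : B →+* C) (((algebraMap S B).comp x) l) = ((algebraMap S C).comp x) l := f.commutes _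

/-- Functoriality of points in `S`-algebras. -/
noncomputable def alongS (W : EquivariantGroup G) {S B C : Type u} [CommRing S] [CommRing B]
    [CommRing C] [Algebra S B] [Algebra S C] (x : L →+* S) (f : B →ₐ[S] C) :
    Pt W.O ((algebraMap S B).comp x) →* Pt W.O ((algebraMap S C).comp x) :=
  Pt.mapTo (f : B →+* C) (comp_algebraMap_apply f x)

lemma alongS_alongS (W : EquivariantGroup G) {S B C C' : Type u} [CommRing S] [CommRing B]
    [CommRing C] [CommRing C'] [Algebra S B] [Algebra S C] [Algebra S C'] (x : L →+* S)
    (f : B →ₐ[S] C) (g : C →ₐ[S] C') (h : B →ₐ[S] C') (hgf : g.comp f = h)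
    (u : Pt W.O ((algebraMap S B).comp x)) : W.alongS x g (W.alongS x f u) = W.alongS x h u :=
  Pt.mapTo_mapTo (fun a => congrArg (fun k => k a) hgf) u

/-- Čech cocycles with values in `W` for faithfully flat coverings are trivial. -/
def CechTrivial (W : EquivariantGroup G) : Prop :=
  ∀ {S B : Type u} [CommRing S] [CommRing B] [Algebra S B] [Module.FaithfullyFlat S B]
    (x : L →+* S) (u : Pt W.O ((algebraMap S (B ⊗[S] B)).comp x)),
    W.alongS x (d13 S B) u = W.alongS x (d12 S B) u * W.alongS x (d23 S B) u →
    ∃ v : Pt W.O ((algebraMap S B).comp x), u =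
      (W.alongS x (Algebra.TensorProduct.includeLeft : B →ₐ[S] B ⊗[S] B) v)⁻¹ *
        W.alongS x (Algebra.TensorProduct.includeRight : B →ₐ[S] B ⊗[S] B) v

/-- The image of `u` in the quotient is a coboundary. A lift of the trivialising point reduces `u`
to a cocycle with values in the kernel, which the Amitsur complex trivialises. -/
lemma CentralExt.cechTrivial {W' W'' D : EquivariantGroup G} (E : CentralExt W' W'' D)
    [Module.Finite L D.prim] (h : CechTrivial W'') : CechTrivial W' := by
  intro S B _ _ _ _ x u hu
  have hproj : ∀ {B C : Type u} [CommRing B] [CommRing C] [Algebra S B] [Algebra S C]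
      (f : B →ₐ[S] C) (u : Pt W'.O ((algebraMap S B).comp x)),
      E.proj (W'.alongS x f u) = W''.alongS x f (E.proj u) := fun f u => E.proj_mapTo _ u
  have hι : ∀ {B C : Type u} [CommRing B] [CommRing C] [Algebra S B] [Algebra S C]
      (f : B →ₐ[S] C) (θ : D.VSec ((algebraMap S B).comp x)), W'.alongS x f (E.ι θ) =
      E.ι (vmapTo (f : B →+* C) (comp_algebraMap_apply f x) θ) := fun f u => E.mapTo_ι _ u
  let i₁ : B →ₐ[S] B ⊗[S] B := Algebra.TensorProduct.includeLeft
  let i₂ : B →ₐ[S] B ⊗[S] B := Algebra.TensorProduct.includeRight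
  have e1 : (d12 S B).comp i₁ = (d13 S B).comp i₁ := AlgHom.ext fun b => by simp [i₁]
  have e2 : (d12 S B).comp i₂ = (d23 S B).comp i₁ := AlgHom.ext fun b => by simp [i₁, i₂]
  have e3 : (d13 S B).comp i₂ = (d23 S B).comp i₂ := AlgHom.ext fun b => by simp [i₂]
  obtain ⟨v, hv⟩ := h x (E.proj u) (by rw [← hproj, hu, map_mul, hproj, hproj])
  obtain ⟨v, rfl⟩ := E.proj_surjective v
  obtain ⟨β, hβ⟩ := (E.proj_eq_one_iff (W'.alongS x i₁ v * u * (W'.alongS x i₂ v)⁻¹)).1 (by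
    rw [map_mul, map_mul, map_inv, hv, hproj, hproj]
    exact (congrArg (· * _) (mul_inv_cancel_left _ _)).trans (mul_inv_cancel _))
  have hcoc : W'.alongS x (d13 S B) (E.ι β) =
      W'.alongS x (d12 S B) (E.ι β) * W'.alongS x (d23 S B) (E.ι β) := by
    rw [hβ]
    simp only [map_mul, map_inv, hu]
    rw [W'.alongS_alongS x i₁ (d12 S B) _ e1, W'.alongS_alongS x i₂ (d12 S B) _ e2,
      W'.alongS_alongS x i₂ (d13 S B) _ e3, W'.alongS_alongS x i₁ (d13 S B) _ rfl,
      W'.alongS_alongS x i₁ (d23 S B) _ rfl, W'.alongS_alongS x i₂ (d23 S B) _ rfl]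
    group
  rw [hι, hι, hι, ← E.ι_add, E.ι_injective.eq_iff] at hcoc
  -- On each vector of a basis of `Vᵛ`, `β` is an additive Amitsur cocycle. The choices for the
  -- basis vectors assemble into a section by `exists_section`.
  have hex : ∀ i, ∃ t, diff0 S B t = β (Module.finBasis L D.prim i) := fun i =>
    (exact_diff1 (S := S) (B := B) _).1 (by
      have h1 := congrArg (fun θ => θ (Module.finBasis L D.prim i)) hcoc
      change d13 S B _ = d12 S B _ + d23 S B _ at h1
      change d12 S B _ - d13 S B _ + d23 S B _ = 0
      rw [h1]
      abel)
  choose t ht using hex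
  obtain ⟨θ, hθ⟩ := exists_section (D := D) ((algebraMap S B).comp x) t
  have hβ' : β = vmapTo (i₂ : B →+* B ⊗[S] B) (comp_algebraMap_apply i₂ x) θ -
      vmapTo (i₁ : B →+* B ⊗[S] B) (comp_algebraMap_apply i₁ x) θ := by
    refine VSec.ext_basis fun i => ?_
    rw [VSec.sub_apply, vmapTo_apply, vmapTo_apply, hθ, ← ht]
    rfl
  refine ⟨E.ι θ * v, ?_⟩
  change u = (W'.alongS x i₁ _)⁻¹ * W'.alongS x i₂ _
  rw [map_mul, map_mul, hι, hι]
  rw [hβ', E.ι_sub] at hβ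
  generalize E.ι (vmapTo (i₂ : B →+* B ⊗[S] B) (comp_algebraMap_apply i₂ x) θ) = b at *
  have hc := E.ι_comm (vmapTo (i₁ : B →+* B ⊗[S] B) (comp_algebraMap_apply i₁ x) θ)
  generalize E.ι (vmapTo (i₁ : B →+* B ⊗[S] B) (comp_algebraMap_apply i₁ x) θ) = a at *
  generalize W'.alongS x i₁ v = v₁ at *
  generalize W'.alongS x i₂ v = v₂ at *
  have h2 : u = v₁⁻¹ * (v₁ * u * v₂⁻¹) * v₂ := by group
  have h3 : a⁻¹ * b = b * a⁻¹ := by rw [inv_mul_eq_iff_eq_mul, ← mul_assoc, hc,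
        mul_inv_cancel_right]
  rw [h2, ← hβ, ← h3]
  group

end EquivariantGroup

/-! ### Sections of torsors and their cocycles -/

section TorsorSections

variable {K L : Type u} [Field K] [Field L] [Algebra K L] {G : AffineGroupoid K L}

namespace TPt

variable {R B T T' T'' : Type u} [CommRing R] [Algebra K R] [CommRing B] [Algebra (R ⊗[K] L) B]
  [CommRing T] [Algebra K T] [CommRing T'] [Algebra K T'] [CommRing T''] [Algebra K T'']
  {φ : R →ₐ[K] T} {x : L →ₐ[K] T} {φ' : R →ₐ[K] T'} {x' : L →ₐ[K] T'}
  {φ'' : R →ₐ[K] T''} {x'' : L →ₐ[K] T''}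

/-- Functoriality of points in the test ring. -/
def mapTo (F : T →ₐ[K] T') (h₁ : ∀ r, F (φ r) = φ' r) (h₂ : ∀ l, F (x l) = x' l)
    (p : TPt B φ x) : TPt B φ' x' :=
  ⟨(F : T →+* T').comp p.hom, fun r l => by simp [p.base, h₁, h₂]⟩

lemma ext' {p q : TPt B φ x} (h : ∀ b, p.hom b = q.hom b) : p = q := TPt.ext (RingHom.ext h)

lemma mapTo_mapTo (F : T →ₐ[K] T') (h₁ : ∀ r, F (φ r) = φ' r) (h₂ : ∀ l, F (x l) = x' l)
    (F' : T' →ₐ[K] T'') (h₁' : ∀ r, F' (φ' r) = φ'' r) (h₂' : ∀ l, F' (x' l) = x'' l)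
    (F'' : T →ₐ[K] T'') (h₁'' : ∀ r, F'' (φ r) = φ'' r) (h₂'' : ∀ l, F'' (x l) = x'' l)
    (h : ∀ a, F' (F a) = F'' a) (p : TPt B φ x) :
    mapTo F' h₁' h₂' (mapTo F h₁ h₂ p) = mapTo F'' h₁'' h₂'' p :=
  ext' fun _ => h _

/-- Yoneda's lemma: the homomorphism is the image of the tautological point `q₀` of `B'`. -/
lemma exists_algHom {B' : Type u} [CommRing B'] [Algebra (R ⊗[K] L) B']
    (Θ : ∀ {T : Type u} [CommRing T] [Algebra K T] {φ : R →ₐ[K] T} {x : L →ₐ[K] T},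
      TPt B' φ x → TPt B φ x)
    (hΘ : ∀ {T T' : Type u} [CommRing T] [Algebra K T] [CommRing T'] [Algebra K T']
      {φ : R →ₐ[K] T} {x : L →ₐ[K] T} {φ' : R →ₐ[K] T'} {x' : L →ₐ[K] T'} (F : T →ₐ[K] T')
      (h₁ : ∀ r, F (φ r) = φ' r) (h₂ : ∀ l, F (x l) = x' l) (q : TPt B' φ x),
      Θ (q.mapTo F h₁ h₂) = (Θ q).mapTo F h₁ h₂) :
    ∃ e : B →ₐ[R ⊗[K] L] B', ∀ {T : Type u} [CommRing T] [Algebra K T] {φ : R →ₐ[K] T}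
      {x : L →ₐ[K] T} (q : TPt B' φ x), q.res e = Θ q := by
  let _ : Algebra K B' :=
    ((algebraMap (R ⊗[K] L) B').comp (algebraMap K (R ⊗[K] L))).toAlgebra
  let j : R ⊗[K] L →ₐ[K] B' := { algebraMap (R ⊗[K] L) B' with commutes' := fun _ => rfl }
  let q₀ : TPt B' (j.comp (incLeft R L)) (j.comp (incRight R L)) := ⟨RingHom.id B', fun r l => by
    change j (r ⊗ₜ l) = j (r ⊗ₜ 1) * j (1 ⊗ₜ l)
    rw [← map_mul, Algebra.TensorProduct.tmul_mul_tmul, one_mul, mul_one]⟩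
  refine ⟨{ (Θ q₀).hom with commutes' := fun z => ?_ }, fun {T} _ _ φ x q => ?_⟩
  · change (Θ q₀).hom _ = j z
    rw [TPt.base_eq]
    exact congrArg (fun f => f z) (evHom_hom j)
  · let F : B' →ₐ[K] T := { q.hom with
      commutes' := fun k => by
        change q.hom (algebraMap (R ⊗[K] L) B' (algebraMap K R k ⊗ₜ 1)) = _
        rw [q.base, map_one, mul_one, AlgHom.commutes] }
    have h₁ : ∀ r, F ((j.comp (incLeft R L)) r) = φ r := fun r => by
      change q.hom (algebraMap (R ⊗[K] L) B' (r ⊗ₜ 1)) = _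
      rw [q.base, map_one, mul_one]
    have h₂ : ∀ l, F ((j.comp (incRight R L)) l) = x l := fun l => by
      change q.hom (algebraMap (R ⊗[K] L) B' (1 ⊗ₜ l)) = _
      rw [q.base, map_one, one_mul]
    exact (hΘ F h₁ h₂ q₀).symm

lemma exists_algEquiv {B' : Type u} [CommRing B'] [Algebra (R ⊗[K] L) B']
    (Θ : ∀ {T : Type u} [CommRing T] [Algebra K T] {φ : R →ₐ[K] T} {x : L →ₐ[K] T},
      TPt B' φ x ≃ TPt B φ x)
    (hΘ : ∀ {T T' : Type u} [CommRing T] [Algebra K T] [CommRing T'] [Algebra K T']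
      {φ : R →ₐ[K] T} {x : L →ₐ[K] T} {φ' : R →ₐ[K] T'} {x' : L →ₐ[K] T'} (F : T →ₐ[K] T')
      (h₁ : ∀ r, F (φ r) = φ' r) (h₂ : ∀ l, F (x l) = x' l) (q : TPt B' φ x),
      Θ (q.mapTo F h₁ h₂) = (Θ q).mapTo F h₁ h₂) :
    ∃ e : B ≃ₐ[R ⊗[K] L] B', ∀ {T : Type u} [CommRing T] [Algebra K T] {φ : R →ₐ[K] T}
      {x : L →ₐ[K] T} (q : TPt B' φ x), q.res e.toAlgHom = Θ q := by
  obtain ⟨e, he⟩ := exists_algHom (fun q => Θ q) hΘ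
  obtain ⟨e', he'⟩ := exists_algHom (fun q => Θ.symm q) fun F h₁ h₂ q => by
    rw [Equiv.symm_apply_eq, hΘ, Equiv.apply_symm_apply]
  -- The uniqueness half of Yoneda's lemma, again by testing on the tautological point.
  have aux : ∀ {C : Type u} [CommRing C] [Algebra (R ⊗[K] L) C] (f : C →ₐ[R ⊗[K] L] C),
      (∀ {T : Type u} [CommRing T] [Algebra K T] {φ : R →ₐ[K] T} {x : L →ₐ[K] T}
        (q : TPt C φ x), q.res f = q) → f = AlgHom.id _ C := by
    intro C _ _ f hf
    let _ : Algebra K C :=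
      ((algebraMap (R ⊗[K] L) C).comp (algebraMap K (R ⊗[K] L))).toAlgebra
    let j : R ⊗[K] L →ₐ[K] C := { algebraMap (R ⊗[K] L) C with commutes' := fun _ => rfl }
    let q₀ : TPt C (j.comp (incLeft R L)) (j.comp (incRight R L)) := ⟨RingHom.id C, fun r l => by
      change j (r ⊗ₜ l) = j (r ⊗ₜ 1) * j (1 ⊗ₜ l)
      rw [← map_mul, Algebra.TensorProduct.tmul_mul_tmul, one_mul, mul_one]⟩
    exact AlgHom.ext fun c => congrArg (fun q => q.hom c) (hf q₀)
  refine ⟨AlgEquiv.ofAlgHom e e' (aux _ fun q => ?_) (aux _ fun q => ?_), fun q => he q⟩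
  · have h1 := he' (q.res e)
    rw [he q, Equiv.symm_apply_apply, ← he q] at h1
    exact h1
  · have h1 := he (q.res e')
    rw [he' q, Equiv.apply_symm_apply, ← he' q] at h1
    exact h1

end TPt

namespace EquivariantTorsor

variable {W : EquivariantGroup G} {R T T' : Type u} [CommRing R] [Algebra K R]
  [CommRing T] [Algebra K T] [CommRing T'] [Algebra K T']
  {φ : R →ₐ[K] T} {x y : L →ₐ[K] T} {φ' : R →ₐ[K] T'} {x' y' : L →ₐ[K] T'}
  (P : EquivariantTorsor W R)

lemma smul_mapTo (F : T →ₐ[K] T') (h₁ : ∀ r, F (φ r) = φ' r) (h₂ : ∀ l, F (x l) = x' l)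
    (p : TPt P.B φ x) (u : Pt W.O (x : L →+* T)) :
    P.smul (p.mapTo F h₁ h₂) (Pt.mapTo (F : T →+* T') (AlgHom.coe_comm h₂) u) =
      (P.smul p u).mapTo F h₁ h₂ := by
  obtain rfl : F.comp φ = φ' := AlgHom.ext h₁
  obtain rfl : F.comp x = x' := AlgHom.ext h₂
  exact (P.smul_map F p u).symm

lemma act_mapTo (F : T →ₐ[K] T') (h₁ : ∀ r, F (φ r) = φ' r) (h₂ : ∀ l, F (x l) = x' l)
    (h₃ : ∀ l, F (y l) = y' l) (g : G.Hom x y) (g' : G.Hom x' y')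
    (hg : ∀ a, F (g.hom a) = g'.hom a) (p : TPt P.B φ x) :
    P.act g' (p.mapTo F h₁ h₂) = (P.act g p).mapTo F h₁ h₃ := by
  obtain rfl : F.comp φ = φ' := AlgHom.ext h₁
  obtain rfl : F.comp x = x' := AlgHom.ext h₂
  obtain rfl : F.comp y = y' := AlgHom.ext h₃
  obtain rfl : g.map F = g' := Arr.ext (AlgHom.ext hg)
  exact (P.act_map F g p).symm

lemma smul_injective (p : TPt P.B φ x) {u v : Pt W.O (x : L →+* T)}
    (h : P.smul p u = P.smul p v) : u = v :=
  (P.existsUnique_smul_eq p (P.smul p v)).unique h rfl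

/-- The sections of a torsor. -/
abbrev Section : Type u := TPt P.B (incLeft R L : R →ₐ[K] R ⊗[K] L) (incRight R L)

variable {P}

/-- The value of a section at a point. -/
noncomputable def Section.val (p : P.Section) (φ : R →ₐ[K] T) (x : L →ₐ[K] T) : TPt P.B φ x :=
  TPt.mapTo (evHom φ x) (evHom_incLeft φ x) (evHom_incRight φ x) p

lemma Section.mapTo_val (p : P.Section) (F : T →ₐ[K] T') (h₁ : ∀ r, F (φ r) = φ' r)
    (h₂ : ∀ l, F (x l) = x' l) : (p.val φ x).mapTo F h₁ h₂ = p.val φ' x' := by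
  refine TPt.mapTo_mapTo _ _ _ _ _ _ _ _ _ (fun a => ?_) p
  induction a with
  | zero => simp only [map_zero]
  | tmul r b => simp [h₁, h₂]
  | add a b ha hb => simp only [map_add, ha, hb]

open EquivariantGroup

/-- The cocycle `c` describes the action of `G` on a section of a torsor. -/
def Section.HasCocycle (p : P.Section) (c : W.C1 R) : Prop :=
  ∀ {T : Type u} [CommRing T] [Algebra K T] (φ : R →ₐ[K] T) {x y : L →ₐ[K] T} (g : G.Hom x y),
    P.act g (p.val φ x) = P.smul (p.val φ y) (val1 c φ g)

/-- The cocycle compares `g p(x)` with `p(y)` for the universal arrow `g : x ⟶ y`; every other arrow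
is a specialisation. -/
lemma Section.exists_hasCocycle (p : P.Section) : ∃ c : W.C1 R, p.HasCocycle c := by
  obtain ⟨c, hc, -⟩ := P.existsUnique_smul_eq (p.val (incLeft R G.A) (incPt R G.t))
    (P.act (genArr G R) (p.val (incLeft R G.A) (incPt R G.s)))
  refine ⟨c, fun {T} _ _ φ x y g => ?_⟩
  have ex : ∀ l, evHom φ g.hom (incPt R G.s l) = x l := evHom_incPt φ g.source
  have ey : ∀ l, evHom φ g.hom (incPt R G.t l) = y l := evHom_incPt φ g.target
  have h1 := P.act_mapTo (evHom φ g.hom) (evHom_incLeft _ _) ex ey (genArr G R) g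
    (evHom_incRight _ _) (p.val (incLeft R G.A) (incPt R G.s))
  rw [Section.mapTo_val, ← hc, ← smul_mapTo, Section.mapTo_val] at h1
  exact h1

lemma Section.HasCocycle.isCocycle {p : P.Section} {c : W.C1 R} (hc : p.HasCocycle c) :
    IsCocycle c := by
  intro T _ _ φ x y z g h
  apply P.smul_injective (p.val φ z)
  rw [← hc, P.act_comp, hc, P.act_smul, hc, P.smul_mul]

lemma Section.val_res {Q : EquivariantTorsor W R} (e : P.B →ₐ[R ⊗[K] L] Q.B) (q : Q.Section)
    (φ : R →ₐ[K] T) (x : L →ₐ[K] T) :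
    (Section.val (P := P) (q.res e : P.Section) φ x) = (q.val φ x).res e := rfl

lemma Section.exists_val_eq_smul (p q : P.Section) : ∃ w : W.C0 R,
    ∀ {T : Type u} [CommRing T] [Algebra K T] (φ : R →ₐ[K] T) (x : L →ₐ[K] T),
      q.val φ x = P.smul (p.val φ x) (val0 w φ x) := by
  obtain ⟨w, hw, -⟩ := P.existsUnique_smul_eq p q
  refine ⟨w, fun φ x => ?_⟩
  rw [← hw]
  exact (P.smul_mapTo (evHom φ x) (evHom_incLeft φ x) (evHom_incRight φ x) p w).symm

/-- The isomorphism transports `q` to a second section of `P`, which is `p` translated by some `w`;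
the two cocycles differ by conjugation with `w⁻¹`. -/
lemma Iso.exists_conj {Q : EquivariantTorsor W R} (h : Iso P Q) {p : P.Section} {q : Q.Section}
    {c c' : W.C1 R} (hc : p.HasCocycle c) (hc' : q.HasCocycle c') : ∃ u, conj u c = c' := by
  obtain ⟨e, h1, h2⟩ := h
  obtain ⟨w, hw⟩ := p.exists_val_eq_smul (q.res e.toAlgHom)
  refine ⟨w⁻¹, C1_ext fun φ x y g => ?_⟩
  have h3 := h2 g (q.val φ x)
  rw [hc', h1] at h3
  rw [← Section.val_res, ← Section.val_res, hw, hw, P.act_smul, hc, ← P.smul_mul,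
    ← P.smul_mul] at h3
  have h4 := P.smul_injective _ h3
  rw [val1_conj, val0, val0, map_inv, map_inv, map_inv, inv_inv, mul_assoc, ← h4,
    inv_mul_cancel_left]

/-- The coordinate of a point with respect to a section. -/
noncomputable def Section.coord (p : P.Section) (q : TPt P.B φ x) : Pt W.O (x : L →+* T) :=
  (P.existsUnique_smul_eq (p.val φ x) q).choose

lemma Section.smul_coord (p : P.Section) (q : TPt P.B φ x) :
    P.smul (p.val φ x) (p.coord q) = q :=
  (P.existsUnique_smul_eq (p.val φ x) q).choose_spec.1

lemma Section.coord_smul (p : P.Section) (u : Pt W.O (x : L →+* T)) :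
    p.coord (P.smul (p.val φ x) u) = u :=
  P.smul_injective _ (p.smul_coord _)

/-- The isomorphism sends `q(x) w` to `p(x) u(x)⁻¹ w`. It respects right translations by
construction, and its compatibility with `G` is the equation `conj u c = c'`. -/
lemma Section.HasCocycle.iso {Q : EquivariantTorsor W R} {p : P.Section} {q : Q.Section}
    {c c' : W.C1 R} (hc : p.HasCocycle c) (hc' : q.HasCocycle c') {u : W.C0 R}
    (hu : conj u c = c') : Iso P Q := by
  let Θ : ∀ {T : Type u} [CommRing T] [Algebra K T] {φ : R →ₐ[K] T} {x : L →ₐ[K] T},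
      TPt Q.B φ x ≃ TPt P.B φ x := fun {T} _ _ φ x =>
    { toFun := fun a => P.smul (p.val φ x) ((val0 u φ x)⁻¹ * q.coord a)
      invFun := fun a => Q.smul (q.val φ x) (val0 u φ x * p.coord a)
      left_inv := fun a => by
        dsimp only
        rw [Section.coord_smul, mul_inv_cancel_left, Section.smul_coord]
      right_inv := fun a => by
        dsimp only
        rw [Section.coord_smul, inv_mul_cancel_left, Section.smul_coord] }
  have hΘ : ∀ {T : Type u} [CommRing T] [Algebra K T] {φ : R →ₐ[K] T} {x : L →ₐ[K] T}
      (w : Pt W.O (x : L →+* T)), Θ (Q.smul (q.val φ x) w) =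
        P.smul (p.val φ x) ((val0 u φ x)⁻¹ * w) := fun w => by
    change P.smul _ (_ * q.coord _) = _
    rw [Section.coord_smul]
  obtain ⟨e, he⟩ := TPt.exists_algEquiv Θ fun {T T'} _ _ _ _ φ x φ' x' F h₁ h₂ a => by
    obtain ⟨w, rfl⟩ : ∃ w, Q.smul (q.val φ x) w = a := ⟨_, q.smul_coord a⟩
    rw [← smul_mapTo, Section.mapTo_val, hΘ, hΘ, ← smul_mapTo, Section.mapTo_val, map_mul, map_inv,
      mapTo_pev _ _ _ _ _ _ _ h₁ h₂]
  refine ⟨e, fun {T} _ _ φ x a w => ?_, fun {T} _ _ φ x y g a => ?_⟩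
  · rw [he, he]
    obtain ⟨v, rfl⟩ : ∃ w, Q.smul (q.val φ x) w = a := ⟨_, q.smul_coord a⟩
    rw [← Q.smul_mul, hΘ, hΘ, ← P.smul_mul, mul_assoc]
  · rw [he, he]
    obtain ⟨v, rfl⟩ : ∃ w, Q.smul (q.val φ x) w = a := ⟨_, q.smul_coord a⟩
    rw [Q.act_smul, hc', ← Q.smul_mul, hΘ, hΘ, P.act_smul, hc, ← P.smul_mul, ← hu, val1_conj,
      map_mul, map_inv]
    congr 1
    group

end EquivariantTorsor

end TorsorSections

/-! ### Torsors defined by cocycles, base change, and existence of sections -/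

section CocyclesOfTorsors

variable {K L : Type u} [Field K] [Field L] [Algebra K L] {G : AffineGroupoid K L}

namespace EquivariantTorsor

open EquivariantGroup

section Trivial

variable (W : EquivariantGroup G) (R : Type u) [CommRing R] [Algebra K R]

/-- The base change of `W` to `R ⊗ L`, with its functor of points. -/
lemma exists_cover : ∃ (B : Type u) (_ : CommRing B) (_ : Algebra (R ⊗[K] L) B),
    Module.FaithfullyFlat (R ⊗[K] L) B ∧
    ∃ τ : ∀ {T : Type u} [CommRing T] [Algebra K T] {φ : R →ₐ[K] T} {x : L →ₐ[K] T},
      TPt B φ x ≃ Pt W.O (x : L →+* T),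
      ∀ {T T' : Type u} [CommRing T] [Algebra K T] [CommRing T'] [Algebra K T'] {φ : R →ₐ[K] T}
        {x : L →ₐ[K] T} (f : T →ₐ[K] T') (p : TPt B φ x),
        τ (p.map f) = (τ p).map (f : T →+* T') := by
  let _ : Algebra L (R ⊗[K] L) := ((incRight R L : L →ₐ[K] R ⊗[K] L) : L →+* R ⊗[K] L).toAlgebra
  have : Nontrivial W.O := (Bialgebra.counitAlgHom L W.O : W.O →+* L).domain_nontrivial
  let τ : ∀ {T : Type u} [CommRing T] [Algebra K T] {φ : R →ₐ[K] T} {x : L →ₐ[K] T},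
      TPt ((R ⊗[K] L) ⊗[L] W.O) φ x ≃ Pt W.O (x : L →+* T) := fun {T} _ _ φ x =>
    { toFun := fun p => ⟨p.hom.comp
        (Algebra.TensorProduct.includeRight : W.O →ₐ[L] (R ⊗[K] L) ⊗[L] W.O).toRingHom,
        fun l => by
          change p.hom (Algebra.TensorProduct.includeRight (algebraMap L W.O l)) = x l
          rw [AlgHom.commutes]
          refine (p.base 1 l).trans ?_
          rw [map_one, one_mul]⟩
      invFun := fun u =>
        letI : Algebra L T := (x : L →+* T).toAlgebra
        ⟨(Algebra.TensorProduct.lift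
          ({ (evHom φ x : R ⊗[K] L →+* T) with
            commutes' := fun l => evHom_incRight φ x l } : R ⊗[K] L →ₐ[L] T)
          ({ u.hom with commutes' := u.base } : W.O →ₐ[L] T)
          (fun _ _ => Commute.all _ _)).toRingHom, fun r l => by
            change Algebra.TensorProduct.lift _ _ _ ((r ⊗ₜ l) ⊗ₜ 1) = _
            rw [Algebra.TensorProduct.lift_tmul, map_one, mul_one]
            exact evHom_tmul φ x r l⟩
      left_inv := fun p => TPt.ext' fun b => by
        let _ : Algebra L T := (x : L →+* T).toAlgebra
        induction b with
        | zero => rw [map_zero, map_zero]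
        | add a b ha hb => rw [map_add, map_add, ha, hb]
        | tmul s b =>
          refine (Algebra.TensorProduct.lift_tmul _ _ (fun _ _ => Commute.all _ _) _ _).trans ?_
          have h1 : (s ⊗ₜ b : (R ⊗[K] L) ⊗[L] W.O) =
              algebraMap (R ⊗[K] L) ((R ⊗[K] L) ⊗[L] W.O) s * (1 ⊗ₜ b) := by
            simp [Algebra.TensorProduct.algebraMap_apply]
          rw [h1, map_mul, TPt.base_eq]
          rfl
      right_inv := fun u => Pt.ext' fun b => by
        let _ : Algebra L T := (x : L →+* T).toAlgebra
        refine (Algebra.TensorProduct.lift_tmul _ _ (fun _ _ => Commute.all _ _) _ _).trans ?_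
        rw [map_one, one_mul]
        rfl }
  exact ⟨(R ⊗[K] L) ⊗[L] W.O, inferInstance, inferInstance, inferInstance, τ,
    fun f p => rfl⟩

variable {W R}

lemma val1_map {T T' : Type u} [CommRing T] [Algebra K T] [CommRing T'] [Algebra K T']
    {x y : L →ₐ[K] T} (c : W.C1 R) (φ : R →ₐ[K] T) (g : G.Hom x y) (f : T →ₐ[K] T') :
    (val1 c φ g).map (f : T →+* T') = val1 c (f.comp φ) (g.map f) := by
  refine Eq.trans (Pt.ext' fun b => (Pt.mapTo_hom _ _ _ _).symm) (mapTo_pev φ g.hom g.target f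
    (f.comp φ) (g.map f).hom (g.map f).target (fun _ => rfl) (fun _ => rfl) (fun _ => rfl) c)

lemma _root_.EquivariantGroup.IsCocycle.val1_one {c : W.C1 R} (hc : IsCocycle c) {T : Type u}
    [CommRing T] [Algebra K T] (φ : R →ₐ[K] T) (x : L →ₐ[K] T) : val1 c φ (G.one x) = 1 := by
  have h := hc φ (G.one x) (G.one x)
  rw [G.one_comp, W.act_one] at h
  exact left_eq_mul.1 h

/-- Twisting the trivial torsor: `W` acts on itself by right multiplication, and an arrow `g` acts
by `p ↦ c(g) ρ(g)(p)`. The cocycle condition is what makes this compatible with composition; the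
section is the unit. -/
lemma exists_of_isCocycle {c : W.C1 R} (hc : IsCocycle c) :
    ∃ (P : EquivariantTorsor W R) (p : P.Section), p.HasCocycle c := by
  obtain ⟨B, _, _, hB, τ, hτ⟩ := exists_cover W R
  have hτs : ∀ {T T' : Type u} [CommRing T] [Algebra K T] [CommRing T'] [Algebra K T']
      {φ : R →ₐ[K] T} {x : L →ₐ[K] T} (f : T →ₐ[K] T') (u : Pt W.O (x : L →+* T)),
      ((τ.symm u : TPt B φ x)).map f = τ.symm (u.map (f : T →+* T') :
        Pt W.O ((f.comp x : L →ₐ[K] T') : L →+* T')) := fun f u => by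
    exact (Equiv.eq_symm_apply _).2 ((hτ f _).trans (by rw [Equiv.apply_symm_apply]))
  let P : EquivariantTorsor W R :=
    { B := B
      faithfullyFlat := hB
      smul := fun p u => τ.symm (τ p * u)
      smul_map := fun {T T'} _ _ _ _ f {φ x} p u => by
        refine (hτs f _).trans (congrArg τ.symm ?_)
        rw [hτ]
        exact Pt.map_mul _ _ _
      smul_one := fun p => by rw [mul_one, Equiv.symm_apply_apply]
      smul_mul := fun p u v => by rw [Equiv.apply_symm_apply, mul_assoc]
      existsUnique_smul_eq := fun p q => ⟨(τ p)⁻¹ * τ q, by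
        dsimp only
        rw [mul_inv_cancel_left, Equiv.symm_apply_apply], fun u hu => by
        rw [← hu, Equiv.apply_symm_apply, inv_mul_cancel_left]⟩
      act := fun {T} _ _ {φ x y} g p => τ.symm (val1 c φ g * W.act g (τ p))
      act_map := fun {T T'} _ _ _ _ f {φ x y} g p => by
        refine (hτs f _).trans (congrArg τ.symm ?_)
        rw [hτ, Pt.map_mul, W.act_map, val1_map]
        rfl
      act_one := fun p => by
        rw [hc.val1_one, one_mul, W.act_one, Equiv.symm_apply_apply]
      act_comp := fun g h p => by
        rw [Equiv.apply_symm_apply, hc, W.act_comp, MonoidHom.map_mul (W.act _), mul_assoc]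
      act_smul := fun g p u => by
        rw [Equiv.apply_symm_apply, Equiv.apply_symm_apply, MonoidHom.map_mul (W.act _),
          mul_assoc] }
  let p : P.Section := (τ.symm 1 : TPt B _ _)
  have hp : ∀ {T : Type u} [CommRing T] [Algebra K T] (φ : R →ₐ[K] T) (x : L →ₐ[K] T),
      τ (p.val φ x : TPt B φ x) = 1 := by
    intro T _ _ φ x
    obtain ⟨F, rfl, rfl⟩ : ∃ F : R ⊗[K] L →ₐ[K] T, F.comp (incLeft R L) = φ ∧
        F.comp (incRight R L) = x :=
      ⟨evHom φ x, AlgHom.ext (evHom_incLeft φ x), AlgHom.ext (evHom_incRight φ x)⟩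
    have h1 : (p.val (F.comp (incLeft R L)) (F.comp (incRight R L)) : TPt B _ _) =
        TPt.map (τ.symm 1 : TPt B (incLeft R L) (incRight R L)) F :=
      TPt.ext' fun b => congrArg (fun f => f ((p : TPt B _ _).hom b)) (evHom_hom F)
    rw [h1, hτ, Equiv.apply_symm_apply]
    exact Pt.map_one _
  refine ⟨P, p, fun {T} _ _ φ x y g => ?_⟩
  change τ.symm (_ * W.act g (τ (p.val φ x : TPt B φ x))) =
    τ.symm (τ (p.val φ y : TPt B φ y) * _)
  rw [hp, hp, map_one, mul_one, one_mul]

end Trivial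

section BaseChange

variable {W : EquivariantGroup G} {R R' : Type u} [CommRing R] [Algebra K R] [CommRing R']
  [Algebra K R'] [Algebra (R ⊗[K] L) (R' ⊗[K] L)] {f : R →ₐ[K] R'}
  (hf : algebraMap (R ⊗[K] L) (R' ⊗[K] L) = (Algebra.TensorProduct.map f (AlgHom.id K L)).toRingHom)
  {P : EquivariantTorsor W R}

lemma exists_hasCocycle_baseChange {p : P.Section} {c : W.C1 R} (hc : p.HasCocycle c) :
    ∃ p' : (P.baseChange hf).Section, p'.HasCocycle (ppush f c) := by
  let p' : (P.baseChange hf).Section :=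
    TPt.ofPt hf (p.val ((incLeft R' L).comp f) (incRight R' L))
  have hp' : ∀ {T : Type u} [CommRing T] [Algebra K T] (φ : R' →ₐ[K] T) (x : L →ₐ[K] T),
      TPt.toPt hf (p'.val φ x) = p.val (φ.comp f) x := by
    intro T _ _ φ x
    refine Eq.trans ?_ (p.mapTo_val (φ := (incLeft R' L).comp f) (x := incRight R' L)
      (evHom φ x) (fun r => evHom_incLeft _ _ _) (evHom_incRight _ _))
    rw [← TPt.toPt_ofPt hf (p.val ((incLeft R' L).comp f) (incRight R' L))]
    rfl
  refine ⟨p', fun {T} _ _ φ x y g => ?_⟩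
  change TPt.ofPt hf (P.act g (TPt.toPt hf (p'.val φ x))) =
    TPt.ofPt hf (P.smul (TPt.toPt hf (p'.val φ y)) _)
  rw [hp', hp', hc, val1_ppush]

end BaseChange

section Sections

variable {W : EquivariantGroup G} {R : Type u} [CommRing R] [Algebra K R]

open Amitsur

section Along

variable (K L R) (C C' C'' : Type u) [CommRing C] [Algebra (R ⊗[K] L) C] [Algebra K C]
  [IsScalarTower K (R ⊗[K] L) C] [CommRing C'] [Algebra (R ⊗[K] L) C'] [Algebra K C']
  [IsScalarTower K (R ⊗[K] L) C'] [CommRing C''] [Algebra (R ⊗[K] L) C''] [Algebra K C'']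
  [IsScalarTower K (R ⊗[K] L) C'']

/-- The structure morphism of an `R ⊗ L`-algebra as an `R`-algebra. -/
abbrev toLeft : R →ₐ[K] C := (IsScalarTower.toAlgHom K (R ⊗[K] L) C).comp (incLeft R L)

/-- The structure morphism of an `R ⊗ L`-algebra as an `L`-algebra. -/
abbrev toRight : L →ₐ[K] C := (IsScalarTower.toAlgHom K (R ⊗[K] L) C).comp (incRight R L)

variable {K L R C C' C''} {P : EquivariantTorsor W R}

/-- Functoriality of points with values in `R ⊗ L`-algebras. -/
def along (f : C →ₐ[R ⊗[K] L] C') (p : TPt P.B (toLeft K L R C) (toRight K L R C)) :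
    TPt P.B (toLeft K L R C') (toRight K L R C') :=
  p.mapTo (f.restrictScalars K) (fun _ => f.commutes _) (fun _ => f.commutes _)

lemma along_smul (f : C →ₐ[R ⊗[K] L] C') (p : TPt P.B (toLeft K L R C) (toRight K L R C))
    (u : Pt W.O ((algebraMap (R ⊗[K] L) C).comp
      ((incRight R L : L →ₐ[K] R ⊗[K] L) : L →+* R ⊗[K] L))) :
    along f (P.smul p u) = P.smul (along f p)
      (W.alongS ((incRight R L : L →ₐ[K] R ⊗[K] L) : L →+* R ⊗[K] L) f u) :=
  (P.smul_mapTo (f.restrictScalars K) (fun _ => f.commutes _) (fun _ => f.commutes _) p u).symm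

lemma along_along (f : C →ₐ[R ⊗[K] L] C') (g : C' →ₐ[R ⊗[K] L] C'') (h : C →ₐ[R ⊗[K] L] C'')
    (hgf : g.comp f = h) (p : TPt P.B (toLeft K L R C) (toRight K L R C)) :
    along g (along f p) = along h p :=
  TPt.ext' fun b => congrArg (fun k => k (p.hom b)) hgf

end Along

/-- The torsor has a tautological point over itself, and it is itself a faithfully flat covering of
`Spec (R ⊗ L)`. The obstruction to descending this point is a Čech cocycle. -/
lemma nonempty_section (hW : CechTrivial W) (P : EquivariantTorsor W R) : Nonempty P.Section := by
  have := P.faithfullyFlat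
  let _ : Algebra K P.B := ((algebraMap (R ⊗[K] L) P.B).comp (algebraMap K (R ⊗[K] L))).toAlgebra
  have _ : IsScalarTower K (R ⊗[K] L) P.B := IsScalarTower.of_algebraMap_eq fun _ => rfl
  let x : L →+* R ⊗[K] L := ((incRight R L : L →ₐ[K] R ⊗[K] L) : L →+* R ⊗[K] L)
  let p₀ : TPt P.B (toLeft K L R P.B) (toRight K L R P.B) := ⟨RingHom.id P.B, fun r l => by
    change algebraMap _ _ (r ⊗ₜ l) = algebraMap _ _ (r ⊗ₜ 1) * algebraMap _ _ (1 ⊗ₜ l)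
    rw [← map_mul, Algebra.TensorProduct.tmul_mul_tmul, one_mul, mul_one]⟩
  let i₁ : P.B →ₐ[R ⊗[K] L] P.B ⊗[R ⊗[K] L] P.B := Algebra.TensorProduct.includeLeft
  let i₂ : P.B →ₐ[R ⊗[K] L] P.B ⊗[R ⊗[K] L] P.B := Algebra.TensorProduct.includeRight
  have e1 : (d12 (R ⊗[K] L) P.B).comp i₁ = (d13 (R ⊗[K] L) P.B).comp i₁ :=
    AlgHom.ext fun b => by simp [i₁]
  have e2 : (d12 (R ⊗[K] L) P.B).comp i₂ = (d23 (R ⊗[K] L) P.B).comp i₁ :=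
    AlgHom.ext fun b => by simp [i₁, i₂]
  have e3 : (d13 (R ⊗[K] L) P.B).comp i₂ = (d23 (R ⊗[K] L) P.B).comp i₂ :=
    AlgHom.ext fun b => by simp [i₂]
  obtain ⟨u, hu, -⟩ := P.existsUnique_smul_eq (along i₁ p₀) (along i₂ p₀)
  have hd : ∀ d : P.B ⊗[R ⊗[K] L] P.B →ₐ[R ⊗[K] L] P.B ⊗[R ⊗[K] L] (P.B ⊗[R ⊗[K] L] P.B),
      along (d.comp i₂) p₀ = P.smul (along (d.comp i₁) p₀) (W.alongS x d u) := fun d => by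
    rw [← along_along i₂ d _ rfl, ← hu, ← along_along i₁ d _ rfl]
    exact along_smul d (along i₁ p₀) u
  have hcoc : W.alongS x (d13 (R ⊗[K] L) P.B) u =
      W.alongS x (d12 (R ⊗[K] L) P.B) u * W.alongS x (d23 (R ⊗[K] L) P.B) u := by
    apply P.smul_injective (along ((d13 (R ⊗[K] L) P.B).comp i₁) p₀)
    refine (hd _).symm.trans ?_
    refine Eq.trans ?_ (P.smul_mul _ _ _).symm
    rw [e3, hd, ← e2, hd, e1]
  obtain ⟨v, hv⟩ := hW x u hcoc
  -- The two pullbacks of `p₀` differ by `u = (i₁ v)⁻¹ (i₂ v)`, so those of `p₀ v⁻¹` coincide and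
  -- the translated point descends.
  let p₁ : TPt P.B (toLeft K L R P.B) (toRight K L R P.B) := P.smul p₀ v⁻¹
  have h1 : along i₁ p₁ = along i₂ p₁ := by
    have h2 := along_smul i₁ p₀ v⁻¹
    have h3 := along_smul i₂ p₀ v⁻¹
    refine h2.trans (Eq.trans ?_ h3.symm)
    rw [← hu, hv]
    refine Eq.trans ?_ (P.smul_mul _ _ _)
    refine congrArg (P.smul _) ?_
    rw [map_inv, map_inv]
    exact (mul_inv_cancel_right _ _).symm
  obtain ⟨f, hf⟩ := exists_of_equalizer (S := R ⊗[K] L) p₁.hom fun a =>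
    congrArg (fun q => q.hom a) h1
  refine ⟨⟨f, fun r l => FaithfulSMul.algebraMap_injective (R ⊗[K] L) P.B ?_⟩⟩
  rw [hf, p₁.base, map_mul]
  rfl

end Sections

end EquivariantTorsor

end CocyclesOfTorsors

/-! ### Representability of the cohomology functor -/

namespace EquivariantGroup

variable {K L : Type u} [Field K] [Field L] [Algebra K L] {G : AffineGroupoid K L}
  {W : EquivariantGroup G}

open EquivariantTorsor

/-- A point `a` of `Spec X` is sent to the torsor of the cocycle `a(c)`. This map is injective
because isomorphic torsors have conjugate cocycles, and surjective because every torsor has a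
section. -/
lemma CocyclesRepresentedBy.h1IsRepresentedBy {X : Type u} [CommRing X] [Algebra K X] {c : W.C1 X}
    (hc : CocyclesRepresentedBy W X c) (hW : CechTrivial W) : W.H1IsRepresentedBy X := by
  choose P p hp using fun (R : Type u) [CommRing R] [Algebra K R] (a : X →ₐ[K] R) =>
    exists_of_isCocycle (IsCocycle.ppush hc.1 a)
  have hbij : ∀ (R : Type u) [CommRing R] [Algebra K R], Function.Bijective
      fun a : X →ₐ[K] R => (Quotient.mk (EquivariantTorsor.setoid W R) (P R a) : W.H1 R) := by
    intro R _ _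
    refine ⟨fun a a' h => ?_, fun q => ?_⟩
    · obtain ⟨u, hu⟩ := Iso.exists_conj (Quotient.exact h) (hp R a) (hp R a')
      exact (hc.2 _ (IsCocycle.ppush hc.1 a')).unique ⟨u, hu⟩ ⟨1, conj_one _⟩
    · obtain ⟨Q, rfl⟩ := Quotient.exists_rep q
      obtain ⟨q⟩ := nonempty_section hW Q
      obtain ⟨e, he⟩ := q.exists_hasCocycle
      obtain ⟨a, ⟨u, hu⟩, -⟩ := hc.2 e he.isCocycle
      exact ⟨a, Quotient.sound (Section.HasCocycle.iso (hp R a) he hu)⟩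
  refine ⟨fun R _ _ => Equiv.ofBijective _ (hbij R), fun {R R'} _ _ _ _ f a => ?_⟩
  let _ : Algebra (R ⊗[K] L) (R' ⊗[K] L) :=
    (Algebra.TensorProduct.map f (AlgHom.id K L)).toRingHom.toAlgebra
  obtain ⟨p', hp'⟩ := exists_hasCocycle_baseChange (f := f) rfl (hp R a)
  exact Quotient.sound (Section.HasCocycle.iso hp' (hp R' (f.comp a)) (u := 1)
    (by rw [conj_one, ppush_ppush]))

section Trivial

variable (hW : ∀ {T : Type u} [CommRing T] {x : L →+* T} (u v : Pt W.O x), u = v)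
include hW

lemma trivialStabilizers_of_subsingleton : TrivialStabilizers W := fun _ _ _ => hW _ _

lemma cechTrivial_of_subsingleton : CechTrivial W := fun _ _ _ => ⟨1, hW _ _⟩

lemma cocyclesRepresentedBy_of_subsingleton : CocyclesRepresentedBy W K 1 :=
  ⟨fun _ _ _ _ _ _ => hW _ _, fun _ _ =>
    ⟨Algebra.ofId K _, ⟨1, hW _ _⟩, fun _ _ => Subsingleton.elim _ _⟩⟩

end Trivial

variable {U : EquivariantGroup G} (hU : IsConilpotent L U.O) [CharZero L] [Algebra.FiniteType L U.O]
  (h0 : ∀ i : ℕ, 1 ≤ i → (U.gr i).H0 = ⊥) (h1 : ∀ i : ℕ, 1 ≤ i → Module.Finite K (U.gr i).VecH1)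

-- Trivial stabilizers and triviality of Čech cocycles travel along with representability: the first
-- gives uniqueness in the next lifting step, the second is needed at the end to return to torsors.
include hU h0 h1 in
lemma exists_cocyclesRepresentedBy_lcsQuot {n : ℕ} (hn : 1 ≤ n) :
    ∃ (X : Type u) (_ : CommRing X) (_ : Algebra K X) (c : (U.lcsQuot n).C1 X),
      CocyclesRepresentedBy (U.lcsQuot n) X c ∧ TrivialStabilizers (U.lcsQuot n) ∧
        CechTrivial (U.lcsQuot n) ∧ Algebra.FiniteType K X ∧ ringKrullDim X ≤
          ((∑ i ∈ Finset.Ico 1 n, Module.finrank K (U.gr i).VecH1 : ℕ) : WithBot ℕ∞) := by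
  induction n, hn using Nat.le_induction with
  | base =>
    have hs := @subsingleton_lcsQuot_one _ _ _ _ _ _ U hU _ _
    refine ⟨K, inferInstance, inferInstance, 1, cocyclesRepresentedBy_of_subsingleton hs,
      trivialStabilizers_of_subsingleton hs, cechTrivial_of_subsingleton hs, inferInstance, ?_⟩
    simp
  | succ n hn ih =>
    obtain ⟨X, _, _, c, hc, hstab, hcech, hft, hdim⟩ := ih
    have := U.finite_prim_gr hU hn
    have := h1 n hn
    have hd := d0_injective (U.gr n) (U.logPt_gr_bijective hU hn)
      (U.logPt_gr_bijective hU hn).injective (h0 n hn)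
    let E := U.lcsExt hU hn
    let b := Module.Free.chooseBasis K (U.gr n).VecH1
    choose z hz using fun i => Submodule.Quotient.mk_surjective _ (b i)
    obtain ⟨𝔞, c', hc'⟩ := E.exists_cocyclesRepresentedBy b hz hstab hc
    have := Algebra.FiniteType.isNoetherianRing K X
    refine ⟨_, _, _, c', hc', E.trivialStabilizers hd hstab, E.cechTrivial hcech,
      Algebra.FiniteType.trans (S := X ⧸ 𝔞) inferInstance inferInstance, ?_⟩
    -- Passing to `X ⧸ 𝔞` does not raise the dimension, and the polynomial variables add the
    -- dimension of `H¹` of the graded piece.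
    rw [MvPolynomial.ringKrullDim_of_isNoetherianRing, Finset.sum_Ico_succ_top hn, Nat.cast_add,
      Nat.card_eq_fintype_card, ← Module.finrank_eq_card_chooseBasisIndex]
    exact add_le_add_left ((ringKrullDim_quotient_le 𝔞).trans hdim) _

end EquivariantGroup

theorem mainTheorem9 {K L : Type u} [Field K] [CharZero K] [Field L] [Algebra K L]
    [FiniteDimensional K L] (G : AffineGroupoid K L) (U : EquivariantGroup G)
    (hU : IsUnipotentGroup L U.O)
    (h0 : ∀ i : ℕ, 1 ≤ i → (U.gr i).H0 = ⊥)
    (h1 : ∀ i : ℕ, 1 ≤ i → Module.Finite K (U.gr i).VecH1)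
    (n : ℕ) (hn : 1 ≤ n) :
    ∃ (X : Type u) (_ : CommRing X) (_ : Algebra K X),
      (U.lcsQuot n).H1IsRepresentedBy X ∧ Algebra.FiniteType K X ∧
        ringKrullDim X ≤
          ((∑ i ∈ Finset.Ico 1 n, Module.finrank K (U.gr i).VecH1 : ℕ) : WithBot ℕ∞) := by
  have := charZero_of_injective_algebraMap (algebraMap K L).injective
  have := hU.1
  obtain ⟨X, _, _, c, hc, -, hcech, hft, hdim⟩ :=
    EquivariantGroup.exists_cocyclesRepresentedBy_lcsQuot hU.isConilpotent h0 h1 hn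
  exact ⟨X, _, _, hc.h1IsRepresentedBy hcech, hft, hdim⟩
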